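/- Let $k\in\mathbb N$ and let $\Lambda$ be a row-finite $k$-graph without sources: a nonempty countable small category with a degree functor $d:\Lambda\to\mathbb N^k$ having the unique factorisation property, such that for every vertex $v$ and every $n\in\mathbb N^k$ the set $v\Lambda^n$ of morphisms of range $v$ and degree $n$ is finite and nonempty. Let $X$ be a regular $\Lambda$-system of $C^*$-correspondences; that is, we are given $C^*$-algebras $A_v$ $(v\in\Lambda^0)$, $A_{r(\lambda)}$–$A_{s(\lambda)}$ correspondences $X_\lambda$ $(\lambda\in\Lambda)$ with left actions $\varphi_\lambda$, and maps of correspondences $\chi_{\alpha,\beta}:X_\alpha\otimes_{A_{s(\alpha)}}X_\beta\to X_{\alpha\beta}$ for composable $\alpha,\beta$, such that (1) $X_v=A_v$ for $v\in\Lambda^0$; (2) $\chi_{\alpha,\beta}$ is an isomorphism if $\alpha\notin\Lambda^0$; (3) $\chi_{r(\lambda),\lambda}(a\otimes\xi)=\varphi_\lambda(a)\xi$ and $\chi_{\lambda,s(\lambda)}(\xi\otimes a)=\xi\cdot a$; (4) $\chi_{\alpha\beta,\gamma}(\chi_{\alpha,\beta}(\xi\otimes\eta)\otimes\zeta)=\chi_{\alpha,\beta\gamma}(\xi\otimes\chi_{\beta,\gamma}(\eta\otimes\zeta))$;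 (5) (regularity) each $X_\lambda$ is nondegenerate as a left module and full as a right Hilbert module, and each $\varphi_\lambda$ is injective with values in the compact operators $\mathcal K(X_\lambda)$. Under these hypotheses every $\chi_{\alpha,\beta}$ is an isomorphism. An infinite path is a degree-preserving functor $x:\Omega_k\to\Lambda$, where $\Omega_k=\{(m,n)\in\mathbb N^k\times\mathbb N^k: m\le n\}$ with $r(m,n)=m$, $s(m,n)=n$, $d(m,n)=n-m$; put $\sigma^p(x)(m,n)=x(m+p,n+p)$, and write $x=\lambda z$ if $x(0,d(\lambda))=\lambda$ and $\sigma^{d(\lambda)}(x)=z$. Let $G_\Lambda$ be the set of the triples $(x,n,y)$, with $x,y$ infinite paths and $n\in\mathbb Z^k$, such that $\sigma^\ell(x)=\sigma^m(y)$ and $n=\ell-m$ for some $\ell,m\in\mathbb N^k$. For an infinite path $x$ the fibre algebra is the $C^*$-algebraic inductive limit $E_x=\varinjlim_{n\in\mathbb N^k}\mathcal K(X_{x(0,n)})$ with the connecting maps $T\mapsto T'$, $T'\chi(\xi\otimes\eta)=\chi(T\xi\otimes\eta)$ for $\xi\in X_{x(0,m)}$, $\eta\in X_{x(m,n)}$.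 For $g=(x,n,y)\in G_\Lambda$ let $D_g$ be the directed set of the pairs $(\lambda,\mu)$ such that $x=\lambda z$ and $y=\mu z$ for some infinite path $z$ and $d(\lambda)-d(\mu)=n$, with $(\lambda,\mu)\le(\lambda',\mu')$ if and only if $d(\lambda)\le d(\lambda')$; in this case $\lambda'=\lambda\nu$ and $\mu'=\mu\nu$ for a unique $\nu$. Let $L_g=\varinjlim_{(\lambda,\mu)\in D_g}\mathcal K(X_\lambda\oplus X_\mu)$, with the connecting maps $T\mapsto T\otimes 1$ for the identification $(X_\lambda\oplus X_\mu)\otimes X_\nu= X_{\lambda\nu}\oplus X_{\mu\nu}$ given by $\chi_{\lambda,\nu}$ and $\chi_{\mu,\nu}$. Let $P_x,P_y\in M(L_g)$ be the multipliers given by the projections $P_\lambda,P_\mu$ of $X_\lambda\oplus X_\mu$ onto $X_\lambda$ and $X_\mu$, and put $$E_g=P_xL_gP_y .$$ Then for every $g=(x,n,y)\in G_\Lambda$: (a) The fibre algebras $E_x$ and $E_y$ are Morita–Rieffel equivalent. (b) There are injective $*$-homomorphisms $\Phi_x:E_x\to L_g$ with range $P_xL_gP_x$ and $\Phi_y:E_y\to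 L_g$ with range $P_yL_gP_y$, which for each $(\lambda,\mu)\in D_g$ take the image in $E_x$ of $T\in\mathcal K(X_\lambda)$ to the image in $L_g$ of $T\oplus0$, and the image in $E_y$ of $T\in\mathcal K(X_\mu)$ to the image in $L_g$ of $0\oplus T$. With these identifications $E_g$ is an $E_x$–$E_y$ imprimitivity bimodule: its norm is that of $L_g$, its actions are $b\cdot e=\Phi_x(b)e$ and $e\cdot c=e\Phi_y(c)$, and its inner products are determined by $\Phi_x({}_{E_x}\langle e,f\rangle)=ef^*$ and $\Phi_y(\langle e,f\rangle_{E_y})=e^*f$. (c) As a Banach space, $E_g$ is the inductive limit of the spaces $\mathcal K(X_\mu,X_\lambda)$: there is an isometric linear isomorphism $$\varinjlim_{(\lambda,\mu)\in D_g}\mathcal K(X_\mu,X_\lambda)\;\cong\;E_g$$ which takes the class of $T\in\mathcal K(X_\mu,X_\lambda)=P_\lambda\mathcal K(X_\lambda\oplus X_\mu)P_\mu$ to the image of $T$ in $L_g$; the connecting maps on the left are given by $T'\chi_{\mu,\nu}(\xi\otimes\eta)=\chi_{\lambda,\nu}(T\xi\otimes\eta)$. -/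

import Mathlib

noncomputable section

set_option linter.unusedSectionVars false
set_option linter.unusedVariables false

namespace HilbertMod

open scoped RightActions
open MulOpposite (op unop)

/-- `H` is a right pre-Hilbert `B`-module whose norm is `‖x‖ = ‖⟨x, x⟩_B‖^{1/2}`; it is a right
Hilbert `B`-module if `H` is moreover complete.  Mathlib's `CStarModule` is the class of *left*
modules, so a right `B`-module is a `CStarModule` over the opposite algebra `Bᵐᵒᵖ`; the right action
of `b` on `x` is `x <• b = op b • x`. -/
abbrev RightHilbertModule (B H : Type*) [NonUnitalCStarAlgebra B] [PartialOrder B]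
    [NormedAddCommGroup H] [NormedSpace ℂ H] [SMul Bᵐᵒᵖ H] : Type _ := CStarModule Bᵐᵒᵖ H

section Basic

variable (B : Type*) [NonUnitalCStarAlgebra B] [PartialOrder B] [StarOrderedRing B]
  {H H₁ H₂ H₃ : Type*}
  [NormedAddCommGroup H] [NormedSpace ℂ H] [SMul Bᵐᵒᵖ H] [RightHilbertModule B H]
  [NormedAddCommGroup H₁] [NormedSpace ℂ H₁] [SMul Bᵐᵒᵖ H₁] [RightHilbertModule B H₁]
  [NormedAddCommGroup H₂] [NormedSpace ℂ H₂] [SMul Bᵐᵒᵖ H₂] [RightHilbertModule B H₂]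
  [NormedAddCommGroup H₃] [NormedSpace ℂ H₃] [SMul Bᵐᵒᵖ H₃] [RightHilbertModule B H₃]

/-- The `B`-valued inner product `⟨x, y⟩_B` of a right Hilbert `B`-module `H`, linear in the second
variable. -/
def rinner (x y : H) : B := unop (inner Bᵐᵒᵖ x y)

lemma rinner_add_right (x y z : H) : rinner B x (y + z) = rinner B x y + rinner B x z := by
  simp [rinner]

lemma rinner_add_left (x y z : H) : rinner B (x + y) z = rinner B x z + rinner B y z := by
  simp [rinner]

lemma rinner_smul_right (c : ℂ) (x y : H) : rinner B x (c • y) = c • rinner B x y := by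
  simp [rinner]

lemma rinner_smul_left (c : ℂ) (x y : H) : rinner B (c • x) y = star c • rinner B x y := by
  simp [rinner]

lemma rinner_sub_right (x y z : H) : rinner B x (y - z) = rinner B x y - rinner B x z := by
  simp [rinner]

lemma rinner_sub_left (x y z : H) : rinner B (x - y) z = rinner B x z - rinner B y z := by
  simp [rinner]

lemma rinner_zero_right (x : H) : rinner B x 0 = 0 := by
  simp [rinner]

lemma rinner_zero_left (x : H) : rinner B 0 x = 0 := by
  simp [rinner]

lemma rinner_rsmul_right (x y : H) (b : B) : rinner B x (y <• b) = rinner B x y * b := by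
  simp [rinner]

lemma rinner_rsmul_left (x y : H) (b : B) : rinner B (x <• b) y = star b * rinner B x y := by
  simp [rinner]

lemma star_rinner (x y : H) : star (rinner B x y) = rinner B y x := by
  rw [rinner, ← MulOpposite.unop_star, CStarModule.star_inner, rinner]

lemma rinner_self_eq_zero {x : H} : rinner B x x = 0 ↔ x = 0 := by
  rw [rinner, MulOpposite.unop_eq_zero_iff, CStarModule.inner_self]

lemma norm_rinner_le (x y : H) : ‖rinner B x y‖ ≤ ‖x‖ * ‖y‖ := by
  have := CStarModule.norm_inner_le (A := Bᵐᵒᵖ) H (x := x) (y := y)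
  rwa [← MulOpposite.norm_unop] at this

lemma norm_sq_eq (x : H) : ‖x‖ ^ 2 = ‖rinner B x x‖ := by
  have := CStarModule.norm_sq_eq Bᵐᵒᵖ (x := x)
  rwa [← MulOpposite.norm_unop] at this

lemma ext_rinner {x y : H} (h : ∀ z, rinner B z x = rinner B z y) : x = y := by
  rw [← sub_eq_zero, ← rinner_self_eq_zero B, rinner_sub_right, h, sub_self]

lemma continuous_rinner : Continuous (fun p : H × H => rinner B p.1 p.2) :=
  MulOpposite.continuous_unop.comp CStarModule.continuous_inner

lemma add_rsmul (x y : H) (b : B) : (x + y) <• b = x <• b + y <• b :=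
  ext_rinner B fun z => by simp [rinner_rsmul_right, rinner_add_right, add_mul]

lemma rsmul_add (x : H) (b c : B) : x <• (b + c) = x <• b + x <• c :=
  ext_rinner B fun z => by
    rw [rinner_add_right, rinner_rsmul_right, rinner_rsmul_right, rinner_rsmul_right, mul_add]

lemma rsmul_smul (x : H) (r : ℂ) (b : B) : x <• (r • b) = r • (x <• b) :=
  ext_rinner B fun z => by
    rw [rinner_rsmul_right, rinner_smul_right, rinner_rsmul_right, mul_smul_comm]

lemma smul_rsmul (x : H) (r : ℂ) (b : B) : (r • x) <• b = r • (x <• b) :=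
  ext_rinner B fun z => by
    rw [rinner_rsmul_right, rinner_smul_right, rinner_smul_right, rinner_rsmul_right,
      smul_mul_assoc]

lemma rsmul_rsmul (x : H) (b c : B) : (x <• b) <• c = x <• (b * c) :=
  ext_rinner B fun z => by
    rw [rinner_rsmul_right, rinner_rsmul_right, rinner_rsmul_right, mul_assoc]

lemma norm_rsmul_le (x : H) (b : B) : ‖x <• b‖ ≤ ‖x‖ * ‖b‖ := by
  refine abs_le_of_sq_le_sq' ?_ (by positivity) |>.2
  rw [norm_sq_eq B, rinner_rsmul_right, rinner_rsmul_left]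
  calc ‖star b * rinner B x x * b‖ ≤ ‖star b‖ * ‖rinner B x x‖ * ‖b‖ := norm_mul₃_le
    _ = (‖x‖ * ‖b‖) ^ 2 := by rw [norm_star, ← norm_sq_eq B]; ring

/-- `S` is an adjoint of `T`: `⟨T x, y⟩ = ⟨x, S y⟩` for all `x`, `y`. -/
def IsAdjointPair (T : H₁ →L[ℂ] H₂) (S : H₂ →L[ℂ] H₁) : Prop :=
  ∀ x y, rinner B (T x) y = rinner B x (S y)

variable {B} in
lemma IsAdjointPair.symm {T : H₁ →L[ℂ] H₂} {S : H₂ →L[ℂ] H₁} (h : IsAdjointPair B T S) :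
    IsAdjointPair B S T := fun x y => by
  rw [← star_rinner, ← h, star_rinner]

variable {B} in
lemma IsAdjointPair.unique {T : H₁ →L[ℂ] H₂} {S S' : H₂ →L[ℂ] H₁} (h : IsAdjointPair B T S)
    (h' : IsAdjointPair B T S') : S = S' := by
  ext y
  exact ext_rinner B fun z => by rw [← h, h']

variable {B} in
lemma IsAdjointPair.map_rsmul {T : H₁ →L[ℂ] H₂} {S : H₂ →L[ℂ] H₁} (h : IsAdjointPair B T S)
    (x : H₁) (b : B) : T (x <• b) = T x <• b :=
  ext_rinner B fun z => by
    rw [← h.symm, rinner_rsmul_right, rinner_rsmul_right, h.symm]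

variable {B} in
lemma IsAdjointPair.comp {T : H₁ →L[ℂ] H₂} {S : H₂ →L[ℂ] H₁} {T' : H₂ →L[ℂ] H₃}
    {S' : H₃ →L[ℂ] H₂} (h : IsAdjointPair B T S) (h' : IsAdjointPair B T' S') :
    IsAdjointPair B (T'.comp T) (S.comp S') := fun x y => by
  exact (h' (T x) y).trans (h x (S' y))

variable {B} in
lemma IsAdjointPair.norm_le {T : H₁ →L[ℂ] H₂} {S : H₂ →L[ℂ] H₁} (h : IsAdjointPair B T S) :
    ‖S‖ ≤ ‖T‖ := by
  refine S.opNorm_le_bound (norm_nonneg _) fun y => ?_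
  by_cases h0 : ‖S y‖ = 0
  · rw [h0]; positivity
  have h1 : ‖S y‖ ^ 2 ≤ ‖T‖ * ‖S y‖ * ‖y‖ := by
    rw [norm_sq_eq B, ← h]
    exact (norm_rinner_le B _ _).trans (by gcongr; exact T.le_opNorm _)
  have h2 : 0 < ‖S y‖ := lt_of_le_of_ne (norm_nonneg _) (Ne.symm h0)
  nlinarith

variable {B} in
lemma IsAdjointPair.norm_eq {T : H₁ →L[ℂ] H₂} {S : H₂ →L[ℂ] H₁} (h : IsAdjointPair B T S) :
    ‖S‖ = ‖T‖ := le_antisymm h.norm_le h.symm.norm_le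

variable {B} in
lemma IsAdjointPair.norm_sq_le {T : H₁ →L[ℂ] H₂} {S : H₂ →L[ℂ] H₁} (h : IsAdjointPair B T S) :
    ‖T‖ * ‖T‖ ≤ ‖S.comp T‖ := by
  have : ‖T‖ ≤ √‖S.comp T‖ := by
    refine T.opNorm_le_bound (by positivity) fun x => ?_
    refine abs_le_of_sq_le_sq' ?_ (by positivity) |>.2
    rw [norm_sq_eq B, h, mul_pow, Real.sq_sqrt (norm_nonneg _)]
    calc _ ≤ ‖x‖ * ‖S.comp T x‖ := norm_rinner_le B _ _
      _ ≤ ‖x‖ * (‖S.comp T‖ * ‖x‖) := by gcongr; exact (S.comp T).le_opNorm x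
      _ = _ := by ring
  calc _ ≤ √‖S.comp T‖ * √‖S.comp T‖ := by gcongr
    _ = _ := Real.mul_self_sqrt (norm_nonneg _)

/-- The rank-one operator `θ_{ξ, η} : ζ ↦ ξ · ⟨η, ζ⟩_B`. -/
def rankOne (ξ : H₂) (η : H₁) : H₁ →L[ℂ] H₂ :=
  LinearMap.mkContinuous
    { toFun := fun ζ => ξ <• rinner B η ζ
      map_add' := fun x y => by rw [rinner_add_right, rsmul_add]
      map_smul' := fun c x => by rw [rinner_smul_right, rsmul_smul]; rfl }
    (‖ξ‖ * ‖η‖) (fun ζ => by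
      calc ‖ξ <• rinner B η ζ‖ ≤ ‖ξ‖ * ‖rinner B η ζ‖ := norm_rsmul_le B _ _
        _ ≤ ‖ξ‖ * (‖η‖ * ‖ζ‖) := by gcongr; exact norm_rinner_le B _ _
        _ = _ := by ring)

lemma rankOne_apply (ξ : H₂) (η ζ : H₁) : rankOne B ξ η ζ = ξ <• rinner B η ζ := rfl

lemma rankOne_isAdjointPair (ξ : H₂) (η : H₁) :
    IsAdjointPair B (rankOne B ξ η) (rankOne B η ξ) := fun x y => by
  rw [rankOne_apply, rankOne_apply, rinner_rsmul_left, rinner_rsmul_right, star_rinner]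

variable (H₁ H₂) in
/-- `𝒦(H₁, H₂)`: the norm closure of the linear span of the rank-one operators, with the operator
norm. -/
def compacts : Submodule ℂ (H₁ →L[ℂ] H₂) :=
  (Submodule.span ℂ {T | ∃ ξ η, T = rankOne B ξ η}).topologicalClosure

lemma rankOne_mem (ξ : H₂) (η : H₁) : rankOne B ξ η ∈ compacts B H₁ H₂ :=
  Submodule.le_topologicalClosure _ (Submodule.subset_span ⟨ξ, η, rfl⟩)

lemma isClosed_compacts : IsClosed (compacts B H₁ H₂ : Set (H₁ →L[ℂ] H₂)) :=
  Submodule.isClosed_topologicalClosure _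

/-- A closed subspace containing the rank-one operators contains the compact operators. -/
lemma compacts_induction {F : Type*} [NormedAddCommGroup F] [NormedSpace ℂ F]
    (f : (H₁ →L[ℂ] H₂) →L[ℂ] F) (N : Submodule ℂ F) (hN : IsClosed (N : Set F))
    (h : ∀ ξ η, f (rankOne B ξ η) ∈ N) {T : H₁ →L[ℂ] H₂} (hT : T ∈ compacts B H₁ H₂) :
    f T ∈ N := by
  have : compacts B H₁ H₂ ≤ N.comap f.toLinearMap := by
    refine Submodule.topologicalClosure_minimal _ ?_ (hN.preimage f.continuous)
    rw [Submodule.span_le]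
    rintro _ ⟨ξ, η, rfl⟩
    exact h ξ η
  exact this hT

lemma comp_mem_compacts_left {R : H₂ →L[ℂ] H₃} {R' : H₃ →L[ℂ] H₂} (hR : IsAdjointPair B R R')
    {T : H₁ →L[ℂ] H₂} (hT : T ∈ compacts B H₁ H₂) : R.comp T ∈ compacts B H₁ H₃ := by
  refine compacts_induction B (ContinuousLinearMap.compL ℂ H₁ H₂ H₃ R) _ (isClosed_compacts B)
    (fun ξ η => ?_) hT
  have : R.comp (rankOne B ξ η) = rankOne B (R ξ) η := by
    ext ζ
    simp [rankOne_apply, hR.map_rsmul]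
  have h2 := rankOne_mem B (R ξ) η
  rw [← this] at h2
  exact h2

lemma comp_mem_compacts_right {R : H₁ →L[ℂ] H₂} {R' : H₂ →L[ℂ] H₁} (hR : IsAdjointPair B R R')
    {T : H₂ →L[ℂ] H₃} (hT : T ∈ compacts B H₂ H₃) : T.comp R ∈ compacts B H₁ H₃ := by
  refine compacts_induction B ((ContinuousLinearMap.compL ℂ H₁ H₂ H₃).flip R) _
    (isClosed_compacts B) (fun ξ η => ?_) hT
  have : (rankOne B ξ η).comp R = rankOne B ξ (R' η) := by
    ext ζ
    simp [rankOne_apply, ← hR.symm _ _]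
  have h2 := rankOne_mem B ξ (R' η)
  rw [← this] at h2
  exact h2

variable [CompleteSpace H₁] [CompleteSpace H₂]

/-- The operators with an adjoint in a given closed set form a closed set. -/
lemma isClosed_exists_adjoint (N : Set (H₂ →L[ℂ] H₁)) (hN : IsClosed N) :
    IsClosed {T : H₁ →L[ℂ] H₂ | ∃ S ∈ N, IsAdjointPair B T S} := by
  refine isClosed_of_closure_subset fun T hT => ?_
  obtain ⟨u, hu, hlim⟩ := mem_closure_iff_seq_limit.mp hT
  choose S hS hS' using hu
  have hcau : CauchySeq S := by
    have hu' := hlim.cauchySeq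
    rw [Metric.cauchySeq_iff] at hu' ⊢
    intro ε hε
    obtain ⟨N, hN⟩ := hu' ε hε
    refine ⟨N, fun m hm n hn => ?_⟩
    have : IsAdjointPair B (u m - u n) (S m - S n) := fun x y => by
      simp [rinner_sub_left, rinner_sub_right, hS' m x y, hS' n x y]
    rw [dist_eq_norm, this.norm_eq, ← dist_eq_norm]
    exact hN m hm n hn
  obtain ⟨S₀, hS₀⟩ := cauchySeq_tendsto_of_complete hcau
  refine ⟨S₀, hN.mem_of_tendsto hS₀ (Filter.Eventually.of_forall hS), fun x y => ?_⟩
  have h1 : Filter.Tendsto (fun n => rinner B (u n x) y) Filter.atTop (nhds (rinner B (T x) y)) :=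
    ((continuous_rinner B).tendsto (T x, y)).comp
      ((((ContinuousLinearMap.apply ℂ H₂ x).continuous.tendsto T).comp hlim).prodMk_nhds
        tendsto_const_nhds)
  have h2 : Filter.Tendsto (fun n => rinner B x (S n y)) Filter.atTop (nhds (rinner B x (S₀ y))) :=
    ((continuous_rinner B).tendsto (x, S₀ y)).comp
      (tendsto_const_nhds.prodMk_nhds
        (((ContinuousLinearMap.apply ℂ H₁ y).continuous.tendsto S₀).comp hS₀))
  exact tendsto_nhds_unique h1 (h2.congr fun n => (hS' n x y).symm)

lemma exists_adjoint {T : H₁ →L[ℂ] H₂} (hT : T ∈ compacts B H₁ H₂) :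
    ∃ S ∈ compacts B H₂ H₁, IsAdjointPair B T S := by
  refine closure_minimal (fun T hT => ?_)
    (isClosed_exists_adjoint B _ (isClosed_compacts B (H₁ := H₂) (H₂ := H₁))) hT
  induction hT using Submodule.span_induction with
  | mem T h =>
    obtain ⟨ξ, η, rfl⟩ := h
    exact ⟨_, rankOne_mem B _ _, rankOne_isAdjointPair B ξ η⟩
  | zero =>
    exact ⟨0, Submodule.zero_mem _, fun x y => by simp [rinner_zero_left, rinner_zero_right]⟩
  | add T T' _ _ h h' =>
    obtain ⟨S, hS, hS'⟩ := h
    obtain ⟨R, hR, hR'⟩ := h'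
    exact ⟨S + R, Submodule.add_mem _ hS hR, fun x y => by
      simp [rinner_add_left, rinner_add_right, hS' x y, hR' x y]⟩
  | smul c T _ h =>
    obtain ⟨S, hS, hS'⟩ := h
    exact ⟨star c • S, Submodule.smul_mem _ _ hS, fun x y => by
      simp [rinner_smul_left, rinner_smul_right, hS' x y]⟩

end Basic

section Algebra

variable (B : Type*) [NonUnitalCStarAlgebra B] [PartialOrder B] [StarOrderedRing B]
  (H : Type*) [NormedAddCommGroup H] [NormedSpace ℂ H] [CompleteSpace H]
  [SMul Bᵐᵒᵖ H] [RightHilbertModule B H]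

/-- `ℒ(H)`: the algebra of adjointable operators on `H`. -/
def adjointableAlg : Subalgebra ℂ (H →L[ℂ] H) where
  carrier := {T | ∃ S, IsAdjointPair B T S}
  mul_mem' := fun ⟨S, hS⟩ ⟨T, hT⟩ => ⟨T.comp S, hT.comp hS⟩
  add_mem' := fun ⟨S, hS⟩ ⟨T, hT⟩ => ⟨S + T, fun x y => by
    simp [rinner_add_left, rinner_add_right, hS x y, hT x y]⟩
  algebraMap_mem' := fun c => ⟨algebraMap ℂ _ (star c), fun x y => by
    simp [Algebra.algebraMap_eq_smul_one, rinner_smul_left, rinner_smul_right]⟩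

variable {B H} in
/-- The adjoint of an adjointable operator. -/
def adj (T : adjointableAlg B H) : adjointableAlg B H :=
  ⟨T.2.choose, T, T.2.choose_spec.symm⟩

variable {B H} in
lemma adj_isAdjointPair (T : adjointableAlg B H) : IsAdjointPair B (T : H →L[ℂ] H) (adj T) :=
  T.2.choose_spec

variable {B H} in
lemma eq_adj {T S : adjointableAlg B H} (h : IsAdjointPair B (T : H →L[ℂ] H) (S : H →L[ℂ] H)) :
    adj T = S := Subtype.ext ((adj_isAdjointPair T).unique h)

instance : StarRing (adjointableAlg B H) where
  star := adj
  star_involutive T := eq_adj (adj_isAdjointPair T).symm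
  star_mul S T := eq_adj ((adj_isAdjointPair T).comp (adj_isAdjointPair S))
  star_add S T := eq_adj fun x y => by
    simp [rinner_add_left, rinner_add_right, adj_isAdjointPair S x y, adj_isAdjointPair T x y]

variable {B H} in
lemma adjointable_star_isAdjointPair (T : adjointableAlg B H) :
    IsAdjointPair B (T : H →L[ℂ] H) (star T : adjointableAlg B H) := adj_isAdjointPair T

instance : CompleteSpace (adjointableAlg B H) := by
  have h := isClosed_exists_adjoint B (H₁ := H) (H₂ := H) Set.univ isClosed_univ
  simp only [Set.mem_univ, true_and] at h
  exact h.completeSpace_coe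

/-- `ℒ(H)` is a C⋆-algebra. -/
instance : CStarAlgebra (adjointableAlg B H) where
  star_smul c T := eq_adj fun x y => by
    simp [rinner_smul_left, rinner_smul_right, adjointable_star_isAdjointPair T x y]
  norm_smul_le c T := norm_smul_le c (T : H →L[ℂ] H)
  norm_mul_self_le T := (adjointable_star_isAdjointPair T).norm_sq_le

/-! Shortcut instances. -/

instance : AddCommGroup (adjointableAlg B H) := inferInstance
instance : AddCommMonoid (adjointableAlg B H) := inferInstance
instance : NormedAddCommGroup (adjointableAlg B H) := inferInstance
instance : SeminormedAddCommGroup (adjointableAlg B H) := inferInstance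
instance : NormedSpace ℂ (adjointableAlg B H) := inferInstance
instance : Module ℂ (adjointableAlg B H) := inferInstance
instance : DistribMulAction ℂ (adjointableAlg B H) := inferInstance
instance : NonUnitalNonAssocSemiring (adjointableAlg B H) := inferInstance
instance : NonUnitalSemiring (adjointableAlg B H) := inferInstance
instance : NonUnitalRing (adjointableAlg B H) := inferInstance
instance : Mul (adjointableAlg B H) := inferInstance
instance : Star (adjointableAlg B H) := inferInstance
instance : Norm (adjointableAlg B H) := inferInstance
instance : TopologicalSpace (adjointableAlg B H) := inferInstance
instance : Zero (adjointableAlg B H) := inferInstance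
instance : Add (adjointableAlg B H) := inferInstance

/-- `𝒦(H) = 𝒦(H, H)` as a subalgebra of the bounded operators on `H`. -/
def compactAlg : NonUnitalSubalgebra ℂ (H →L[ℂ] H) where
  __ := compacts B H H
  mul_mem' := fun {S T} hS hT => by
    obtain ⟨S', -, h⟩ := exists_adjoint B hS
    exact comp_mem_compacts_left B h hT

lemma mem_compactAlg {T : H →L[ℂ] H} : T ∈ compactAlg B H ↔ T ∈ compacts B H H := Iff.rfl

variable {B H} in
/-- The adjoint of a compact operator. -/
def compactAdj (T : compactAlg B H) : compactAlg B H :=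
  ⟨(exists_adjoint B T.2).choose, (exists_adjoint B T.2).choose_spec.1⟩

variable {B H} in
lemma compactAdj_isAdjointPair (T : compactAlg B H) : IsAdjointPair B (T : H →L[ℂ] H) (compactAdj T) :=
  (exists_adjoint B T.2).choose_spec.2

variable {B H} in
lemma eq_compactAdj {T S : compactAlg B H} (h : IsAdjointPair B (T : H →L[ℂ] H) (S : H →L[ℂ] H)) :
    compactAdj T = S := Subtype.ext ((compactAdj_isAdjointPair T).unique h)

instance : StarRing (compactAlg B H) where
  star := compactAdj
  star_involutive T := eq_compactAdj (compactAdj_isAdjointPair T).symm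
  star_mul S T := eq_compactAdj ((compactAdj_isAdjointPair T).comp (compactAdj_isAdjointPair S))
  star_add S T := eq_compactAdj fun x y => by
    simp [rinner_add_left, rinner_add_right, compactAdj_isAdjointPair S x y, compactAdj_isAdjointPair T x y]

variable {B H} in
lemma star_isAdjointPair (T : compactAlg B H) :
    IsAdjointPair B (T : H →L[ℂ] H) (star T : compactAlg B H) := compactAdj_isAdjointPair T

variable {B H} in
lemma eq_star {T S : compactAlg B H} (h : IsAdjointPair B (T : H →L[ℂ] H) (S : H →L[ℂ] H)) :
    star T = S := eq_compactAdj h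

instance : CompleteSpace (compactAlg B H) :=
  (isClosed_compacts B (H₁ := H) (H₂ := H)).completeSpace_coe

/-- `𝒦(H)` is a C⋆-algebra. -/
instance : NonUnitalCStarAlgebra (compactAlg B H) where
  star_smul c T := eq_compactAdj fun x y => by
    simp [rinner_smul_left, rinner_smul_right, star_isAdjointPair T x y]
  norm_smul_le c T := norm_smul_le c (T : H →L[ℂ] H)
  norm_mul_self_le T := (star_isAdjointPair T).norm_sq_le

/-! Shortcut instances. -/

instance : AddCommGroup (compactAlg B H) := inferInstance
instance : AddCommMonoid (compactAlg B H) := inferInstance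
instance : NormedAddCommGroup (compactAlg B H) := inferInstance
instance : SeminormedAddCommGroup (compactAlg B H) := inferInstance
instance : NormedSpace ℂ (compactAlg B H) := inferInstance
instance : Module ℂ (compactAlg B H) := inferInstance
instance : DistribMulAction ℂ (compactAlg B H) := inferInstance
instance : NonUnitalNonAssocSemiring (compactAlg B H) := inferInstance
instance : NonUnitalSemiring (compactAlg B H) := inferInstance
instance : NonUnitalRing (compactAlg B H) := inferInstance
instance : Mul (compactAlg B H) := inferInstance
instance : Star (compactAlg B H) := inferInstance
instance : Norm (compactAlg B H) := inferInstance
instance : TopologicalSpace (compactAlg B H) := inferInstance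
instance : Zero (compactAlg B H) := inferInstance
instance : Add (compactAlg B H) := inferInstance

end Algebra

section Tensor

variable {B C : Type*} [NonUnitalCStarAlgebra B] [PartialOrder B] [StarOrderedRing B]
  [NonUnitalCStarAlgebra C] [PartialOrder C] [StarOrderedRing C]
  {H₁ H₂ Y Z₁ Z₂ : Type*}
  [NormedAddCommGroup H₁] [NormedSpace ℂ H₁] [SMul Bᵐᵒᵖ H₁] [RightHilbertModule B H₁]
  [NormedAddCommGroup H₂] [NormedSpace ℂ H₂] [SMul Bᵐᵒᵖ H₂] [RightHilbertModule B H₂]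
  [NormedAddCommGroup Y] [NormedSpace ℂ Y] [CompleteSpace Y] [SMul Cᵐᵒᵖ Y] [RightHilbertModule C Y]
  [NormedAddCommGroup Z₁] [NormedSpace ℂ Z₁] [SMul Cᵐᵒᵖ Z₁] [RightHilbertModule C Z₁]
  [NormedAddCommGroup Z₂] [NormedSpace ℂ Z₂] [SMul Cᵐᵒᵖ Z₂] [RightHilbertModule C Z₂]

/-- The bilinear map `t : H × Y → Z` exhibits the right Hilbert `C`-module `Z` as the internal
tensor product `H ⊗_B Y` of the right Hilbert `B`-module `H` and the `B`-`C` correspondence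
`(Y, φ)`. -/
structure IsTensor (φ : B →⋆ₙₐ[ℂ] adjointableAlg C Y) (t₁ : H₁ →ₗ[ℂ] Y →ₗ[ℂ] Z₁) : Prop where
  inner : ∀ x x' y y', rinner C (t₁ x y) (t₁ x' y') = rinner C y ((φ (rinner B x x') : Y →L[ℂ] Y) y')
  dense : (Submodule.span ℂ {z | ∃ x y, z = t₁ x y}).topologicalClosure = ⊤

variable {φ : B →⋆ₙₐ[ℂ] adjointableAlg C Y} {t₁ : H₁ →ₗ[ℂ] Y →ₗ[ℂ] Z₁}
  {t₂ : H₂ →ₗ[ℂ] Y →ₗ[ℂ] Z₂}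

open TensorProduct in
lemma IsTensor.denseRange (ht : IsTensor φ t₁) : DenseRange (TensorProduct.lift t₁) := by
  have h1 : Submodule.span ℂ {z | ∃ x y, z = t₁ x y} ≤ LinearMap.range (TensorProduct.lift t₁) := by
    rw [Submodule.span_le]
    rintro _ ⟨x, y, rfl⟩
    exact ⟨x ⊗ₜ y, by simp⟩
  have h2 := ht.dense
  rw [DenseRange, dense_iff_closure_eq, Set.eq_univ_iff_forall]
  intro z
  have h3 : z ∈ (Submodule.span ℂ {z | ∃ x y, z = t₁ x y}).topologicalClosure := by
    rw [h2]; trivial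
  exact closure_mono (fun w hw => h1 hw) h3

/-- Two continuous linear maps agreeing on elementary tensors are equal. -/
lemma IsTensor.ext {F : Type*} [NormedAddCommGroup F] [NormedSpace ℂ F] (ht : IsTensor φ t₁)
    {f g : Z₁ →L[ℂ] F} (h : ∀ x y, f (t₁ x y) = g (t₁ x y)) : f = g := by
  refine ContinuousLinearMap.ext_on (s := {z | ∃ x y, z = t₁ x y}) ?_ ?_
  · rw [dense_iff_closure_eq, ← Submodule.topologicalClosure_coe, ht.dense]; rfl
  · rintro _ ⟨x, y, rfl⟩; exact h x y

open TensorProduct in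
lemma IsTensor.inner_map (h₁ : IsTensor φ t₁) (h₂ : IsTensor φ t₂) {T : H₁ →L[ℂ] H₂}
    {S : H₂ →L[ℂ] H₁} (h : IsAdjointPair B T S) (u : H₁ ⊗[ℂ] Y) (w : H₂ ⊗[ℂ] Y) :
    rinner C (lift t₂ (T.toLinearMap.rTensor Y u)) (lift t₂ w) =
      rinner C (lift t₁ u) (lift t₁ (S.toLinearMap.rTensor Y w)) := by
  induction u using TensorProduct.induction_on with
  | zero => simp [rinner_zero_left]
  | add a b ha hb => simp only [map_add, rinner_add_left, ha, hb]
  | tmul x y =>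
    induction w using TensorProduct.induction_on with
    | zero => simp [rinner_zero_right]
    | add a b ha hb => simp only [map_add, rinner_add_right, ha, hb]
    | tmul x' y' =>
      simp [h₁.inner, h₂.inner, h x x']

lemma IsTensor.norm_apply_le (ht : IsTensor φ t₁) (x : H₁) (y : Y) :
    ‖t₁ x y‖ ≤ √‖φ (rinner B x x)‖ * ‖y‖ := by
  refine abs_le_of_sq_le_sq' ?_ (by positivity) |>.2
  rw [norm_sq_eq C, ht.inner, mul_pow, Real.sq_sqrt (norm_nonneg _)]
  calc _ ≤ ‖y‖ * ‖(φ (rinner B x x) : Y →L[ℂ] Y) y‖ := norm_rinner_le C _ _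
    _ ≤ ‖y‖ * (‖φ (rinner B x x)‖ * ‖y‖) := by gcongr; exact ContinuousLinearMap.le_opNorm _ _
    _ = _ := by ring

lemma IsTensor.norm_apply_le' (ht : IsTensor φ t₁) (x : H₁) (y : Y) : ‖t₁ x y‖ ≤ ‖x‖ * ‖y‖ := by
  refine (ht.norm_apply_le x y).trans ?_
  gcongr
  rw [← Real.sqrt_sq (norm_nonneg x), norm_sq_eq B]
  exact Real.sqrt_le_sqrt (NonUnitalStarAlgHom.norm_apply_le φ _)

lemma pow_bound {b c q K : ℝ} (hb : 0 ≤ b) (hq : 0 ≤ q) {a : ℕ → ℝ} (ha : ∀ n, 0 ≤ a n)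
    (h0 : a 0 = c) (h1 : ∀ n, a n ^ 2 ≤ b * a (n + 1)) (h2 : ∀ n, a n ≤ K * q ^ (2 ^ n)) :
    c ≤ b * q := by
  rcases hb.eq_or_lt with rfl | hb
  · have := h1 0
    rw [h0] at this
    nlinarith [sq_nonneg c]
  have h3 : ∀ n, b * c ^ (2 ^ n) ≤ b ^ (2 ^ n) * a n := by
    intro n
    induction n with
    | zero => simp [h0]
    | succ n ih =>
      have hc : 0 ≤ c := h0 ▸ ha 0
      have h4 : (b * c ^ (2 ^ n)) ^ 2 ≤ (b ^ (2 ^ n) * a n) ^ 2 := by gcongr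
      have h5 : b * (b * c ^ (2 ^ (n + 1))) ≤ b * (b ^ (2 ^ (n + 1)) * a (n + 1)) := by
        calc b * (b * c ^ (2 ^ (n + 1))) = (b * c ^ (2 ^ n)) ^ 2 := by ring
          _ ≤ (b ^ (2 ^ n) * a n) ^ 2 := h4
          _ = b ^ (2 ^ (n + 1)) * a n ^ 2 := by ring
          _ ≤ b ^ (2 ^ (n + 1)) * (b * a (n + 1)) := by gcongr; exact h1 n
          _ = _ := by ring
      exact le_of_mul_le_mul_left h5 hb
  by_contra! hlt
  have hc : 0 < c := lt_of_le_of_lt (by positivity) hlt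
  have hbd : ∀ n, b * c ^ (2 ^ n) ≤ K * (b * q) ^ (2 ^ n) := fun n => by
    calc _ ≤ b ^ (2 ^ n) * a n := h3 n
      _ ≤ b ^ (2 ^ n) * (K * q ^ (2 ^ n)) := by gcongr; exact h2 n
      _ = _ := by rw [mul_pow]; ring
  have hr : b * q / c < 1 := (div_lt_one hc).mpr hlt
  have hlim : Filter.Tendsto (fun n : ℕ => K * (b * q / c) ^ (2 ^ n)) Filter.atTop (nhds (K * 0)) :=
    ((tendsto_pow_atTop_nhds_zero_of_lt_one (by positivity) hr).comp
      (tendsto_pow_atTop_atTop_of_one_lt (by norm_num : 1 < 2))).const_mul K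
  have hge : ∀ n, b ≤ K * (b * q / c) ^ (2 ^ n) := fun n => by
    rw [div_pow, ← mul_div_assoc, le_div_iff₀ (by positivity)]
    exact hbd n
  have := ge_of_tendsto' hlim hge
  simp only [mul_zero] at this
  linarith

open TensorProduct in
lemma IsTensor.exists_bound (ht : IsTensor φ t₁) (u : H₁ ⊗[ℂ] Y) :
    ∃ K, 0 ≤ K ∧ ∀ (T S : H₁ →L[ℂ] H₁), IsAdjointPair B T S →
      ‖lift t₁ (T.toLinearMap.rTensor Y u)‖ ≤ K * ‖T‖ := by
  induction u using TensorProduct.induction_on with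
  | zero => exact ⟨0, le_rfl, fun T S _ => by simp⟩
  | add a b ha hb =>
    obtain ⟨K, hK, h⟩ := ha
    obtain ⟨K', hK', h'⟩ := hb
    refine ⟨K + K', by positivity, fun T S hTS => ?_⟩
    simp only [map_add]
    exact (norm_add_le _ _).trans (by rw [add_mul]; exact add_le_add (h T S hTS) (h' T S hTS))
  | tmul x y =>
    refine ⟨‖x‖ * ‖y‖, by positivity, fun T S hTS => ?_⟩
    simp only [LinearMap.rTensor_tmul, lift.tmul]
    refine (ht.norm_apply_le' _ _).trans ?_
    calc _ ≤ (‖T‖ * ‖x‖) * ‖y‖ := by gcongr; exact T.le_opNorm x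
      _ = _ := by ring

open TensorProduct in
lemma IsTensor.norm_sq_map_le (h₁ : IsTensor φ t₁) (h₂ : IsTensor φ t₂) {T : H₁ →L[ℂ] H₂}
    {S : H₂ →L[ℂ] H₁} (h : IsAdjointPair B T S) (u : H₁ ⊗[ℂ] Y) :
    ‖lift t₂ (T.toLinearMap.rTensor Y u)‖ ^ 2 ≤
      ‖lift t₁ u‖ * ‖lift t₁ ((S.comp T).toLinearMap.rTensor Y u)‖ := by
  rw [norm_sq_eq C, h₁.inner_map h₂ h]
  have : S.toLinearMap.rTensor Y (T.toLinearMap.rTensor Y u) =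
      (S.comp T).toLinearMap.rTensor Y u := by
    rw [ContinuousLinearMap.toLinearMap_comp, LinearMap.rTensor_comp]; rfl
  rw [this]
  exact norm_rinner_le C _ _

open TensorProduct in
lemma IsTensor.norm_map_le (h₁ : IsTensor φ t₁) (h₂ : IsTensor φ t₂) {T : H₁ →L[ℂ] H₂}
    {S : H₂ →L[ℂ] H₁} (h : IsAdjointPair B T S) (u : H₁ ⊗[ℂ] Y) :
    ‖lift t₂ (T.toLinearMap.rTensor Y u)‖ ≤ ‖T‖ * ‖lift t₁ u‖ := by
  set Q : H₁ →L[ℂ] H₁ := S.comp T with hQ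
  have hQQ : IsAdjointPair B Q Q := h.comp h.symm
  have hpow : ∀ n : ℕ, IsAdjointPair B (Q ^ n) (Q ^ n) := by
    intro n
    induction n with
    | zero => exact fun x y => rfl
    | succ n ih =>
      have := hQQ.comp ih
      rw [← ContinuousLinearMap.mul_def, ← ContinuousLinearMap.mul_def, ← pow_succ, ← pow_succ']
        at this
      exact this
  obtain ⟨K, hK, hbd⟩ := h₁.exists_bound u
  have hq : ‖lift t₁ (Q.toLinearMap.rTensor Y u)‖ ≤ ‖lift t₁ u‖ * ‖Q‖ := by
    refine pow_bound (K := K) (a := fun n => ‖lift t₁ ((Q ^ (2 ^ n)).toLinearMap.rTensor Y u)‖)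
      (norm_nonneg _) (norm_nonneg _) (fun n => norm_nonneg _) (by simp) (fun n => ?_) (fun n => ?_)
    · have := h₁.norm_sq_map_le h₁ (hpow (2 ^ n)) u
      rwa [← ContinuousLinearMap.mul_def, ← pow_add, ← two_mul, ← pow_succ'] at this
    · refine (hbd _ _ (hpow (2 ^ n))).trans ?_
      gcongr
      exact norm_pow_le' _ (by positivity)
  refine abs_le_of_sq_le_sq' ?_ (by positivity) |>.2
  have hQn : ‖Q‖ ≤ ‖T‖ * ‖T‖ := by
    refine (ContinuousLinearMap.opNorm_comp_le _ _).trans ?_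
    rw [h.norm_eq]
  calc _ ≤ ‖lift t₁ u‖ * ‖lift t₁ (Q.toLinearMap.rTensor Y u)‖ := h₁.norm_sq_map_le h₂ h u
    _ ≤ ‖lift t₁ u‖ * (‖lift t₁ u‖ * (‖T‖ * ‖T‖)) := by
      gcongr; exact hq.trans (by gcongr)
    _ = _ := by ring

variable [CompleteSpace Z₁] [CompleteSpace Z₂]

open TensorProduct in
/-- The operator `T ⊗ 1 : H₁ ⊗_B Y → H₂ ⊗_B Y`. -/
def mapTensor (t₁ : H₁ →ₗ[ℂ] Y →ₗ[ℂ] Z₁) (t₂ : H₂ →ₗ[ℂ] Y →ₗ[ℂ] Z₂) (T : H₁ →L[ℂ] H₂) :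
    Z₁ →L[ℂ] Z₂ :=
  ((lift t₂).comp (T.toLinearMap.rTensor Y)).extendOfNorm (lift t₁)

open TensorProduct in
lemma mapTensor_apply (h₁ : IsTensor φ t₁) (h₂ : IsTensor φ t₂) {T : H₁ →L[ℂ] H₂}
    {S : H₂ →L[ℂ] H₁} (h : IsAdjointPair B T S) (x : H₁) (y : Y) :
    mapTensor t₁ t₂ T (t₁ x y) = t₂ (T x) y := by
  have := LinearMap.extendOfNorm_eq (f := (lift t₂).comp (T.toLinearMap.rTensor Y)) (e := lift t₁)
    h₁.denseRange ⟨_, h₁.norm_map_le h₂ h⟩ (x ⊗ₜ y)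
  simp only [lift.tmul, LinearMap.comp_apply, LinearMap.rTensor_tmul] at this
  exact this

open TensorProduct in
lemma norm_mapTensor_le (h₁ : IsTensor φ t₁) (h₂ : IsTensor φ t₂) {T : H₁ →L[ℂ] H₂}
    {S : H₂ →L[ℂ] H₁} (h : IsAdjointPair B T S) : ‖mapTensor t₁ t₂ T‖ ≤ ‖T‖ :=
  ContinuousLinearMap.opNorm_le_bound _ (norm_nonneg _) fun z =>
    LinearMap.norm_extendOfNorm_apply_le h₁.denseRange _ (h₁.norm_map_le h₂ h) z

lemma mapTensor_isAdjointPair (h₁ : IsTensor φ t₁) (h₂ : IsTensor φ t₂) {T : H₁ →L[ℂ] H₂}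
    {S : H₂ →L[ℂ] H₁} (h : IsAdjointPair B T S) :
    IsAdjointPair C (mapTensor t₁ t₂ T) (mapTensor t₂ t₁ S) := by
  have key : ∀ x y w, rinner C (mapTensor t₁ t₂ T (t₁ x y)) w =
      rinner C (t₁ x y) (mapTensor t₂ t₁ S w) := by
    intro x y w
    let l : Z₂ →L[ℂ] C := LinearMap.mkContinuous
      { toFun := fun w => rinner C (mapTensor t₁ t₂ T (t₁ x y)) w -
          rinner C (t₁ x y) (mapTensor t₂ t₁ S w)
        map_add' := fun a b => by simp only [map_add, rinner_add_right]; abel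
        map_smul' := fun c a => by simp only [map_smul, rinner_smul_right, smul_sub]; rfl }
      (‖mapTensor t₁ t₂ T (t₁ x y)‖ + ‖t₁ x y‖ * ‖mapTensor t₂ t₁ S‖) (fun w => by
        rw [add_mul]
        refine (norm_sub_le _ _).trans (add_le_add (norm_rinner_le C _ _) ?_)
        refine (norm_rinner_le C _ _).trans ?_
        rw [mul_assoc]
        gcongr
        exact ContinuousLinearMap.le_opNorm _ _)
    have hl : l = 0 := h₂.ext fun x' y' => by
      simp only [l, LinearMap.mkContinuous_apply, LinearMap.coe_mk, AddHom.coe_mk,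
        zero_apply]
      rw [mapTensor_apply h₁ h₂ h, mapTensor_apply h₂ h₁ h.symm, h₁.inner, h₂.inner, h x x',
        sub_self]
    exact sub_eq_zero.mp (congrArg (fun f : Z₂ →L[ℂ] C => f w) hl)
  intro z w
  rw [← star_rinner C w, ← star_rinner C _ z]
  congr 1
  let l : Z₁ →L[ℂ] C := LinearMap.mkContinuous
    { toFun := fun z => rinner C w (mapTensor t₁ t₂ T z) - rinner C (mapTensor t₂ t₁ S w) z
      map_add' := fun a b => by simp only [map_add, rinner_add_right]; abel
      map_smul' := fun c a => by simp only [map_smul, rinner_smul_right, smul_sub]; rfl }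
    (‖w‖ * ‖mapTensor t₁ t₂ T‖ + ‖mapTensor t₂ t₁ S w‖) (fun z => by
      rw [add_mul]
      refine (norm_sub_le _ _).trans (add_le_add ?_ (norm_rinner_le C _ _))
      refine (norm_rinner_le C _ _).trans ?_
      rw [mul_assoc]
      gcongr
      exact ContinuousLinearMap.le_opNorm _ _)
  have hl : l = 0 := h₁.ext fun x y => by
    simp only [l, LinearMap.mkContinuous_apply, LinearMap.coe_mk, AddHom.coe_mk,
      zero_apply]
    rw [← star_rinner C _ w, key, star_rinner, sub_self]
  exact sub_eq_zero.mp (congrArg (fun f : Z₁ →L[ℂ] C => f z) hl)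

lemma mapTensor_eq (h₁ : IsTensor φ t₁) (h₂ : IsTensor φ t₂) {T : H₁ →L[ℂ] H₂}
    {S : H₂ →L[ℂ] H₁} (h : IsAdjointPair B T S) {R : Z₁ →L[ℂ] Z₂}
    (hR : ∀ x y, R (t₁ x y) = t₂ (T x) y) : mapTensor t₁ t₂ T = R :=
  h₁.ext fun x y => by rw [mapTensor_apply h₁ h₂ h, hR]

lemma mapTensor_sub (h₁ : IsTensor φ t₁) (h₂ : IsTensor φ t₂) {T T' : H₁ →L[ℂ] H₂}
    {S S' : H₂ →L[ℂ] H₁} (h : IsAdjointPair B T S) (h' : IsAdjointPair B T' S') :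
    mapTensor t₁ t₂ (T - T') = mapTensor t₁ t₂ T - mapTensor t₁ t₂ T' :=
  mapTensor_eq h₁ h₂ (S := S - S') (fun x y => by
      simp [rinner_sub_left, rinner_sub_right, h x y, h' x y]) fun x y => by
    simp [mapTensor_apply h₁ h₂ h, mapTensor_apply h₁ h₂ h']

lemma norm_mapTensor_sub_le (h₁ : IsTensor φ t₁) (h₂ : IsTensor φ t₂) {T T' : H₁ →L[ℂ] H₂}
    {S S' : H₂ →L[ℂ] H₁} (h : IsAdjointPair B T S) (h' : IsAdjointPair B T' S') :
    ‖mapTensor t₁ t₂ T - mapTensor t₁ t₂ T'‖ ≤ ‖T - T'‖ := by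
  rw [← mapTensor_sub h₁ h₂ h h']
  exact norm_mapTensor_le h₁ h₂ (S := S - S') fun x y => by
      simp [rinner_sub_left, rinner_sub_right, h x y, h' x y]

/-- The operator `y ↦ ξ ⊗ y`. -/
def creation (ht : IsTensor φ t₁) (ξ : H₁) : Y →L[ℂ] Z₁ :=
  (t₁ ξ).mkContinuous ‖ξ‖ (ht.norm_apply_le' ξ)

open TensorProduct in
/-- The operator `y ↦ ξ ⊗ y` is adjointable, with adjoint `x ⊗ y ↦ ⟨ξ, x⟩ y`. -/
lemma exists_annihilation (ht : IsTensor φ t₁) (ξ : H₁) :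
    ∃ R : Z₁ →L[ℂ] Y, IsAdjointPair C (creation ht ξ) R ∧
      ∀ x y, R (t₁ x y) = (φ (rinner B ξ x) : Y →L[ℂ] Y) y := by
  let f₀ : H₁ →ₗ[ℂ] Y →ₗ[ℂ] Y := LinearMap.mk₂ ℂ (fun x y => (φ (rinner B ξ x) : Y →L[ℂ] Y) y)
    (fun x x' y => by simp [rinner_add_right]) (fun c x y => by simp [rinner_smul_right])
    (fun x y y' => by simp) (fun c x y => by simp)
  have hf : ∀ (u : H₁ ⊗[ℂ] Y) (y : Y), rinner C y (lift f₀ u) = rinner C (t₁ ξ y) (lift t₁ u) := by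
    intro u y
    induction u using TensorProduct.induction_on with
    | zero => simp [rinner_zero_right]
    | add a b ha hb => simp only [map_add, rinner_add_right, ha, hb]
    | tmul x y' => simp [ht.inner, f₀]
  have hbd : ∀ u : H₁ ⊗[ℂ] Y, ‖lift f₀ u‖ ≤ ‖ξ‖ * ‖lift t₁ u‖ := by
    intro u
    by_cases h0 : ‖lift f₀ u‖ = 0
    · rw [h0]; positivity
    have h2 : 0 < ‖lift f₀ u‖ := lt_of_le_of_ne (norm_nonneg _) (Ne.symm h0)
    have h1 : ‖lift f₀ u‖ ^ 2 ≤ ‖ξ‖ * ‖lift f₀ u‖ * ‖lift t₁ u‖ := by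
      rw [norm_sq_eq C, hf]
      exact (norm_rinner_le C _ _).trans (by gcongr; exact ht.norm_apply_le' _ _)
    nlinarith
  have happ : ∀ u, (lift f₀).extendOfNorm (lift t₁) (lift t₁ u) = lift f₀ u :=
    LinearMap.extendOfNorm_eq ht.denseRange ⟨_, hbd⟩
  refine ⟨(lift f₀).extendOfNorm (lift t₁), fun y z => ?_, fun x y => ?_⟩
  · have hcl : IsClosed {z : Z₁ | rinner C (creation ht ξ y) z =
        rinner C y ((lift f₀).extendOfNorm (lift t₁) z)} :=
      isClosed_eq ((continuous_rinner C).comp (continuous_const.prodMk continuous_id))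
        ((continuous_rinner C).comp (continuous_const.prodMk (ContinuousLinearMap.continuous _)))
    refine ht.denseRange.induction_on (p := fun z => rinner C (creation ht ξ y) z =
        rinner C y ((lift f₀).extendOfNorm (lift t₁) z)) z hcl fun u => ?_
    rw [happ, hf]; rfl
  · have := happ (x ⊗ₜ y)
    simp only [lift.tmul] at this
    rw [this]; rfl

/-- `ξ` is a limit of vectors `ξ b`. -/
lemma exists_rsmul_near (ξ : H₁) {ε : ℝ} (hε : 0 < ε) : ∃ b : B, ‖ξ - ξ <• b‖ < ε := by
  have hl := CStarAlgebra.increasingApproximateUnit B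
  have := hl.toIsApproximateUnit.neBot
  set a := rinner B ξ ξ with ha
  have h1 := hl.toIsApproximateUnit.tendsto_mul_left a
  have h2 : ∀ᶠ e in CStarAlgebra.approximateUnit B, ‖a * e - a‖ < ε ^ 2 / 2 := by
    have := (tendsto_iff_norm_sub_tendsto_zero.mp h1)
    exact this.eventually_lt_const (by positivity)
  obtain ⟨e, he, hn⟩ := (h2.and hl.eventually_norm).exists
  refine ⟨e, ?_⟩
  have h3 : ‖ξ - ξ <• e‖ ^ 2 < ε ^ 2 := by
    rw [norm_sq_eq B]
    have : rinner B (ξ - ξ <• e) (ξ - ξ <• e) = -(a * e - a) + star e * (a * e - a) := by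
      rw [rinner_sub_left, rinner_sub_right, rinner_sub_right, rinner_rsmul_left,
        rinner_rsmul_left, rinner_rsmul_right, mul_sub]
      abel
    rw [this]
    calc _ ≤ ‖a * e - a‖ + ‖star e‖ * ‖a * e - a‖ :=
          (norm_add_le _ _).trans (by rw [norm_neg]; gcongr; exact norm_mul_le _ _)
      _ ≤ ‖a * e - a‖ + 1 * ‖a * e - a‖ := by rw [norm_star]; gcongr
      _ < ε ^ 2 := by linarith
  exact lt_of_pow_lt_pow_left₀ 2 hε.le h3

/-- If `B` acts on `Y` by compact operators, then `T ⊗ 1` is compact for every compact `T`. -/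
lemma mapTensor_mem_compacts [CompleteSpace H₁] [CompleteSpace H₂] (h₁ : IsTensor φ t₁)
    (h₂ : IsTensor φ t₂) (hφ : ∀ b, (φ b : Y →L[ℂ] Y) ∈ compacts C Y Y) {T : H₁ →L[ℂ] H₂}
    (hT : T ∈ compacts B H₁ H₂) : mapTensor t₁ t₂ T ∈ compacts C Z₁ Z₂ := by
  have hcl := isClosed_compacts C (H₁ := Z₁) (H₂ := Z₂)
  have step1 : ∀ (ξ : H₂) (b : B) (η : H₁),
      mapTensor t₁ t₂ (rankOne B (ξ <• b) η) ∈ compacts C Z₁ Z₂ := by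
    intro ξ b η
    obtain ⟨R, hR, hR'⟩ := exists_annihilation h₁ η
    obtain ⟨R₂, hR₂, -⟩ := exists_annihilation h₂ ξ
    have h3 : (creation h₂ ξ).comp ((φ b : Y →L[ℂ] Y).comp R) ∈ compacts C Z₁ Z₂ :=
      comp_mem_compacts_left C hR₂ (comp_mem_compacts_right C hR.symm (hφ b))
    have hbal : ∀ (c : B) (y : Y), t₂ (ξ <• c) y = t₂ ξ ((φ c : Y →L[ℂ] Y) y) := by
      intro c y
      rw [← sub_eq_zero, ← rinner_self_eq_zero C]
      have hm : ∀ (a a' : B) (y : Y), (φ (a * a') : Y →L[ℂ] Y) y =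
        (φ a : Y →L[ℂ] Y) ((φ a' : Y →L[ℂ] Y) y) := fun a a' y => by rw [map_mul]; rfl
      have hs : ∀ (a : B) (y y' : Y), rinner C y ((φ (star a) : Y →L[ℂ] Y) y') =
          rinner C ((φ a : Y →L[ℂ] Y) y) y' := fun a y y' => by
        rw [map_star]; exact (adjointable_star_isAdjointPair (φ a) y y').symm
      rw [rinner_sub_left, rinner_sub_right, rinner_sub_right, h₂.inner, h₂.inner, h₂.inner,
        h₂.inner, rinner_rsmul_left, rinner_rsmul_left, rinner_rsmul_right, hm, hm, hm, hs]
      abel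
    rw [mapTensor_eq h₁ h₂ (rankOne_isAdjointPair B _ _)
      (R := (creation h₂ ξ).comp ((φ b : Y →L[ℂ] Y).comp R)) fun x y => ?_]
    · exact h3
    · have hm : (φ (b * rinner B η x) : Y →L[ℂ] Y) y =
        (φ b : Y →L[ℂ] Y) ((φ (rinner B η x) : Y →L[ℂ] Y) y) := by rw [map_mul]; rfl
      rw [rankOne_apply, rsmul_rsmul, hbal, hm]
      simp [hR', creation]
  have step2 : ∀ (ξ : H₂) (η : H₁), mapTensor t₁ t₂ (rankOne B ξ η) ∈ compacts C Z₁ Z₂ := by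
    intro ξ η
    refine hcl.closure_subset (Metric.mem_closure_iff.mpr fun ε hε => ?_)
    obtain ⟨b, hb⟩ := exists_rsmul_near (B := B) ξ (ε := ε / (‖η‖ + 1)) (by positivity)
    refine ⟨_, step1 ξ b η, ?_⟩
    rw [dist_eq_norm]
    refine (norm_mapTensor_sub_le h₁ h₂ (rankOne_isAdjointPair B _ _)
      (rankOne_isAdjointPair B _ _)).trans_lt ?_
    refine (ContinuousLinearMap.opNorm_le_bound _ (M := ‖ξ - ξ <• b‖ * ‖η‖) (by positivity)
      fun ζ => ?_).trans_lt (b := ‖ξ - ξ <• b‖ * ‖η‖) ?_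
    · have : (rankOne B ξ η - rankOne B (ξ <• b) η) ζ = (ξ - ξ <• b) <• rinner B η ζ :=
        HilbertMod.ext_rinner B fun z => by
          simp only [sub_apply, rankOne_apply, rinner_sub_right, rinner_rsmul_right, sub_mul]
      rw [this, mul_assoc]
      refine (norm_rsmul_le B _ _).trans ?_
      gcongr
      exact norm_rinner_le B _ _
    · rw [lt_div_iff₀ (by positivity)] at hb
      nlinarith [norm_nonneg (ξ - ξ <• b)]
  have step3 : ∀ T ∈ Submodule.span ℂ {T : H₁ →L[ℂ] H₂ | ∃ ξ η, T = rankOne B ξ η},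
      mapTensor t₁ t₂ T ∈ compacts C Z₁ Z₂ := by
    intro T hT
    have hadj : ∀ T ∈ Submodule.span ℂ {T : H₁ →L[ℂ] H₂ | ∃ ξ η, T = rankOne B ξ η},
        ∃ S, IsAdjointPair B T S := fun T hT =>
      (exists_adjoint B (Submodule.le_topologicalClosure _ hT)).imp fun _ h => h.2
    induction hT using Submodule.span_induction with
    | mem T h => obtain ⟨ξ, η, rfl⟩ := h; exact step2 ξ η
    | zero =>
      rw [mapTensor_eq h₁ h₂ (T := 0) (S := 0) (R := 0)
        (fun x y => by simp [rinner_zero_left, rinner_zero_right]) (by simp)]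
      exact Submodule.zero_mem _
    | add T T' hT hT' h h' =>
      obtain ⟨S, hS⟩ := hadj T hT
      obtain ⟨S', hS'⟩ := hadj T' hT'
      rw [mapTensor_eq h₁ h₂ (T := T + T') (S := S + S')
        (R := mapTensor t₁ t₂ T + mapTensor t₁ t₂ T') (fun x y => by
          simp [rinner_add_left, rinner_add_right, hS x y, hS' x y])
        (fun x y => by simp [mapTensor_apply h₁ h₂ hS, mapTensor_apply h₁ h₂ hS'])]
      exact Submodule.add_mem _ h h'
    | smul c T hT h =>
      obtain ⟨S, hS⟩ := hadj T hT
      rw [mapTensor_eq h₁ h₂ (T := c • T) (S := star c • S) (R := c • mapTensor t₁ t₂ T)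
        (fun x y => by simp [rinner_smul_left, rinner_smul_right, hS x y])
        (fun x y => by simp [mapTensor_apply h₁ h₂ hS])]
      exact Submodule.smul_mem _ _ h
  refine hcl.closure_subset (Metric.mem_closure_iff.mpr fun ε hε => ?_)
  obtain ⟨T', hT', hlt⟩ := Metric.mem_closure_iff.mp
    (show T ∈ closure (Submodule.span ℂ {T : H₁ →L[ℂ] H₂ | ∃ ξ η, T = rankOne B ξ η} :
      Set (H₁ →L[ℂ] H₂)) from hT) ε hε
  refine ⟨_, step3 T' hT', ?_⟩
  obtain ⟨S, -, hS⟩ := exists_adjoint B hT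
  obtain ⟨S', -, hS'⟩ := exists_adjoint B (Submodule.le_topologicalClosure _ hT')
  rw [dist_eq_norm] at hlt ⊢
  exact (norm_mapTensor_sub_le h₁ h₂ hS hS').trans_lt hlt

variable [CompleteSpace H₁] [CompleteSpace H₂]

/-- The `⋆`-homomorphism `𝒦(H) → 𝒦(H ⊗_B Y)`, `T ↦ T ⊗ 1`. -/
def ampAlg (ht : IsTensor φ t₁) (hφ : ∀ b, (φ b : Y →L[ℂ] Y) ∈ compacts C Y Y) :
    compactAlg B H₁ →⋆ₙₐ[ℂ] compactAlg C Z₁ where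
  toFun T := ⟨mapTensor t₁ t₁ T, mapTensor_mem_compacts ht ht hφ T.2⟩
  map_smul' c T := Subtype.ext <| mapTensor_eq ht ht (star_isAdjointPair (c • T)) fun x y => by
    simp [mapTensor_apply ht ht (star_isAdjointPair T)]
  map_zero' := Subtype.ext <| mapTensor_eq ht ht (star_isAdjointPair 0) fun x y => by simp
  map_add' S T := Subtype.ext <| mapTensor_eq ht ht (star_isAdjointPair (S + T)) fun x y => by
    simp [mapTensor_apply ht ht (star_isAdjointPair T), mapTensor_apply ht ht (star_isAdjointPair S)]
  map_mul' S T := Subtype.ext <| mapTensor_eq ht ht (star_isAdjointPair (S * T)) fun x y => by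
    simp [mapTensor_apply ht ht (star_isAdjointPair T), mapTensor_apply ht ht (star_isAdjointPair S)]
  map_star' T := (eq_star (mapTensor_isAdjointPair ht ht (star_isAdjointPair T))).symm

lemma ampAlg_apply (ht : IsTensor φ t₁) (hφ : ∀ b, (φ b : Y →L[ℂ] Y) ∈ compacts C Y Y)
    (T : compactAlg B H₁) (x : H₁) (y : Y) :
    (ampAlg ht hφ T : Z₁ →L[ℂ] Z₁) (t₁ x y) = t₁ ((T : H₁ →L[ℂ] H₁) x) y :=
  mapTensor_apply ht ht (star_isAdjointPair T) x y

lemma ampAlg_eq (ht : IsTensor φ t₁) (hφ : ∀ b, (φ b : Y →L[ℂ] Y) ∈ compacts C Y Y)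
    {T : compactAlg B H₁} {R : compactAlg C Z₁}
    (h : ∀ x y, (R : Z₁ →L[ℂ] Z₁) (t₁ x y) = t₁ ((T : H₁ →L[ℂ] H₁) x) y) : ampAlg ht hφ T = R :=
  Subtype.ext <| mapTensor_eq ht ht (star_isAdjointPair T) h

lemma ampAlg_injective (ht : IsTensor φ t₁) (hφ : ∀ b, (φ b : Y →L[ℂ] Y) ∈ compacts C Y Y)
    (hinj : Function.Injective φ) : Function.Injective (ampAlg ht hφ) := by
  rw [injective_iff_map_eq_zero]
  intro T hT
  refine Subtype.ext (ContinuousLinearMap.ext fun x => HilbertMod.ext_rinner B fun x' => ?_)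
  refine hinj (Subtype.ext (ContinuousLinearMap.ext fun y => HilbertMod.ext_rinner C fun y' => ?_))
  rw [← ht.inner, ← ampAlg_apply ht hφ, hT]
  simp [rinner_zero_right]

lemma norm_ampAlg (ht : IsTensor φ t₁) (hφ : ∀ b, (φ b : Y →L[ℂ] Y) ∈ compacts C Y Y)
    (hinj : Function.Injective φ) (T : compactAlg B H₁) : ‖ampAlg ht hφ T‖ = ‖T‖ :=
  NonUnitalStarAlgHom.norm_map _ (ampAlg_injective ht hφ hinj) T

/-- The linear map `𝒦(H₁, H₂) → 𝒦(H₁ ⊗_B Y, H₂ ⊗_B Y)`, `T ↦ T ⊗ 1`; it is isometric if the left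
action of `B` on `Y` is injective. -/
def ampLin (h₁ : IsTensor φ t₁) (h₂ : IsTensor φ t₂)
    (hφ : ∀ b, (φ b : Y →L[ℂ] Y) ∈ compacts C Y Y) (hinj : Function.Injective φ) :
    compacts B H₁ H₂ →ₗᵢ[ℂ] compacts C Z₁ Z₂ where
  toFun T := ⟨mapTensor t₁ t₂ T, mapTensor_mem_compacts h₁ h₂ hφ T.2⟩
  map_smul' c T := by
    obtain ⟨S, -, hS⟩ := exists_adjoint B T.2
    refine Subtype.ext <| mapTensor_eq h₁ h₂ (S := star c • S)
      (fun x y => by simp [rinner_smul_left, rinner_smul_right, hS x y]) fun x y => ?_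
    simp [mapTensor_apply h₁ h₂ hS]
  map_add' T T' := by
    obtain ⟨S, -, hS⟩ := exists_adjoint B T.2
    obtain ⟨S', -, hS'⟩ := exists_adjoint B T'.2
    refine Subtype.ext <| mapTensor_eq h₁ h₂ (S := S + S')
      (fun x y => by simp [rinner_add_left, rinner_add_right, hS x y, hS' x y]) fun x y => ?_
    simp [mapTensor_apply h₁ h₂ hS, mapTensor_apply h₁ h₂ hS']
  norm_map' T := by
    obtain ⟨S, hSc, hS⟩ := exists_adjoint B T.2
    refine le_antisymm (norm_mapTensor_le h₁ h₂ hS) ?_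
    refine abs_le_of_sq_le_sq' ?_ (norm_nonneg _) |>.2
    let Q : compactAlg B H₁ := ⟨S.comp T, comp_mem_compacts_left B hS.symm T.2⟩
    have hQ : mapTensor t₁ t₁ (S.comp (T : H₁ →L[ℂ] H₂)) =
        (mapTensor t₂ t₁ S).comp (mapTensor t₁ t₂ T) :=
      mapTensor_eq h₁ h₁ (hS.comp hS.symm) fun x y => by
        simp [mapTensor_apply h₁ h₂ hS, mapTensor_apply h₂ h₁ hS.symm]
    calc ‖(T : H₁ →L[ℂ] H₂)‖ ^ 2 = ‖(T : H₁ →L[ℂ] H₂)‖ * ‖(T : H₁ →L[ℂ] H₂)‖ := sq _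
      _ ≤ ‖Q‖ := hS.norm_sq_le
      _ = ‖ampAlg h₁ hφ Q‖ := (norm_ampAlg h₁ hφ hinj Q).symm
      _ = ‖(mapTensor t₂ t₁ S).comp (mapTensor t₁ t₂ (T : H₁ →L[ℂ] H₂))‖ := by rw [← hQ]; rfl
      _ ≤ ‖mapTensor t₂ t₁ S‖ * ‖mapTensor t₁ t₂ (T : H₁ →L[ℂ] H₂)‖ :=
        ContinuousLinearMap.opNorm_comp_le _ _
      _ = ‖mapTensor t₁ t₂ (T : H₁ →L[ℂ] H₂)‖ ^ 2 := by
        rw [(mapTensor_isAdjointPair h₁ h₂ hS).norm_eq, sq]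

lemma ampLin_apply (h₁ : IsTensor φ t₁) (h₂ : IsTensor φ t₂)
    (hφ : ∀ b, (φ b : Y →L[ℂ] Y) ∈ compacts C Y Y) (hinj : Function.Injective φ)
    (T : compacts B H₁ H₂) (x : H₁) (y : Y) :
    (ampLin h₁ h₂ hφ hinj T : Z₁ →L[ℂ] Z₂) (t₁ x y) = t₂ ((T : H₁ →L[ℂ] H₂) x) y := by
  obtain ⟨S, -, hS⟩ := exists_adjoint B T.2
  exact mapTensor_apply h₁ h₂ hS x y

lemma ampLin_eq (h₁ : IsTensor φ t₁) (h₂ : IsTensor φ t₂)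
    (hφ : ∀ b, (φ b : Y →L[ℂ] Y) ∈ compacts C Y Y) (hinj : Function.Injective φ)
    {T : compacts B H₁ H₂} {R : compacts C Z₁ Z₂}
    (h : ∀ x y, (R : Z₁ →L[ℂ] Z₂) (t₁ x y) = t₂ ((T : H₁ →L[ℂ] H₂) x) y) :
    ampLin h₁ h₂ hφ hinj T = R :=
  Subtype.ext <| h₁.ext fun x y => (ampLin_apply h₁ h₂ hφ hinj T x y).trans (h x y).symm

end Tensor

section DirectSum

variable (B : Type*) [NonUnitalCStarAlgebra B] [PartialOrder B] [StarOrderedRing B]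
  (H₁ H₂ : Type*)
  [NormedAddCommGroup H₁] [NormedSpace ℂ H₁] [SMul Bᵐᵒᵖ H₁] [RightHilbertModule B H₁]
  [NormedAddCommGroup H₂] [NormedSpace ℂ H₂] [SMul Bᵐᵒᵖ H₂] [RightHilbertModule B H₂]

/-- The direct sum `H₁ ⊕ H₂` of right Hilbert `B`-modules, with
`⟨(x₁, x₂), (y₁, y₂)⟩ = ⟨x₁, y₁⟩ + ⟨x₂, y₂⟩`. -/
abbrev DSum : Type _ := WithCStarModule Bᵐᵒᵖ (H₁ × H₂)

variable {B H₁ H₂} in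
lemma rinner_dsum (x y : DSum B H₁ H₂) :
    rinner B x y = rinner B x.1 y.1 + rinner B x.2 y.2 := rfl

/-- The inclusion `H₁ → H₁ ⊕ H₂`. -/
def inlL : H₁ →L[ℂ] DSum B H₁ H₂ :=
  (WithCStarModule.equivL ℂ (A := Bᵐᵒᵖ) (E := H₁ × H₂)).symm.toContinuousLinearMap.comp
    (ContinuousLinearMap.inl ℂ H₁ H₂)

/-- The inclusion `H₂ → H₁ ⊕ H₂`. -/
def inrL : H₂ →L[ℂ] DSum B H₁ H₂ :=
  (WithCStarModule.equivL ℂ (A := Bᵐᵒᵖ) (E := H₁ × H₂)).symm.toContinuousLinearMap.comp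
    (ContinuousLinearMap.inr ℂ H₁ H₂)

/-- The coordinate projection `H₁ ⊕ H₂ → H₁`. -/
def fstL : DSum B H₁ H₂ →L[ℂ] H₁ :=
  (ContinuousLinearMap.fst ℂ H₁ H₂).comp
    (WithCStarModule.equivL ℂ (A := Bᵐᵒᵖ) (E := H₁ × H₂)).toContinuousLinearMap

/-- The coordinate projection `H₁ ⊕ H₂ → H₂`. -/
def sndL : DSum B H₁ H₂ →L[ℂ] H₂ :=
  (ContinuousLinearMap.snd ℂ H₁ H₂).comp
    (WithCStarModule.equivL ℂ (A := Bᵐᵒᵖ) (E := H₁ × H₂)).toContinuousLinearMap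

lemma inlL_isAdjointPair : IsAdjointPair B (inlL B H₁ H₂) (fstL B H₁ H₂) := fun x y => by
  change rinner B x y.1 + rinner B 0 y.2 = rinner B x y.1
  rw [rinner_zero_left, add_zero]

lemma inrL_isAdjointPair : IsAdjointPair B (inrL B H₁ H₂) (sndL B H₁ H₂) := fun x y => by
  change rinner B 0 y.1 + rinner B x y.2 = rinner B x y.2
  rw [rinner_zero_left, zero_add]

/-- The projection of `H₁ ⊕ H₂` onto the first summand. -/
def projFst : DSum B H₁ H₂ →L[ℂ] DSum B H₁ H₂ := (inlL B H₁ H₂).comp (fstL B H₁ H₂)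

/-- The projection of `H₁ ⊕ H₂` onto the second summand. -/
def projSnd : DSum B H₁ H₂ →L[ℂ] DSum B H₁ H₂ := (inrL B H₁ H₂).comp (sndL B H₁ H₂)

lemma projFst_isAdjointPair : IsAdjointPair B (projFst B H₁ H₂) (projFst B H₁ H₂) :=
  (inlL_isAdjointPair B H₁ H₂).symm.comp (inlL_isAdjointPair B H₁ H₂)

lemma projSnd_isAdjointPair : IsAdjointPair B (projSnd B H₁ H₂) (projSnd B H₁ H₂) :=
  (inrL_isAdjointPair B H₁ H₂).symm.comp (inrL_isAdjointPair B H₁ H₂)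

variable [CompleteSpace H₁] [CompleteSpace H₂]

variable {B H₁ H₂} in
/-- `S ↦ S ⊕ 0`, the identification of `𝒦(H₁)` with a corner of `𝒦(H₁ ⊕ H₂)`. -/
def cornerFst (S : compactAlg B H₁) : compactAlg B (DSum B H₁ H₂) :=
  ⟨(inlL B H₁ H₂).comp ((S : H₁ →L[ℂ] H₁).comp (fstL B H₁ H₂)),
    comp_mem_compacts_left B (inlL_isAdjointPair B H₁ H₂)
      (comp_mem_compacts_right B (inlL_isAdjointPair B H₁ H₂).symm S.2)⟩

variable {B H₁ H₂} in
/-- `S ↦ 0 ⊕ S`, the identification of `𝒦(H₂)` with a corner of `𝒦(H₁ ⊕ H₂)`. -/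
def cornerSnd (S : compactAlg B H₂) : compactAlg B (DSum B H₁ H₂) :=
  ⟨(inrL B H₁ H₂).comp ((S : H₂ →L[ℂ] H₂).comp (sndL B H₁ H₂)),
    comp_mem_compacts_left B (inrL_isAdjointPair B H₁ H₂)
      (comp_mem_compacts_right B (inrL_isAdjointPair B H₁ H₂).symm S.2)⟩

variable {B H₁ H₂} in
/-- The identification of `𝒦(H₂, H₁)` with `P₁ 𝒦(H₁ ⊕ H₂) P₂`, taking `T` to
`(x₁, x₂) ↦ (T x₂, 0)`. -/
def offDiag (T : compacts B H₂ H₁) : compactAlg B (DSum B H₁ H₂) :=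
  ⟨(inlL B H₁ H₂).comp ((T : H₂ →L[ℂ] H₁).comp (sndL B H₁ H₂)),
    comp_mem_compacts_left B (inlL_isAdjointPair B H₁ H₂)
      (comp_mem_compacts_right B (inrL_isAdjointPair B H₁ H₂).symm T.2)⟩

end DirectSum

section DirectSumTensor

variable {B C : Type*} [NonUnitalCStarAlgebra B] [PartialOrder B] [StarOrderedRing B]
  [NonUnitalCStarAlgebra C] [PartialOrder C] [StarOrderedRing C]
  {H₁ H₂ Y Z₁ Z₂ : Type*}
  [NormedAddCommGroup H₁] [NormedSpace ℂ H₁] [SMul Bᵐᵒᵖ H₁] [RightHilbertModule B H₁]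
  [NormedAddCommGroup H₂] [NormedSpace ℂ H₂] [SMul Bᵐᵒᵖ H₂] [RightHilbertModule B H₂]
  [NormedAddCommGroup Y] [NormedSpace ℂ Y] [CompleteSpace Y] [SMul Cᵐᵒᵖ Y]
  [RightHilbertModule C Y]
  [NormedAddCommGroup Z₁] [NormedSpace ℂ Z₁] [SMul Cᵐᵒᵖ Z₁] [RightHilbertModule C Z₁]
  [NormedAddCommGroup Z₂] [NormedSpace ℂ Z₂] [SMul Cᵐᵒᵖ Z₂] [RightHilbertModule C Z₂]
  {φ : B →⋆ₙₐ[ℂ] adjointableAlg C Y} {t₁ : H₁ →ₗ[ℂ] Y →ₗ[ℂ] Z₁}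
  {t₂ : H₂ →ₗ[ℂ] Y →ₗ[ℂ] Z₂}

variable (B C) in
/-- The bilinear map `(x₁, x₂) ⊗ y ↦ (x₁ ⊗ y, x₂ ⊗ y)`. -/
def dsumTensor (t₁ : H₁ →ₗ[ℂ] Y →ₗ[ℂ] Z₁) (t₂ : H₂ →ₗ[ℂ] Y →ₗ[ℂ] Z₂) :
    DSum B H₁ H₂ →ₗ[ℂ] Y →ₗ[ℂ] DSum C Z₁ Z₂ :=
  LinearMap.mk₂ ℂ (fun x y => inlL C Z₁ Z₂ (t₁ x.1 y) + inrL C Z₁ Z₂ (t₂ x.2 y))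
    (fun x x' y => by simp; abel) (fun c x y => by simp)
    (fun x y y' => by simp; abel) (fun c x y => by simp)

lemma dsumTensor_apply (x : DSum B H₁ H₂) (y : Y) :
    dsumTensor B C t₁ t₂ x y = inlL C Z₁ Z₂ (t₁ x.1 y) + inrL C Z₁ Z₂ (t₂ x.2 y) := rfl

lemma isTensor_dsum (h₁ : IsTensor φ t₁) (h₂ : IsTensor φ t₂) :
    IsTensor φ (dsumTensor B C t₁ t₂) where
  inner x x' y y' := by
    have e : ∀ (x : DSum B H₁ H₂) y, (dsumTensor B C t₁ t₂ x y).1 = t₁ x.1 y := fun x y =>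
      add_zero (t₁ x.1 y)
    have e' : ∀ (x : DSum B H₁ H₂) y, (dsumTensor B C t₁ t₂ x y).2 = t₂ x.2 y := fun x y =>
      zero_add (t₂ x.2 y)
    rw [rinner_dsum, e, e', e, e', h₁.inner, h₂.inner, rinner_dsum, map_add, ← rinner_add_right]
    rfl
  dense := by
    rw [eq_top_iff]
    rintro z -
    set N := (Submodule.span ℂ {z | ∃ x y, z = dsumTensor B C t₁ t₂ x y}).topologicalClosure
    have hz : z = inlL C Z₁ Z₂ (fstL C Z₁ Z₂ z) + inrL C Z₁ Z₂ (sndL C Z₁ Z₂ z) := by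
      have h1 : z.1 = z.1 + 0 := (add_zero _).symm
      have h2 : z.2 = 0 + z.2 := (zero_add _).symm
      exact Prod.ext h1 h2
    have k1 : ∀ z₁, inlL C Z₁ Z₂ z₁ ∈ N := by
      intro z₁
      have : (Submodule.span ℂ {z | ∃ x y, z = t₁ x y}).topologicalClosure ≤
          N.comap (inlL C Z₁ Z₂).toLinearMap := by
        refine Submodule.topologicalClosure_minimal _ (Submodule.span_le.mpr ?_)
          ((Submodule.isClosed_topologicalClosure _).preimage (inlL C Z₁ Z₂).continuous)
        rintro _ ⟨x, y, rfl⟩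
        refine Submodule.le_topologicalClosure _ (Submodule.subset_span ⟨inlL B H₁ H₂ x, y, ?_⟩)
        have h0 : inrL C Z₁ Z₂ (t₂ (inlL B H₁ H₂ x).2 y) = 0 := by
          have : (inlL B H₁ H₂ x).2 = 0 := rfl
          rw [this]; simp
        rw [dsumTensor_apply, h0, add_zero]; rfl
      rw [h₁.dense] at this
      exact this trivial
    have k2 : ∀ z₂, inrL C Z₁ Z₂ z₂ ∈ N := by
      intro z₂
      have : (Submodule.span ℂ {z | ∃ x y, z = t₂ x y}).topologicalClosure ≤
          N.comap (inrL C Z₁ Z₂).toLinearMap := by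
        refine Submodule.topologicalClosure_minimal _ (Submodule.span_le.mpr ?_)
          ((Submodule.isClosed_topologicalClosure _).preimage (inrL C Z₁ Z₂).continuous)
        rintro _ ⟨x, y, rfl⟩
        refine Submodule.le_topologicalClosure _ (Submodule.subset_span ⟨inrL B H₁ H₂ x, y, ?_⟩)
        have h0 : inlL C Z₁ Z₂ (t₁ (inrL B H₁ H₂ x).1 y) = 0 := by
          have : (inrL B H₁ H₂ x).1 = 0 := rfl
          rw [this]; simp
        rw [dsumTensor_apply, h0, zero_add]; rfl
      rw [h₂.dense] at this
      exact this trivial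
    rw [hz]
    exact N.add_mem (k1 _) (k2 _)

end DirectSumTensor

section Completion

open UniformSpace

variable (A : Type*) [NonUnitalNormedRing A] [NormedSpace ℂ A] [IsScalarTower ℂ A A]
  [SMulCommClass ℂ A A] [StarRing A] [StarModule ℂ A] [CStarRing A]

/-- The completion of a normed algebra with involution satisfying the C⋆-identity. -/
def CStarCompletion : Type _ := UniformSpace.Completion A

namespace CStarCompletion

instance : NormedAddCommGroup (CStarCompletion A) :=
  inferInstanceAs (NormedAddCommGroup (UniformSpace.Completion A))
instance : NormedSpace ℂ (CStarCompletion A) :=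
  inferInstanceAs (NormedSpace ℂ (UniformSpace.Completion A))
instance : CompleteSpace (CStarCompletion A) :=
  inferInstanceAs (CompleteSpace (UniformSpace.Completion A))

variable {A} in
/-- The inclusion of an algebra in its completion. -/
def incl (a : A) : CStarCompletion A := (a : UniformSpace.Completion A)

lemma continuous_incl : Continuous (incl (A := A)) := Completion.continuous_coe A

lemma isDenseInducing_incl : IsDenseInducing (incl (A := A)) := Completion.isDenseInducing_coe

lemma incl_add (a b : A) : incl (a + b) = incl a + incl b := Completion.coe_add a b
lemma incl_zero : incl (0 : A) = 0 := Completion.coe_zero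
lemma incl_smul (c : ℂ) (a : A) : incl (c • a) = c • incl a := Completion.coe_smul c a
lemma norm_incl (a : A) : ‖incl a‖ = ‖a‖ := Completion.norm_coe a

variable {A} in
@[elab_as_elim]
lemma ind {p : CStarCompletion A → Prop} (x : CStarCompletion A) (hp : IsClosed {x | p x})
    (h : ∀ a, p (incl a)) : p x := Completion.induction_on x hp h

variable {A} in
@[elab_as_elim]
lemma ind₂ {p : CStarCompletion A → CStarCompletion A → Prop} (x y : CStarCompletion A)
    (hp : IsClosed {x : CStarCompletion A × CStarCompletion A | p x.1 x.2})
    (h : ∀ a b, p (incl a) (incl b)) : p x y := Completion.induction_on₂ x y hp h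

variable {A} in
@[elab_as_elim]
lemma ind₃ {p : CStarCompletion A → CStarCompletion A → CStarCompletion A → Prop}
    (x y z : CStarCompletion A)
    (hp : IsClosed {x : CStarCompletion A × CStarCompletion A × CStarCompletion A |
      p x.1 x.2.1 x.2.2})
    (h : ∀ a b c, p (incl a) (incl b) (incl c)) : p x y z := Completion.induction_on₃ x y z hp h

instance : Mul (CStarCompletion A) :=
  ⟨Function.curry <| ((isDenseInducing_incl A).prodMap (isDenseInducing_incl A)).extend
    (incl ∘ Function.uncurry (· * ·))⟩

lemma incl_mul (a b : A) : incl (a * b) = incl a * incl b :=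
  (((isDenseInducing_incl A).prodMap (isDenseInducing_incl A)).extend_eq
      ((continuous_incl A).comp (continuous_mul (M := A))) (a, b)).symm

instance : ContinuousMul (CStarCompletion A) where
  continuous_mul := by
    let m := (AddMonoidHom.mul : A →+ A →+ A).compr₂ Completion.toCompl
    have : Continuous fun p : A × A => m p.1 p.2 := (continuous_incl A).comp continuous_mul
    have di : IsDenseInducing (Completion.toCompl : A → Completion A) :=
      Completion.isDenseInducing_coe
    exact (di.extend_Z_bilin di this :)

instance : Star (CStarCompletion A) := ⟨Completion.map (star : A → A)⟩

lemma continuous_star' : Continuous (star : CStarCompletion A → CStarCompletion A) :=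
  Completion.continuous_map

lemma incl_star (a : A) : incl (star a) = star (incl a) :=
  (Completion.map_coe (starₗᵢ (E := A) ℂ).isometry.uniformContinuous a).symm

lemma mul_add_aux (a b c : CStarCompletion A) : a * (b + c) = a * b + a * c := by
  refine ind₃ a b c ?_ fun a b c => ?_
  · exact isClosed_eq (by fun_prop) (by fun_prop)
  rw [← incl_add, ← incl_mul, ← incl_mul, ← incl_mul, ← incl_add, mul_add]

lemma add_mul_aux (a b c : CStarCompletion A) : (a + b) * c = a * c + b * c := by
  refine ind₃ a b c ?_ fun a b c => ?_
  · exact isClosed_eq (by fun_prop) (by fun_prop)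
  rw [← incl_add, ← incl_mul, ← incl_mul, ← incl_mul, ← incl_add, add_mul]

lemma zero_mul_aux (a : CStarCompletion A) : 0 * a = 0 := by
  refine ind a ?_ fun a => ?_
  · exact isClosed_eq (by fun_prop) continuous_const
  rw [← incl_zero, ← incl_mul, zero_mul]

lemma mul_zero_aux (a : CStarCompletion A) : a * 0 = 0 := by
  refine ind a ?_ fun a => ?_
  · exact isClosed_eq (by fun_prop) continuous_const
  rw [← incl_zero, ← incl_mul, mul_zero]

lemma mul_assoc_aux (a b c : CStarCompletion A) : a * b * c = a * (b * c) := by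
  refine ind₃ a b c ?_ fun a b c => ?_
  · exact isClosed_eq (by fun_prop) (by fun_prop)
  rw [← incl_mul, ← incl_mul, ← incl_mul, ← incl_mul, mul_assoc]

lemma norm_mul_aux (a b : CStarCompletion A) : ‖a * b‖ ≤ ‖a‖ * ‖b‖ := by
  refine ind₂ a b ?_ fun a b => ?_
  · exact isClosed_le (by fun_prop) (by fun_prop)
  rw [← incl_mul, norm_incl, norm_incl, norm_incl]
  exact norm_mul_le a b

lemma star_star_aux (a : CStarCompletion A) : star (star a) = a := by
  refine ind a ?_ fun a => ?_
  · exact isClosed_eq ((continuous_star' A).comp (continuous_star' A)) continuous_id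
  rw [← incl_star, ← incl_star, star_star]

lemma star_mul_aux (a b : CStarCompletion A) : star (a * b) = star b * star a := by
  refine ind₂ a b ?_ fun a b => ?_
  · exact isClosed_eq ((continuous_star' A).comp (by fun_prop))
      (((continuous_star' A).comp continuous_snd).mul ((continuous_star' A).comp continuous_fst))
  rw [← incl_mul, ← incl_star, ← incl_star, ← incl_star, ← incl_mul, star_mul]

lemma star_add_aux (a b : CStarCompletion A) : star (a + b) = star a + star b := by
  refine ind₂ a b ?_ fun a b => ?_
  · exact isClosed_eq ((continuous_star' A).comp (by fun_prop))
      (((continuous_star' A).comp continuous_fst).add ((continuous_star' A).comp continuous_snd))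
  rw [← incl_add, ← incl_star, ← incl_star, ← incl_star, ← incl_add, star_add]

lemma continuous_smul_aux (c : ℂ) : Continuous fun a : CStarCompletion A => c • a :=
  continuous_const_smul (T := UniformSpace.Completion A) c

lemma star_smul_aux (c : ℂ) (a : CStarCompletion A) : star (c • a) = star c • star a := by
  refine ind a ?_ fun a => ?_
  · exact isClosed_eq ((continuous_star' A).comp (continuous_smul_aux A c))
      ((continuous_smul_aux A (star c)).comp (continuous_star' A))
  rw [← incl_smul, ← incl_star, ← incl_star, ← incl_smul, star_smul]

lemma smul_mul_aux (c : ℂ) (a b : CStarCompletion A) : (c • a) * b = c • (a * b) := by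
  refine ind₂ a b ?_ fun a b => ?_
  · exact isClosed_eq (((continuous_smul_aux A c).comp continuous_fst).mul continuous_snd)
      ((continuous_smul_aux A c).comp (continuous_fst.mul continuous_snd))
  rw [← incl_smul, ← incl_mul, ← incl_mul, ← incl_smul, smul_mul_assoc]

lemma mul_smul_aux (c : ℂ) (a b : CStarCompletion A) : c • (a * b) = a * (c • b) := by
  refine ind₂ a b ?_ fun a b => ?_
  · exact isClosed_eq ((continuous_smul_aux A c).comp (continuous_fst.mul continuous_snd))
      (continuous_fst.mul ((continuous_smul_aux A c).comp continuous_snd))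
  rw [← incl_smul, ← incl_mul, ← incl_mul, ← incl_smul, mul_smul_comm]

lemma norm_star_mul_aux (a : CStarCompletion A) : ‖a‖ * ‖a‖ ≤ ‖star a * a‖ := by
  refine ind a ?_ fun a => ?_
  · exact isClosed_le (by fun_prop)
      (continuous_norm.comp (((continuous_star' A)).mul continuous_id))
  rw [← incl_star, ← incl_mul, norm_incl, norm_incl]
  exact CStarRing.norm_mul_self_le a

/-- The completion is a C⋆-algebra. -/
instance : NonUnitalCStarAlgebra (CStarCompletion A) where
  __ := (inferInstance : NormedAddCommGroup (CStarCompletion A))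
  __ := (inferInstance : NormedSpace ℂ (CStarCompletion A))
  __ := (inferInstance : Mul (CStarCompletion A))
  __ := (inferInstance : CompleteSpace (CStarCompletion A))
  left_distrib := mul_add_aux A
  right_distrib := add_mul_aux A
  zero_mul := zero_mul_aux A
  mul_zero := mul_zero_aux A
  mul_assoc := mul_assoc_aux A
  norm_mul_le := norm_mul_aux A
  star := star
  star_involutive := star_star_aux A
  star_mul := star_mul_aux A
  star_add := star_add_aux A
  star_smul := star_smul_aux A
  smul_assoc := smul_mul_aux A
  smul_comm := mul_smul_aux A
  norm_mul_self_le := norm_star_mul_aux A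

end CStarCompletion

end Completion

section Limits

universe u w

variable {ι : Type w} [Preorder ι] [IsDirectedOrder ι] [Nonempty ι]

variable (ι) in
/-- A direct system of normed spaces with isometric linear connecting maps. -/
structure BanachSystem where
  V : ι → Type u
  [grp : ∀ i, NormedAddCommGroup (V i)]
  [mod : ∀ i, NormedSpace ℂ (V i)]
  map : ∀ i j, i ≤ j → V i →ₗᵢ[ℂ] V j
  map_self : ∀ i x, map i i le_rfl x = x
  map_map : ∀ i j l (hij : i ≤ j) (hjl : j ≤ l) x, map j l hjl (map i j hij x) =
    map i l (hij.trans hjl) x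

attribute [instance] BanachSystem.grp BanachSystem.mod

variable (ι) in
/-- A direct system of C⋆-algebras with injective connecting `⋆`-homomorphisms. -/
structure CStarSystem where
  G : ι → Type u
  [alg : ∀ i, NonUnitalCStarAlgebra (G i)]
  map : ∀ i j, i ≤ j → G i →⋆ₙₐ[ℂ] G j
  inj : ∀ i j h, Function.Injective (map i j h)
  map_self : ∀ i x, map i i le_rfl x = x
  map_map : ∀ i j l (hij : i ≤ j) (hjl : j ≤ l) x, map j l hjl (map i j hij x) =
    map i l (hij.trans hjl) x

attribute [instance] CStarSystem.alg

namespace BanachSystem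

variable (S : BanachSystem.{u} ι)

instance : DirectedSystem S.V (S.map · · ·) where
  map_self i x := S.map_self i x
  map_map _ _ _ hij hjl x := S.map_map _ _ _ hij hjl x

/-- The algebraic direct limit. -/
def Alg : Type _ := DirectLimit S.V S.map

instance : AddCommGroup S.Alg := inferInstanceAs (AddCommGroup (DirectLimit S.V S.map))
instance : Module ℂ S.Alg := inferInstanceAs (Module ℂ (DirectLimit S.V S.map))

/-- The norm of the class of `x : V i` is `‖x‖`. -/
instance : Norm S.Alg := ⟨DirectLimit.lift S.map (fun _ x => ‖x‖) fun i j h x =>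
  ((S.map i j h).norm_map x).symm⟩

/-- The canonical map of `V i` to the algebraic direct limit. -/
def toAlg (i : ι) : S.V i →ₗ[ℂ] S.Alg where
  toFun x := (⟦⟨i, x⟩⟧ : DirectLimit S.V S.map)
  map_add' x y := (DirectLimit.add_def (f := S.map) i x y).symm
  map_smul' c x := (DirectLimit.smul_def (f := S.map) i x c).symm

lemma norm_toAlg (i : ι) (x : S.V i) : ‖S.toAlg i x‖ = ‖x‖ := rfl

lemma toAlg_map (i j : ι) (h : i ≤ j) (x : S.V i) : S.toAlg j (S.map i j h x) = S.toAlg i x :=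
  DirectLimit.mk_apply (f := S.map) i j x h

lemma alg_ind₂ {p : S.Alg → S.Alg → Prop} (h : ∀ i x y, p (S.toAlg i x) (S.toAlg i y))
    (a b : S.Alg) : p a b := DirectLimit.induction₂ S.map h a b

lemma alg_ind {p : S.Alg → Prop} (h : ∀ i x, p (S.toAlg i x))
    (a : S.Alg) : p a := DirectLimit.induction S.map h a

lemma algCore : NormedSpace.Core ℂ S.Alg where
  norm_nonneg := S.alg_ind fun i x => norm_nonneg x
  norm_smul c := S.alg_ind fun i x => by
    rw [← map_smul, norm_toAlg, norm_toAlg, norm_smul]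
  norm_triangle := S.alg_ind₂ fun i x y => by
    rw [← map_add, norm_toAlg, norm_toAlg, norm_toAlg]
    exact norm_add_le x y
  norm_eq_zero_iff := S.alg_ind fun i x => by
    rw [norm_toAlg, norm_eq_zero]
    refine ⟨fun h => by rw [h, map_zero], fun h => ?_⟩
    have h0 : ‖S.toAlg i x‖ = ‖S.toAlg i 0‖ := by rw [h, map_zero]
    rwa [norm_toAlg, norm_toAlg, norm_zero, norm_eq_zero] at h0

instance : NormedAddCommGroup S.Alg := NormedAddCommGroup.ofCore S.algCore
instance : NormedSpace ℂ S.Alg := NormedSpace.ofCore S.algCore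

/-- The inductive limit in the category of Banach spaces: the completion of the algebraic direct
limit. -/
abbrev Lim : Type _ := UniformSpace.Completion S.Alg

/-- The canonical isometry of `V i` into the inductive limit. -/
def of (i : ι) : S.V i →ₗᵢ[ℂ] S.Lim :=
  (UniformSpace.Completion.toComplₗᵢ (𝕜 := ℂ) (E := S.Alg)).comp
    { S.toAlg i with norm_map' := S.norm_toAlg i }

end BanachSystem

namespace CStarSystem

variable (S : CStarSystem.{u} ι)

instance : DirectedSystem S.G (S.map · · ·) where
  map_self i x := S.map_self i x
  map_map _ _ _ hij hjl x := S.map_map _ _ _ hij hjl x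

/-- The algebraic direct limit. -/
def Alg : Type _ := DirectLimit S.G S.map

instance : NonUnitalRing S.Alg := inferInstanceAs (NonUnitalRing (DirectLimit S.G S.map))
instance : Module ℂ S.Alg := inferInstanceAs (Module ℂ (DirectLimit S.G S.map))
instance : StarRing S.Alg where
  star := (star : DirectLimit S.G S.map → DirectLimit S.G S.map)
  star_involutive := star_involutive (R := DirectLimit S.G S.map)
  star_mul := star_mul (R := DirectLimit S.G S.map)
  star_add := star_add (R := DirectLimit S.G S.map)
instance : IsScalarTower ℂ S.Alg S.Alg :=
  inferInstanceAs (IsScalarTower ℂ (DirectLimit S.G S.map) (DirectLimit S.G S.map))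
instance : SMulCommClass ℂ S.Alg S.Alg :=
  inferInstanceAs (SMulCommClass ℂ (DirectLimit S.G S.map) (DirectLimit S.G S.map))
/-- The norm of the class of `x : G i` is `‖x‖`. -/
instance : Norm S.Alg := ⟨DirectLimit.lift S.map (fun _ x => ‖x‖) fun i j h x =>
  (NonUnitalStarAlgHom.norm_map (S.map i j h) (S.inj i j h) x).symm⟩

/-- The canonical map of `G i` to the algebraic direct limit. -/
def toAlg (i : ι) : S.G i →⋆ₙₐ[ℂ] S.Alg where
  toFun x := (⟦⟨i, x⟩⟧ : DirectLimit S.G S.map)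
  map_add' x y := (DirectLimit.add_def (f := S.map) i x y).symm
  map_zero' := (DirectLimit.zero_def (f := S.map) i).symm
  map_mul' x y := (DirectLimit.mul_def (f := S.map) i x y).symm
  map_smul' c x := (DirectLimit.smul_def (f := S.map) i x c).symm
  map_star' x := (DirectLimit.star_def (f := S.map) i x).symm

lemma norm_toAlg (i : ι) (x : S.G i) : ‖S.toAlg i x‖ = ‖x‖ := rfl

lemma toAlg_map (i j : ι) (h : i ≤ j) (x : S.G i) : S.toAlg j (S.map i j h x) = S.toAlg i x :=
  DirectLimit.mk_apply (f := S.map) i j x h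

lemma alg_ind₂ {p : S.Alg → S.Alg → Prop} (h : ∀ i x y, p (S.toAlg i x) (S.toAlg i y))
    (a b : S.Alg) : p a b := DirectLimit.induction₂ S.map h a b

lemma alg_ind {p : S.Alg → Prop} (h : ∀ i x, p (S.toAlg i x))
    (a : S.Alg) : p a := DirectLimit.induction S.map h a

instance : StarModule ℂ S.Alg where
  star_smul c := S.alg_ind fun i x => by
    rw [← map_smul, ← map_star, ← map_star, ← map_smul, star_smul]

lemma algCore : NormedSpace.Core ℂ S.Alg where
  norm_nonneg := S.alg_ind fun i x => norm_nonneg x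
  norm_smul c := S.alg_ind fun i x => by
    rw [← map_smul, norm_toAlg, norm_toAlg, norm_smul]
  norm_triangle := S.alg_ind₂ fun i x y => by
    rw [← map_add, norm_toAlg, norm_toAlg, norm_toAlg]
    exact norm_add_le x y
  norm_eq_zero_iff := S.alg_ind fun i x => by
    rw [norm_toAlg, norm_eq_zero]
    refine ⟨fun h => by rw [h, map_zero], fun h => ?_⟩
    have h0 : ‖S.toAlg i x‖ = ‖S.toAlg i 0‖ := by rw [h, map_zero]
    rwa [norm_toAlg, norm_toAlg, norm_zero, norm_eq_zero] at h0

instance : NormedAddCommGroup S.Alg := NormedAddCommGroup.ofCore S.algCore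
instance : NormedSpace ℂ S.Alg := NormedSpace.ofCore S.algCore

instance : NonUnitalNormedRing S.Alg where
  __ := (inferInstance : NormedAddCommGroup S.Alg)
  __ := (inferInstance : NonUnitalRing S.Alg)
  norm_mul_le := S.alg_ind₂ fun i x y => by
    rw [← map_mul, norm_toAlg, norm_toAlg, norm_toAlg]
    exact norm_mul_le x y

instance : CStarRing S.Alg where
  norm_mul_self_le := S.alg_ind fun i x => by
    rw [← map_star, ← map_mul, norm_toAlg, norm_toAlg]
    exact CStarRing.norm_mul_self_le x

/-- The inductive limit in the category of C⋆-algebras: the completion of the algebraic direct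
limit. -/
abbrev Lim : Type _ := CStarCompletion S.Alg

/-- A C⋆-algebra carries the order in which `0 ≤ a` iff `a` is of the form `b⋆ b`. -/
instance : PartialOrder S.Lim := CStarAlgebra.spectralOrder S.Lim
instance : StarOrderedRing S.Lim := CStarAlgebra.spectralOrderedRing S.Lim

/-- The canonical injective `⋆`-homomorphism of `G i` into the inductive limit. -/
def of (i : ι) : S.G i →⋆ₙₐ[ℂ] S.Lim where
  toFun x := CStarCompletion.incl (S.toAlg i x)
  map_add' x y := by rw [map_add, CStarCompletion.incl_add]
  map_zero' := by rw [map_zero, CStarCompletion.incl_zero]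
  map_mul' x y := by rw [map_mul, CStarCompletion.incl_mul]
  map_smul' c x := by rw [map_smul, CStarCompletion.incl_smul]; rfl
  map_star' x := by rw [map_star, CStarCompletion.incl_star]

lemma norm_of (i : ι) (x : S.G i) : ‖S.of i x‖ = ‖x‖ := CStarCompletion.norm_incl _ _

lemma of_map (i j : ι) (h : i ≤ j) (x : S.G i) : S.of j (S.map i j h x) = S.of i x :=
  congrArg CStarCompletion.incl (S.toAlg_map i j h x)

lemma lim_ind {p : S.Lim → Prop} (a : S.Lim) (hp : IsClosed {x | p x})
    (h : ∀ i x, p (S.of i x)) : p a :=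
  CStarCompletion.ind a hp (S.alg_ind h)

lemma lim_ind₂ {p : S.Lim → S.Lim → Prop} (a b : S.Lim)
    (hp : IsClosed {x : S.Lim × S.Lim | p x.1 x.2})
    (h : ∀ i x y, p (S.of i x) (S.of i y)) : p a b :=
  CStarCompletion.ind₂ a b hp (S.alg_ind₂ h)

variable {S} in
/-- The endomorphism of the algebraic direct limit given by a compatible family of maps. -/
def mapAlg (f : ∀ i, S.G i →ₗ[ℂ] S.G i)
    (hc : ∀ i j h x, S.map i j h (f i x) = f j (S.map i j h x)) (a : S.Alg) : S.Alg :=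
  DirectLimit.lift S.map (fun i x => S.toAlg i (f i x))
    (fun i j h x => ((congrArg (S.toAlg j) (hc i j h x)).symm.trans (S.toAlg_map i j h _)).symm) a

lemma mapAlg_toAlg (f : ∀ i, S.G i →ₗ[ℂ] S.G i)
    (hc : ∀ i j h x, S.map i j h (f i x) = f j (S.map i j h x)) (i : ι) (x : S.G i) :
    mapAlg f hc (S.toAlg i x) = S.toAlg i (f i x) := rfl

/-- The endomorphism of the inductive limit given by a compatible family of contractions. -/
def mapLim (f : ∀ i, S.G i →ₗ[ℂ] S.G i) (hc : ∀ i j h x, S.map i j h (f i x) = f j (S.map i j h x))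
    (hf : ∀ i x, ‖f i x‖ ≤ ‖x‖) : S.Lim →L[ℂ] S.Lim :=
  ContinuousLinearMap.completion
    (LinearMap.mkContinuous
      { toFun := mapAlg f hc
        map_add' := S.alg_ind₂ fun i x y => by
          rw [← map_add, mapAlg_toAlg, mapAlg_toAlg, mapAlg_toAlg, map_add, map_add]
        map_smul' := fun c => S.alg_ind fun i x => by
          rw [← map_smul, mapAlg_toAlg, mapAlg_toAlg, map_smul, map_smul, RingHom.id_apply] }
      1 (S.alg_ind fun i x => by
        rw [one_mul]
        exact hf i x))

lemma mapLim_of (f : ∀ i, S.G i →ₗ[ℂ] S.G i)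
    (hc : ∀ i j h x, S.map i j h (f i x) = f j (S.map i j h x))
    (hf : ∀ i x, ‖f i x‖ ≤ ‖x‖) (i : ι) (x : S.G i) :
    S.mapLim f hc hf (S.of i x) = S.of i (f i x) :=
  ContinuousLinearMap.completion_apply_coe _ (S.toAlg i x)

/-- The multiplier of the inductive limit given by compatible families of left and right
multiplications. -/
def multLim (l r : ∀ i, S.G i →ₗ[ℂ] S.G i)
    (hl : ∀ i j h x, S.map i j h (l i x) = l j (S.map i j h x))
    (hr : ∀ i j h x, S.map i j h (r i x) = r j (S.map i j h x))
    (hl' : ∀ i x, ‖l i x‖ ≤ ‖x‖) (hr' : ∀ i x, ‖r i x‖ ≤ ‖x‖)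
    (hlr : ∀ i x y, r i x * y = x * l i y) : DoubleCentralizer ℂ S.Lim where
  toProd := (S.mapLim l hl hl', S.mapLim r hr hr')
  central e f := by
    change S.mapLim r hr hr' e * f = e * S.mapLim l hl hl' f
    refine S.lim_ind₂ (p := fun e f => S.mapLim r hr hr' e * f = e * S.mapLim l hl hl' f) e f
      (isClosed_eq ?_ ?_) fun i x y => ?_
    · exact ((S.mapLim r hr hr').continuous.comp continuous_fst).mul continuous_snd
    · exact continuous_fst.mul ((S.mapLim l hl hl').continuous.comp continuous_snd)
    · rw [mapLim_of, mapLim_of, ← map_mul, ← map_mul, hlr]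

end CStarSystem

end Limits

section Multipliers

variable (B : Type*) [NonUnitalCStarAlgebra B] [PartialOrder B] [StarOrderedRing B]
  {H : Type*} [NormedAddCommGroup H] [NormedSpace ℂ H] [CompleteSpace H]
  [SMul Bᵐᵒᵖ H] [RightHilbertModule B H]

/-- Left multiplication `T ↦ P T` of compact operators by a projection. -/
def leftMul (P : H →L[ℂ] H) (hP : IsAdjointPair B P P) : compactAlg B H →ₗ[ℂ] compactAlg B H where
  toFun T := ⟨P.comp (T : H →L[ℂ] H), comp_mem_compacts_left B hP T.2⟩
  map_add' S T := Subtype.ext (ContinuousLinearMap.ext fun x => by simp)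
  map_smul' c T := Subtype.ext (ContinuousLinearMap.ext fun x => by simp)

/-- Right multiplication `T ↦ T P` of compact operators by a projection. -/
def rightMul (P : H →L[ℂ] H) (hP : IsAdjointPair B P P) : compactAlg B H →ₗ[ℂ] compactAlg B H where
  toFun T := ⟨(T : H →L[ℂ] H).comp P, comp_mem_compacts_right B hP T.2⟩
  map_add' S T := Subtype.ext (ContinuousLinearMap.ext fun x => by simp)
  map_smul' c T := Subtype.ext (ContinuousLinearMap.ext fun x => by simp)

lemma norm_proj_le {P : H →L[ℂ] H} (hP : IsAdjointPair B P P) (h2 : P.comp P = P) : ‖P‖ ≤ 1 := by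
  have h := hP.norm_sq_le
  rw [h2] at h
  by_contra! h1
  nlinarith

lemma norm_leftMul_le {P : H →L[ℂ] H} (hP : IsAdjointPair B P P) (h2 : P.comp P = P)
    (T : compactAlg B H) : ‖leftMul B P hP T‖ ≤ ‖T‖ := by
  change ‖P.comp (T : H →L[ℂ] H)‖ ≤ ‖(T : H →L[ℂ] H)‖
  refine (ContinuousLinearMap.opNorm_comp_le _ _).trans ?_
  exact mul_le_of_le_one_left (norm_nonneg _) (norm_proj_le B hP h2)

lemma norm_rightMul_le {P : H →L[ℂ] H} (hP : IsAdjointPair B P P) (h2 : P.comp P = P)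
    (T : compactAlg B H) : ‖rightMul B P hP T‖ ≤ ‖T‖ := by
  change ‖(T : H →L[ℂ] H).comp P‖ ≤ ‖(T : H →L[ℂ] H)‖
  refine (ContinuousLinearMap.opNorm_comp_le _ _).trans ?_
  exact mul_le_of_le_one_right (norm_nonneg _) (norm_proj_le B hP h2)

lemma projFst_comp_self (H₁ H₂ : Type*)
    [NormedAddCommGroup H₁] [NormedSpace ℂ H₁] [SMul Bᵐᵒᵖ H₁] [RightHilbertModule B H₁]
    [NormedAddCommGroup H₂] [NormedSpace ℂ H₂] [SMul Bᵐᵒᵖ H₂] [RightHilbertModule B H₂] :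
    (projFst B H₁ H₂).comp (projFst B H₁ H₂) = projFst B H₁ H₂ := rfl

lemma projSnd_comp_self (H₁ H₂ : Type*)
    [NormedAddCommGroup H₁] [NormedSpace ℂ H₁] [SMul Bᵐᵒᵖ H₁] [RightHilbertModule B H₁]
    [NormedAddCommGroup H₂] [NormedSpace ℂ H₂] [SMul Bᵐᵒᵖ H₂] [RightHilbertModule B H₂] :
    (projSnd B H₁ H₂).comp (projSnd B H₁ H₂) = projSnd B H₁ H₂ := rfl

end Multipliers

section MultipliersTensor

variable {B C : Type*} [NonUnitalCStarAlgebra B] [PartialOrder B] [StarOrderedRing B]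
  [NonUnitalCStarAlgebra C] [PartialOrder C] [StarOrderedRing C]
  {H H₁ H₂ Y Z Z₁ Z₂ : Type*}
  [NormedAddCommGroup H] [NormedSpace ℂ H] [SMul Bᵐᵒᵖ H] [RightHilbertModule B H]
  [NormedAddCommGroup H₁] [NormedSpace ℂ H₁] [SMul Bᵐᵒᵖ H₁] [RightHilbertModule B H₁]
  [NormedAddCommGroup H₂] [NormedSpace ℂ H₂] [SMul Bᵐᵒᵖ H₂] [RightHilbertModule B H₂]
  [NormedAddCommGroup Y] [NormedSpace ℂ Y] [CompleteSpace Y] [SMul Cᵐᵒᵖ Y]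
  [RightHilbertModule C Y]
  [NormedAddCommGroup Z] [NormedSpace ℂ Z] [SMul Cᵐᵒᵖ Z] [RightHilbertModule C Z]
  [NormedAddCommGroup Z₁] [NormedSpace ℂ Z₁] [SMul Cᵐᵒᵖ Z₁] [RightHilbertModule C Z₁]
  [NormedAddCommGroup Z₂] [NormedSpace ℂ Z₂] [SMul Cᵐᵒᵖ Z₂] [RightHilbertModule C Z₂]
  [CompleteSpace H] [CompleteSpace Z]
  {φ : B →⋆ₙₐ[ℂ] adjointableAlg C Y} {t : H →ₗ[ℂ] Y →ₗ[ℂ] Z}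
  (t₁ : H₁ →ₗ[ℂ] Y →ₗ[ℂ] Z₁) (t₂ : H₂ →ₗ[ℂ] Y →ₗ[ℂ] Z₂)

lemma projFst_dsumTensor (x : DSum B H₁ H₂) (y : Y) :
    projFst C Z₁ Z₂ (dsumTensor B C t₁ t₂ x y) = dsumTensor B C t₁ t₂ (projFst B H₁ H₂ x) y := by
  rw [dsumTensor_apply, dsumTensor_apply]
  have h1 : (projFst B H₁ H₂ x).1 = x.1 := rfl
  have h2 : (projFst B H₁ H₂ x).2 = 0 := rfl
  rw [h1, h2, map_add]
  have h3 : projFst C Z₁ Z₂ (inlL C Z₁ Z₂ (t₁ x.1 y)) = inlL C Z₁ Z₂ (t₁ x.1 y) := rfl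
  have h4 : projFst C Z₁ Z₂ (inrL C Z₁ Z₂ (t₂ x.2 y)) = 0 := rfl
  rw [h3, h4, map_zero, LinearMap.zero_apply, map_zero]

lemma projSnd_dsumTensor (x : DSum B H₁ H₂) (y : Y) :
    projSnd C Z₁ Z₂ (dsumTensor B C t₁ t₂ x y) = dsumTensor B C t₁ t₂ (projSnd B H₁ H₂ x) y := by
  rw [dsumTensor_apply, dsumTensor_apply]
  have h1 : (projSnd B H₁ H₂ x).1 = 0 := rfl
  have h2 : (projSnd B H₁ H₂ x).2 = x.2 := rfl
  rw [h1, h2, map_add]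
  have h3 : projSnd C Z₁ Z₂ (inrL C Z₁ Z₂ (t₂ x.2 y)) = inrL C Z₁ Z₂ (t₂ x.2 y) := rfl
  have h4 : projSnd C Z₁ Z₂ (inlL C Z₁ Z₂ (t₁ x.1 y)) = 0 := rfl
  rw [h3, h4, map_zero, LinearMap.zero_apply, map_zero]

lemma ampAlg_leftMul (ht : IsTensor φ t) (hφ : ∀ b, (φ b : Y →L[ℂ] Y) ∈ compacts C Y Y)
    {P : H →L[ℂ] H} (hP : IsAdjointPair B P P) {Q : Z →L[ℂ] Z} (hQ : IsAdjointPair C Q Q)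
    (h : ∀ x y, Q (t x y) = t (P x) y) (T : compactAlg B H) :
    ampAlg ht hφ (leftMul B P hP T) = leftMul C Q hQ (ampAlg ht hφ T) :=
  ampAlg_eq ht hφ fun x y =>
    (congrArg Q (ampAlg_apply ht hφ T x y)).trans (h _ _)

lemma ampAlg_rightMul (ht : IsTensor φ t) (hφ : ∀ b, (φ b : Y →L[ℂ] Y) ∈ compacts C Y Y)
    {P : H →L[ℂ] H} (hP : IsAdjointPair B P P) {Q : Z →L[ℂ] Z} (hQ : IsAdjointPair C Q Q)
    (h : ∀ x y, Q (t x y) = t (P x) y) (T : compactAlg B H) :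
    ampAlg ht hφ (rightMul B P hP T) = rightMul C Q hQ (ampAlg ht hφ T) :=
  ampAlg_eq ht hφ fun x y =>
    (congrArg (ampAlg ht hφ T : Z →L[ℂ] Z) (h x y)).trans (ampAlg_apply ht hφ T (P x) y)

end MultipliersTensor

section Imprimitivity

/-- An `A`-`B` imprimitivity bimodule structure on the Banach space `E`: a full left Hilbert
`A`-module and full right Hilbert `B`-module, whose two norms are that of `E`, with commuting
actions which are adjointable for the inner product of the other side, and with
`_A⟨x, y⟩ z = x ⟨y, z⟩_B`. -/
structure ImprimitivityBimodule (A B E : Type*)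
    [NonUnitalCStarAlgebra A] [PartialOrder A] [StarOrderedRing A]
    [NonUnitalCStarAlgebra B] [PartialOrder B] [StarOrderedRing B]
    [NormedAddCommGroup E] [NormedSpace ℂ E] where
  complete : CompleteSpace E
  [smulLeft : SMul A E]
  [smulRight : SMul Bᵐᵒᵖ E]
  [left : CStarModule A E]
  [right : CStarModule Bᵐᵒᵖ E]
  /-- The left inner product `_A⟨x, y⟩`, linear in the first variable. -/
  linner : E → E → A
  linner_eq : ∀ x y, linner x y = inner A y x
  smul_rsmul : ∀ (a : A) (x : E) (b : B), (a • x) <• b = a • (x <• b)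
  rinner_smul : ∀ (a : A) (x y : E), rinner B (a • x) y = rinner B x (star a • y)
  linner_rsmul : ∀ (b : B) (x y : E), linner (x <• b) y = linner x (y <• star b)
  linner_smul_eq : ∀ x y z : E, linner x y • z = x <• rinner B y z
  left_full : Dense (Submodule.span ℂ {a | ∃ x y, a = linner x y} : Set A)
  right_full : Dense (Submodule.span ℂ {b | ∃ x y : E, b = rinner B x y} : Set B)

namespace ImprimitivityBimodule

variable {A B E : Type*} [NonUnitalCStarAlgebra A] [PartialOrder A] [StarOrderedRing A]
  [NonUnitalCStarAlgebra B] [PartialOrder B] [StarOrderedRing B]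
  [NormedAddCommGroup E] [NormedSpace ℂ E] (M : ImprimitivityBimodule A B E)

/-- The left action `a · x`. -/
def lact (a : A) (x : E) : E := M.smulLeft.smul a x

/-- The right action `x · b`. -/
def ract (x : E) (b : B) : E := M.smulRight.smul (op b) x

/-- The right inner product `⟨x, y⟩_B`, linear in the second variable. -/
def rin (x y : E) : B := unop (M.right.toInner.inner x y)

end ImprimitivityBimodule

universe u₀

/-- `A` and `B` are Morita–Rieffel equivalent: there is an `A`-`B` imprimitivity bimodule. -/
def MoritaRieffelEquivalent (A B : Type*)
    [NonUnitalCStarAlgebra A] [PartialOrder A] [StarOrderedRing A]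
    [NonUnitalCStarAlgebra B] [PartialOrder B] [StarOrderedRing B] : Prop :=
  ∃ (E : Type u₀) (_ : NormedAddCommGroup E) (_ : NormedSpace ℂ E),
    Nonempty (ImprimitivityBimodule A B E)

end Imprimitivity

section KGraphs

open CategoryTheory

universe u v

set_option linter.checkUnivs false in
/-- A `k`-graph: a nonempty countable small category with a degree functor to `ℕ^k` that has the
unique factorisation property.  A morphism `α : v ⟶ w` has source `v` and range `w`, and
the product `αβ` is `β ≫ α`. -/
structure KGraph (k : ℕ) where
  Obj : Type u
  [cat : Category.{v} Obj]
  nonempty : Nonempty Obj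
  countable_obj : Countable Obj
  countable_hom : ∀ v w : Obj, Countable (v ⟶ w)
  d : ∀ {v w : Obj}, (v ⟶ w) → (Fin k → ℕ)
  d_id : ∀ v : Obj, d (𝟙 v) = 0
  d_comp : ∀ {u v w : Obj} (β : u ⟶ v) (α : v ⟶ w), d (β ≫ α) = d α + d β
  /-- If `d γ = m + n`, then `γ = αβ` for unique `α`, `β` with `d α = m` and `d β = n`. -/
  factor : ∀ {u w : Obj} (γ : u ⟶ w) (m n : Fin k → ℕ), d γ = m + n →
    ∃! p : Σ v : Obj, (u ⟶ v) × (v ⟶ w), p.2.1 ≫ p.2.2 = γ ∧ d p.2.2 = m ∧ d p.2.1 = n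

attribute [instance] KGraph.cat

namespace KGraph

variable {k : ℕ} (Λ : KGraph.{u, v} k)

/-- For each vertex `w` and each `n ∈ ℕ^k` the set `wΛ^n` of the morphisms of degree `n` and
range `w` is finite and nonempty. -/
structure IsRowFiniteNoSources : Prop where
  finite : ∀ (w : Λ.Obj) (n : Fin k → ℕ), {p : Σ v : Λ.Obj, v ⟶ w | Λ.d p.2 = n}.Finite
  nonempty : ∀ (w : Λ.Obj) (n : Fin k → ℕ), {p : Σ v : Λ.Obj, v ⟶ w | Λ.d p.2 = n}.Nonempty

variable {Λ}

/-- A morphism of degree zero is an identity. -/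
lemma eq_id_of_d_eq_zero {v w : Λ.Obj} (α : v ⟶ w) (h : Λ.d α = 0) :
    (⟨v, α⟩ : Σ u : Λ.Obj, u ⟶ w) = ⟨w, 𝟙 w⟩ := by
  obtain ⟨p, -, hp⟩ := Λ.factor α 0 0 (by rw [h, add_zero])
  have h1 := hp ⟨v, 𝟙 v, α⟩ ⟨Category.id_comp α, h, Λ.d_id v⟩
  have h2 := hp ⟨w, α, 𝟙 w⟩ ⟨Category.comp_id α, Λ.d_id w, h⟩
  have h3 := h1.trans h2.symm
  obtain rfl : v = w := congrArg Sigma.fst h3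
  have h4 := eq_of_heq (Sigma.mk.inj h3).2
  rw [(Prod.mk.inj h4).2]

/-- Left cancellation: `αβ = αβ'` implies `β = β'`. -/
lemma cancel {u v w : Λ.Obj} {β β' : u ⟶ v} {α : v ⟶ w} (h : β ≫ α = β' ≫ α) : β = β' := by
  have hd : Λ.d β = Λ.d β' := by
    have := congrArg Λ.d h
    rw [Λ.d_comp, Λ.d_comp] at this
    exact add_left_cancel this
  obtain ⟨p, -, hp⟩ := Λ.factor (β ≫ α) (Λ.d α) (Λ.d β) (Λ.d_comp β α)
  have h1 := hp ⟨v, β, α⟩ ⟨rfl, rfl, rfl⟩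
  have h2 := hp ⟨v, β', α⟩ ⟨h.symm, rfl, hd.symm⟩
  exact (Prod.mk.inj (eq_of_heq (Sigma.mk.inj (h1.trans h2.symm)).2)).1

variable (Λ) in
/-- An infinite path in `Λ`: a degree-preserving functor from the `k`-graph `Ω_k` to `Λ`.  The
objects of `Ω_k` are the elements of `ℕ^k`; its morphisms are the pairs `(m, n)` with `m ≤ n`, with
range `m`, source `n`, degree `n - m` and `(m, n)(n, p) = (m, p)`. -/
@[ext]
structure InfinitePath where
  vtx : (Fin k → ℕ) → Λ.Obj
  seg : ∀ {m n : Fin k → ℕ}, m ≤ n → (vtx n ⟶ vtx m)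
  seg_self : ∀ m, seg (le_refl m) = 𝟙 (vtx m)
  seg_comp : ∀ {m n p : Fin k → ℕ} (hmn : m ≤ n) (hnp : n ≤ p),
    seg hnp ≫ seg hmn = seg (hmn.trans hnp)
  d_seg : ∀ {m n : Fin k → ℕ} (h : m ≤ n), Λ.d (seg h) = n - m

namespace InfinitePath

/-- The shift `σ^p`, with `σ^p(x)(m, n) = x(m + p, n + p)`. -/
def shift (p : Fin k → ℕ) (x : Λ.InfinitePath) : Λ.InfinitePath where
  vtx m := x.vtx (m + p)
  seg h := x.seg (add_le_add_left h p)
  seg_self m := x.seg_self (m + p)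
  seg_comp _ _ := x.seg_comp _ _
  d_seg h := by rw [x.d_seg]; exact add_tsub_add_eq_tsub_right _ _ _

/-- The initial segment `x(0, p)`. -/
abbrev init (x : Λ.InfinitePath) (p : Fin k → ℕ) : x.vtx p ⟶ x.vtx 0 := x.seg (zero_le (a := p))

lemma seg_cast (x : Λ.InfinitePath) {m m' n : Fin k → ℕ} (h : m ≤ n) (e : m = m') :
    x.seg h ≫ eqToHom (congrArg x.vtx e) = x.seg (e ▸ h : m' ≤ n) := by
  subst e
  simp

lemma d_init (x : Λ.InfinitePath) (p : Fin k → ℕ) : Λ.d (x.init p) = p := by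
  rw [x.d_seg]; exact tsub_zero p

/-- `α = x(0, p)`. -/
def IsInit (x : Λ.InfinitePath) (p : Fin k → ℕ) {v : Λ.Obj} (α : v ⟶ x.vtx 0) : Prop :=
  (⟨v, α⟩ : Σ u : Λ.Obj, u ⟶ x.vtx 0) = ⟨x.vtx p, x.init p⟩

/-- `x = αz`, that is, `x(0, d(α)) = α` and `σ^{d(α)}(x) = z`. -/
def IsConcat (x : Λ.InfinitePath) {v : Λ.Obj} (α : v ⟶ x.vtx 0) (z : Λ.InfinitePath) : Prop :=
  x.IsInit (Λ.d α) α ∧ x.shift (Λ.d α) = z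

lemma IsInit.d_eq {x : Λ.InfinitePath} {p : Fin k → ℕ} {v : Λ.Obj} {α : v ⟶ x.vtx 0}
    (h : x.IsInit p α) : Λ.d α = p := by
  have := congrArg (fun s : Σ u : Λ.Obj, u ⟶ x.vtx 0 => Λ.d s.2) h
  simpa [d_init] using this

lemma IsConcat.vtx_eq {x : Λ.InfinitePath} {v : Λ.Obj} {α : v ⟶ x.vtx 0} {z : Λ.InfinitePath}
    (h : x.IsConcat α z) : z.vtx 0 = v := by
  have h1 : v = x.vtx (Λ.d α) := congrArg Sigma.fst h.1
  rw [← h.2]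
  exact (congrArg x.vtx (zero_add _)).trans h1.symm

lemma IsInit.extend {x : Λ.InfinitePath} {p : Fin k → ℕ} {v : Λ.Obj} {α : v ⟶ x.vtx 0}
    (h : x.IsInit p α) (hv : (x.shift p).vtx 0 = v) (r : Fin k → ℕ) :
    x.IsInit (r + p) ((x.shift p).init r ≫ eqToHom hv ≫ α) := by
  unfold IsInit at h
  obtain rfl : v = x.vtx p := congrArg Sigma.fst h
  obtain rfl : α = x.init p := eq_of_heq (Sigma.mk.inj h).2
  have h2 := x.seg_cast (m := 0 + p) (m' := p) (n := r + p) (add_le_add_left (zero_le (a := r)) p)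
    (zero_add p)
  have h3 : (x.shift p).init r ≫ eqToHom hv ≫ x.init p = x.init (r + p) := by
    rw [← Category.assoc]
    change (x.seg (add_le_add_left (zero_le (a := r)) p) ≫ eqToHom _) ≫ x.init p = _
    rw [h2, x.seg_comp]
  unfold IsInit
  rw [h3]
  rfl

lemma isInit_extend {x : Λ.InfinitePath} {v : Λ.Obj} {α : v ⟶ x.vtx 0} {z : Λ.InfinitePath}
    (h : x.IsConcat α z) (r : Fin k → ℕ) :
    x.IsInit (r + Λ.d α) (z.init r ≫ eqToHom h.vtx_eq ≫ α) := by
  have hv := h.vtx_eq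
  obtain ⟨h1, rfl⟩ := h
  exact h1.extend hv r

lemma shift_shift (x : Λ.InfinitePath) (p r : Fin k → ℕ) :
    (x.shift p).shift r = x.shift (r + p) := by
  have key : ∀ f g : (Fin k → ℕ) → (Fin k → ℕ), f = g → ∀ (hf : Monotone f) (hg : Monotone g),
      HEq (fun {m n : Fin k → ℕ} (h : m ≤ n) => x.seg (hf h))
        (fun {m n : Fin k → ℕ} (h : m ≤ n) => x.seg (hg h)) := by
    rintro f _ rfl hf hg
    rfl
  have hfg : (fun m : Fin k → ℕ => m + r + p) = fun m => m + (r + p) := funext fun m => add_assoc _ _ _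
  refine InfinitePath.ext ?_ ?_
  · exact congrArg (fun f : (Fin k → ℕ) → (Fin k → ℕ) => fun m => x.vtx (f m)) hfg
  · exact key _ _ hfg (fun _ _ h => add_le_add_left (add_le_add_left h r) p)
      (fun _ _ h => add_le_add_left h (r + p))

lemma isConcat_extend {x : Λ.InfinitePath} {v : Λ.Obj} {α : v ⟶ x.vtx 0} {z : Λ.InfinitePath}
    (h : x.IsConcat α z) (r : Fin k → ℕ) :
    x.IsConcat (z.init r ≫ eqToHom h.vtx_eq ≫ α) (z.shift r) := by
  have h1 := isInit_extend h r
  refine ⟨by rw [h1.d_eq]; exact h1, ?_⟩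
  rw [h1.d_eq, ← shift_shift, h.2]

end InfinitePath

variable (Λ) in
/-- The elements `(x, n, y)` of the path groupoid of `Λ`. -/
structure PathGroupoid where
  x : Λ.InfinitePath
  n : Fin k → ℤ
  y : Λ.InfinitePath
  mem : ∃ l m : Fin k → ℕ, x.shift l = y.shift m ∧ ∀ i, n i = (l i : ℤ) - (m i : ℤ)

/-- The set `D_g` of the pairs `(λ, μ)` such that `x = λz` and `y = μz` for some `z`, and
`d(λ) - d(μ) = n`, where `g = (x, n, y)`; here `dom` is the common source of `λ` and `μ`. -/
structure PairIndex (g : Λ.PathGroupoid) where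
  dom : Λ.Obj
  lam : dom ⟶ g.x.vtx 0
  mu : dom ⟶ g.y.vtx 0
  exists_tail : ∃ z, g.x.IsConcat lam z ∧ g.y.IsConcat mu z
  deg : ∀ i, (Λ.d lam i : ℤ) - (Λ.d mu i : ℤ) = g.n i

namespace PairIndex

variable {g : Λ.PathGroupoid}

/-- `(λ, μ) ≤ (λ', μ')` if `d(λ) ≤ d(λ')`. -/
instance : Preorder (PairIndex g) := Preorder.lift fun a => Λ.d a.lam

lemma le_def {a b : PairIndex g} : a ≤ b ↔ Λ.d a.lam ≤ Λ.d b.lam := Iff.rfl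

/-- If `(λ, μ) ≤ (λ', μ')`, then `λ' = λν` and `μ' = μν` for some `ν`. -/
lemma exists_factor {a b : PairIndex g} (h : a ≤ b) :
    ∃ ν : b.dom ⟶ a.dom, ν ≫ a.lam = b.lam ∧ ν ≫ a.mu = b.mu := by
  obtain ⟨z, hx, hy⟩ := a.exists_tail
  obtain ⟨z', hx', hy'⟩ := b.exists_tail
  rw [le_def] at h
  set r := Λ.d b.lam - Λ.d a.lam with hr
  have h1 : r + Λ.d a.lam = Λ.d b.lam := tsub_add_cancel_of_le h
  have h2 : r + Λ.d a.mu = Λ.d b.mu := by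
    funext i
    have e1 := a.deg i
    have e2 := b.deg i
    have e3 := congrFun h1 i
    simp only [Pi.add_apply] at e3 ⊢
    omega
  have k1 := InfinitePath.isInit_extend hx r
  have k2 := InfinitePath.isInit_extend hy r
  rw [h1] at k1
  rw [h2] at k2
  have l1 := hx'.1.trans k1.symm
  have l2 := hy'.1.trans k2.symm
  have e : b.dom = z.vtx r := congrArg Sigma.fst l1
  have tr : ∀ {w u u' : Λ.Obj} (α : u ⟶ w) (α' : u' ⟶ w) (e : u = u'),
      (⟨u, α⟩ : Σ u : Λ.Obj, u ⟶ w) = ⟨u', α'⟩ → eqToHom e ≫ α' = α := by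
    rintro w u u' α α' rfl h
    rw [eqToHom_refl, Category.id_comp]
    exact (eq_of_heq (Sigma.mk.inj h).2).symm
  refine ⟨eqToHom e ≫ z.init r ≫ eqToHom hx.vtx_eq, ?_, ?_⟩
  · simpa only [Category.assoc] using tr _ _ e l1
  · simpa only [Category.assoc] using tr _ _ e l2

/-- The morphism `ν` with `λ' = λν` and `μ' = μν`, for `(λ, μ) ≤ (λ', μ')`. -/
def conn {a b : PairIndex g} (h : a ≤ b) : b.dom ⟶ a.dom := (exists_factor h).choose

lemma conn_lam {a b : PairIndex g} (h : a ≤ b) : conn h ≫ a.lam = b.lam :=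
  (exists_factor h).choose_spec.1

lemma conn_mu {a b : PairIndex g} (h : a ≤ b) : conn h ≫ a.mu = b.mu :=
  (exists_factor h).choose_spec.2

lemma conn_self (a : PairIndex g) : conn (le_refl a) = 𝟙 a.dom :=
  cancel (α := a.lam) (by rw [conn_lam, Category.id_comp])

lemma conn_comp {a b c : PairIndex g} (h : a ≤ b) (h' : b ≤ c) :
    conn h' ≫ conn h = conn (h.trans h') :=
  cancel (α := a.lam) (by rw [Category.assoc, conn_lam, conn_lam, conn_lam])

lemma exists_extend (a : PairIndex g) (r : Fin k → ℕ) :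
    ∃ b : PairIndex g, Λ.d b.lam = r + Λ.d a.lam := by
  obtain ⟨z, hx, hy⟩ := a.exists_tail
  have h1 := (InfinitePath.isInit_extend hx r).d_eq
  have h2 := (InfinitePath.isInit_extend hy r).d_eq
  refine ⟨⟨z.vtx r, z.init r ≫ eqToHom hx.vtx_eq ≫ a.lam, z.init r ≫ eqToHom hy.vtx_eq ≫ a.mu,
    ⟨z.shift r, InfinitePath.isConcat_extend hx r, InfinitePath.isConcat_extend hy r⟩,
    fun i => ?_⟩, h1⟩
  rw [h1, h2, ← a.deg i]
  simp only [Pi.add_apply]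
  push_cast
  ring

instance : IsDirectedOrder (PairIndex g) where
  directed a b := by
    obtain ⟨c, hc⟩ := a.exists_extend (Λ.d b.lam)
    exact ⟨c, by rw [le_def, hc]; exact le_add_self, by rw [le_def, hc]; exact le_self_add⟩

instance : Nonempty (PairIndex g) := by
  obtain ⟨l, m, h, hn⟩ := g.mem
  have e : g.x.vtx l = g.y.vtx m := by
    have h0 := congrArg (fun z : Λ.InfinitePath => z.vtx 0) h
    have h1 : g.x.vtx (0 + l) = g.y.vtx (0 + m) := h0
    rwa [zero_add, zero_add] at h1
  have h2 : g.y.IsInit m (eqToHom e ≫ g.y.init m) := by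
    have tr : ∀ {w u u' : Λ.Obj} (α : u' ⟶ w) (e : u = u'),
        (⟨u, eqToHom e ≫ α⟩ : Σ u : Λ.Obj, u ⟶ w) = ⟨u', α⟩ := by
      rintro w u u' α rfl
      rw [eqToHom_refl, Category.id_comp]
    exact tr _ e
  have h1 : g.x.IsInit l (g.x.init l) := rfl
  refine ⟨⟨g.x.vtx l, g.x.init l, eqToHom e ≫ g.y.init m, ⟨g.x.shift l, ⟨?_, ?_⟩, ⟨?_, ?_⟩⟩, ?_⟩⟩
  · rw [h1.d_eq]; exact h1
  · rw [h1.d_eq]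
  · rw [h2.d_eq]; exact h2
  · rw [h2.d_eq, h]
  · intro i
    rw [h1.d_eq, h2.d_eq, hn i]

end PairIndex

end KGraph

end KGraphs

section Transitivity

variable {B C D : Type*} [NonUnitalCStarAlgebra B] [PartialOrder B] [StarOrderedRing B]
  [NonUnitalCStarAlgebra C] [PartialOrder C] [StarOrderedRing C]
  [NonUnitalCStarAlgebra D] [PartialOrder D] [StarOrderedRing D]
  {H H' Y₁ Z Z' Y₂ Y₃ W W' : Type*}
  [NormedAddCommGroup H] [NormedSpace ℂ H] [CompleteSpace H]
  [SMul Bᵐᵒᵖ H] [RightHilbertModule B H]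
  [NormedAddCommGroup H'] [NormedSpace ℂ H'] [CompleteSpace H']
  [SMul Bᵐᵒᵖ H'] [RightHilbertModule B H']
  [NormedAddCommGroup Y₁] [NormedSpace ℂ Y₁] [CompleteSpace Y₁]
  [SMul Cᵐᵒᵖ Y₁] [RightHilbertModule C Y₁]
  [NormedAddCommGroup Z] [NormedSpace ℂ Z] [CompleteSpace Z]
  [SMul Cᵐᵒᵖ Z] [RightHilbertModule C Z]
  [NormedAddCommGroup Z'] [NormedSpace ℂ Z'] [CompleteSpace Z']
  [SMul Cᵐᵒᵖ Z'] [RightHilbertModule C Z']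
  [NormedAddCommGroup Y₂] [NormedSpace ℂ Y₂] [CompleteSpace Y₂]
  [SMul Dᵐᵒᵖ Y₂] [RightHilbertModule D Y₂]
  [NormedAddCommGroup Y₃] [NormedSpace ℂ Y₃] [CompleteSpace Y₃]
  [SMul Dᵐᵒᵖ Y₃] [RightHilbertModule D Y₃]
  [NormedAddCommGroup W] [NormedSpace ℂ W] [CompleteSpace W]
  [SMul Dᵐᵒᵖ W] [RightHilbertModule D W]
  [NormedAddCommGroup W'] [NormedSpace ℂ W'] [CompleteSpace W']
  [SMul Dᵐᵒᵖ W'] [RightHilbertModule D W']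
  {φ₁ : B →⋆ₙₐ[ℂ] adjointableAlg C Y₁} {φ₂ : C →⋆ₙₐ[ℂ] adjointableAlg D Y₂}
  {φ₃ : B →⋆ₙₐ[ℂ] adjointableAlg D Y₃}
  {t₁ : H →ₗ[ℂ] Y₁ →ₗ[ℂ] Z} {t₂ : Z →ₗ[ℂ] Y₂ →ₗ[ℂ] W} {t₃ : H →ₗ[ℂ] Y₃ →ₗ[ℂ] W}
  {t₁' : H' →ₗ[ℂ] Y₁ →ₗ[ℂ] Z'} {t₂' : Z' →ₗ[ℂ] Y₂ →ₗ[ℂ] W'} {t₃' : H' →ₗ[ℂ] Y₃ →ₗ[ℂ] W'}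
  {s : Y₁ →ₗ[ℂ] Y₂ →ₗ[ℂ] Y₃}

/-- `(T ⊗ 1) ⊗ 1 = T ⊗ 1`, for compact `T : H → H`. -/
lemma ampAlg_ampAlg (h₁ : IsTensor φ₁ t₁) (h₂ : IsTensor φ₂ t₂) (h₃ : IsTensor φ₃ t₃)
    (hs : IsTensor φ₂ s) (hφ₁ : ∀ b, (φ₁ b : Y₁ →L[ℂ] Y₁) ∈ compacts C Y₁ Y₁)
    (hφ₂ : ∀ b, (φ₂ b : Y₂ →L[ℂ] Y₂) ∈ compacts D Y₂ Y₂)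
    (hφ₃ : ∀ b, (φ₃ b : Y₃ →L[ℂ] Y₃) ∈ compacts D Y₃ Y₃)
    (hassoc : ∀ x y z, t₂ (t₁ x y) z = t₃ x (s y z)) (T : compactAlg B H) :
    ampAlg h₂ hφ₂ (ampAlg h₁ hφ₁ T) = ampAlg h₃ hφ₃ T := by
  refine (ampAlg_eq h₃ hφ₃ fun x y => ?_).symm
  have key : (ampAlg h₂ hφ₂ (ampAlg h₁ hφ₁ T) : W →L[ℂ] W).comp (creation h₃ x) =
      creation h₃ ((T : H →L[ℂ] H) x) := hs.ext fun y z => by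
    change (ampAlg h₂ hφ₂ (ampAlg h₁ hφ₁ T) : W →L[ℂ] W) (t₃ x (s y z)) =
      t₃ ((T : H →L[ℂ] H) x) (s y z)
    rw [← hassoc, ← hassoc, ampAlg_apply, ampAlg_apply]
  exact congrArg (fun f : Y₃ →L[ℂ] W => f y) key

/-- `(T ⊗ 1) ⊗ 1 = T ⊗ 1`, for compact `T : H → H'`. -/
lemma ampLin_ampLin (h₁ : IsTensor φ₁ t₁) (h₁' : IsTensor φ₁ t₁') (h₂ : IsTensor φ₂ t₂)
    (h₂' : IsTensor φ₂ t₂') (h₃ : IsTensor φ₃ t₃) (h₃' : IsTensor φ₃ t₃')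
    (hs : IsTensor φ₂ s) (hφ₁ : ∀ b, (φ₁ b : Y₁ →L[ℂ] Y₁) ∈ compacts C Y₁ Y₁)
    (hφ₂ : ∀ b, (φ₂ b : Y₂ →L[ℂ] Y₂) ∈ compacts D Y₂ Y₂)
    (hφ₃ : ∀ b, (φ₃ b : Y₃ →L[ℂ] Y₃) ∈ compacts D Y₃ Y₃)
    (i₁ : Function.Injective φ₁) (i₂ : Function.Injective φ₂) (i₃ : Function.Injective φ₃)
    (hassoc : ∀ x y z, t₂ (t₁ x y) z = t₃ x (s y z))
    (hassoc' : ∀ x y z, t₂' (t₁' x y) z = t₃' x (s y z)) (T : compacts B H H') :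
    ampLin h₂ h₂' hφ₂ i₂ (ampLin h₁ h₁' hφ₁ i₁ T) = ampLin h₃ h₃' hφ₃ i₃ T := by
  refine (ampLin_eq h₃ h₃' hφ₃ i₃ fun x y => ?_).symm
  have key : (ampLin h₂ h₂' hφ₂ i₂ (ampLin h₁ h₁' hφ₁ i₁ T) : W →L[ℂ] W').comp (creation h₃ x) =
      creation h₃' ((T : H →L[ℂ] H') x) := hs.ext fun y z => by
    change (ampLin h₂ h₂' hφ₂ i₂ (ampLin h₁ h₁' hφ₁ i₁ T) : W →L[ℂ] W') (t₃ x (s y z)) =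
      t₃' ((T : H →L[ℂ] H') x) (s y z)
    rw [← hassoc, ← hassoc', ampLin_apply, ampLin_apply]
  exact congrArg (fun f : Y₃ →L[ℂ] W' => f y) key

lemma dsumTensor_assoc (hassoc : ∀ x y z, t₂ (t₁ x y) z = t₃ x (s y z))
    (hassoc' : ∀ x y z, t₂' (t₁' x y) z = t₃' x (s y z)) (x : DSum B H H') (y : Y₁) (z : Y₂) :
    dsumTensor C D t₂ t₂' (dsumTensor B C t₁ t₁' x y) z = dsumTensor B D t₃ t₃' x (s y z) := by
  have e : (dsumTensor B C t₁ t₁' x y).1 = t₁ x.1 y := add_zero (t₁ x.1 y)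
  have e' : (dsumTensor B C t₁ t₁' x y).2 = t₁' x.2 y := zero_add (t₁' x.2 y)
  rw [dsumTensor_apply (dsumTensor B C t₁ t₁' x y) z, e, e', hassoc, hassoc', dsumTensor_apply]

lemma dsumTensor_rsmul [SMul Bᵐᵒᵖ Y₁] [RightHilbertModule B Y₁] {t : H →ₗ[ℂ] Y₁ →ₗ[ℂ] H} {t' : H' →ₗ[ℂ] Y₁ →ₗ[ℂ] H'} {e : Y₁ → B}
    (h : ∀ x y, t x y = x <• e y) (h' : ∀ x y, t' x y = x <• e y) (x : DSum B H H') (y : Y₁) :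
    dsumTensor B B t t' x y = x <• e y := by
  rw [dsumTensor_apply, h, h']
  exact Prod.ext (add_zero (x.1 <• e y)) (zero_add (x.2 <• e y))

end Transitivity

section Systems

open CategoryTheory

universe u v w

set_option linter.checkUnivs false in
/-- A `Λ`-system of C⋆-correspondences over a `k`-graph `Λ`. -/
structure LambdaSystem {k : ℕ} (Λ : KGraph.{u, v} k) where
  /-- The C⋆-algebra `A_v`; the order is the one given by the C⋆-structure. -/
  A : Λ.Obj → Type w
  [algA : ∀ v, NonUnitalCStarAlgebra (A v)]
  [ordA : ∀ v, PartialOrder (A v)]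
  [sorA : ∀ v, StarOrderedRing (A v)]
  /-- The right Hilbert `A_{s(α)}`-module `X_α`. -/
  X : ∀ {v w : Λ.Obj}, (v ⟶ w) → Type w
  [grpX : ∀ {v w : Λ.Obj} (α : v ⟶ w), NormedAddCommGroup (X α)]
  [modX : ∀ {v w : Λ.Obj} (α : v ⟶ w), NormedSpace ℂ (X α)]
  [comX : ∀ {v w : Λ.Obj} (α : v ⟶ w), CompleteSpace (X α)]
  [actX : ∀ {v w : Λ.Obj} (α : v ⟶ w), SMul (A v)ᵐᵒᵖ (X α)]
  [hilX : ∀ {v w : Λ.Obj} (α : v ⟶ w), RightHilbertModule (A v) (X α)]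
  /-- The left action `φ_α` of `A_{r(α)}` on `X_α`. -/
  phi : ∀ {v w : Λ.Obj} (α : v ⟶ w), A w →⋆ₙₐ[ℂ] adjointableAlg (A v) (X α)
  /-- The identification of `X_v` with the identity correspondence `A_v`. -/
  idIso : ∀ v : Λ.Obj, X (𝟙 v) ≃ₗ[ℂ] A v
  idIso_inner : ∀ v (x y : X (𝟙 v)), rinner (A v) x y = star (idIso v x) * idIso v y
  idIso_right : ∀ v (x : X (𝟙 v)) (a : A v), idIso v (x <• a) = idIso v x * a
  idIso_left : ∀ v (a : A v) (x : X (𝟙 v)),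
    idIso v ((phi (𝟙 v) a : X (𝟙 v) →L[ℂ] X (𝟙 v)) x) = a * idIso v x
  /-- The map `χ_{α,β} : X_α ⊗ X_β → X_{αβ}` of correspondences, as a bilinear map; here
  `γ = αβ`.  It preserves the inner product `⟨x ⊗ y, x' ⊗ y'⟩ = ⟨y, φ_β(⟨x, x'⟩) y'⟩` of the internal
  tensor product, hence is balanced and isometric. -/
  chi : ∀ {u v w : Λ.Obj} (α : v ⟶ w) (β : u ⟶ v) (γ : u ⟶ w), β ≫ α = γ →
    X α →ₗ[ℂ] X β →ₗ[ℂ] X γ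
  chi_inner : ∀ {u v w : Λ.Obj} (α : v ⟶ w) (β : u ⟶ v) (γ : u ⟶ w) (h : β ≫ α = γ)
    (x x' : X α) (y y' : X β), rinner (A u) (chi α β γ h x y) (chi α β γ h x' y') =
      rinner (A u) y ((phi β (rinner (A v) x x') : X β →L[ℂ] X β) y')
  chi_left : ∀ {u v w : Λ.Obj} (α : v ⟶ w) (β : u ⟶ v) (γ : u ⟶ w) (h : β ≫ α = γ)
    (a : A w) (x : X α) (y : X β), chi α β γ h ((phi α a : X α →L[ℂ] X α) x) y =
      (phi γ a : X γ →L[ℂ] X γ) (chi α β γ h x y)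
  chi_right : ∀ {u v w : Λ.Obj} (α : v ⟶ w) (β : u ⟶ v) (γ : u ⟶ w) (h : β ≫ α = γ)
    (x : X α) (y : X β) (a : A u), chi α β γ h x (y <• a) = chi α β γ h x y <• a
  /-- `χ_{α,β}` is an isomorphism if `α` is not a vertex. -/
  chi_iso : ∀ {u v w : Λ.Obj} (α : v ⟶ w) (β : u ⟶ v) (γ : u ⟶ w) (h : β ≫ α = γ), Λ.d α ≠ 0 →
    (Submodule.span ℂ {z | ∃ x y, z = chi α β γ h x y}).topologicalClosure = ⊤
  chi_id_left : ∀ {v w : Λ.Obj} (β : v ⟶ w) (x : X (𝟙 w)) (y : X β),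
    chi (𝟙 w) β β (Category.comp_id β) x y = (phi β (idIso w x) : X β →L[ℂ] X β) y
  chi_id_right : ∀ {v w : Λ.Obj} (α : v ⟶ w) (x : X α) (y : X (𝟙 v)),
    chi α (𝟙 v) α (Category.id_comp α) x y = x <• idIso v y
  /-- `χ_{αβ,γ}(χ_{α,β}(x ⊗ y) ⊗ z) = χ_{α,βγ}(x ⊗ χ_{β,γ}(y ⊗ z))`. -/
  chi_assoc : ∀ {t u v w : Λ.Obj} (α : v ⟶ w) (β : u ⟶ v) (γ : t ⟶ u) (αβ : u ⟶ w) (βγ : t ⟶ v)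
    (αβγ : t ⟶ w) (h₁ : β ≫ α = αβ) (h₂ : γ ≫ β = βγ) (h₃ : γ ≫ αβ = αβγ) (h₄ : βγ ≫ α = αβγ)
    (x : X α) (y : X β) (z : X γ),
    chi αβ γ αβγ h₃ (chi α β αβ h₁ x y) z = chi α βγ αβγ h₄ x (chi β γ βγ h₂ y z)

attribute [instance] LambdaSystem.algA LambdaSystem.ordA LambdaSystem.sorA LambdaSystem.grpX
  LambdaSystem.modX LambdaSystem.comX LambdaSystem.actX LambdaSystem.hilX

namespace LambdaSystem

variable {k : ℕ} {Λ : KGraph.{u, v} k} (S : LambdaSystem.{u, v, w} Λ)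

/-- A `Λ`-system is regular if `Λ` is row-finite without sources, every `X_α` is nondegenerate and
full, and every left action `φ_α` is injective and by compact operators. -/
structure IsRegular : Prop where
  graph : Λ.IsRowFiniteNoSources
  nondegenerate : ∀ {v w : Λ.Obj} (α : v ⟶ w), (Submodule.span ℂ
    {z | ∃ a y, z = (S.phi α a : S.X α →L[ℂ] S.X α) y}).topologicalClosure = ⊤
  full : ∀ {v w : Λ.Obj} (α : v ⟶ w), (Submodule.span ℂ
    {a | ∃ x y : S.X α, a = rinner (S.A v) x y}).topologicalClosure = ⊤
  injective : ∀ {v w : Λ.Obj} (α : v ⟶ w), Function.Injective (S.phi α)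
  compact : ∀ {v w : Λ.Obj} (α : v ⟶ w) (a : S.A w),
    (S.phi α a : S.X α →L[ℂ] S.X α) ∈ compacts (S.A v) (S.X α) (S.X α)

variable {S}

/-- In a regular system, `χ_{α,β}` is an isomorphism `X_α ⊗ X_β → X_{αβ}` for all `α`. -/
lemma IsRegular.isTensor (hS : S.IsRegular) {u v w : Λ.Obj} (α : v ⟶ w) (β : u ⟶ v) (γ : u ⟶ w)
    (h : β ≫ α = γ) : IsTensor (S.phi β) (S.chi α β γ h) where
  inner x x' y y' := S.chi_inner α β γ h x x' y y'
  dense := by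
    by_cases h0 : Λ.d α = 0
    · have h1 := KGraph.eq_id_of_d_eq_zero α h0
      obtain rfl : v = w := congrArg Sigma.fst h1
      obtain rfl : α = 𝟙 v := eq_of_heq (Sigma.mk.inj h1).2
      obtain rfl : γ = β := by rw [← h, Category.comp_id]
      rw [← hS.nondegenerate γ]
      congr 2
      ext z
      constructor
      · rintro ⟨x, y, rfl⟩
        exact ⟨S.idIso v x, y, S.chi_id_left γ x y⟩
      · rintro ⟨a, y, rfl⟩
        refine ⟨(S.idIso v).symm a, y, ?_⟩
        rw [S.chi_id_left γ, LinearEquiv.apply_symm_apply]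
    · exact S.chi_iso α β γ h h0

lemma chi_unit {v w : Λ.Obj} (α : v ⟶ w) (ν : v ⟶ v) (hν : ν = 𝟙 v) (h : ν ≫ α = α) :
    ∃ e : S.X ν → S.A v, ∀ x y, S.chi α ν α h x y = x <• e y := by
  subst hν
  exact ⟨S.idIso v, fun x y => S.chi_id_right α x y⟩

lemma chi_unit₂ {v w w' : Λ.Obj} (α : v ⟶ w) (α' : v ⟶ w') (ν : v ⟶ v) (hν : ν = 𝟙 v)
    (h : ν ≫ α = α) (h' : ν ≫ α' = α') :
    ∃ e : S.X ν → S.A v, (∀ x y, S.chi α ν α h x y = x <• e y) ∧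
      ∀ x y, S.chi α' ν α' h' x y = x <• e y := by
  subst hν
  exact ⟨S.idIso v, fun x y => S.chi_id_right α x y, fun x y => S.chi_id_right α' x y⟩

section FibreAlgebra

variable (hS : S.IsRegular) (x : Λ.InfinitePath)

/-- The system of the algebras `𝒦(X_{x(0,n)})`, `n ∈ ℕ^k`, with the connecting maps
`i_{m,n} : 𝒦(X_{x(0,m)}) → 𝒦(X_{x(0,n)})` given by `i_{m,n}(T)(χ(ξ ⊗ η)) = χ(T ξ ⊗ η)`. -/
def fibreSystem : CStarSystem (Fin k → ℕ) where
  G n := compactAlg (S.A (x.vtx n)) (S.X (x.init n))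
  map m n h := ampAlg (hS.isTensor (x.init m) (x.seg h) (x.init n) (x.seg_comp _ h))
    (hS.compact (x.seg h))
  inj m n h := ampAlg_injective _ _ (hS.injective _)
  map_self n T := ampAlg_eq _ _ fun ξ η => by
    obtain ⟨e, he⟩ := chi_unit (S := S) (x.init n) (x.seg le_rfl) (x.seg_self n) (x.seg_comp _ _)
    rw [he, he, (star_isAdjointPair T).map_rsmul]
  map_map l m n hlm hmn T :=
    ampAlg_ampAlg (hS.isTensor (x.init l) (x.seg hlm) (x.init m) (x.seg_comp _ hlm))
      (hS.isTensor (x.init m) (x.seg hmn) (x.init n) (x.seg_comp _ hmn))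
      (hS.isTensor (x.init l) (x.seg (hlm.trans hmn)) (x.init n) (x.seg_comp _ _))
      (hS.isTensor (x.seg hlm) (x.seg hmn) (x.seg (hlm.trans hmn)) (x.seg_comp hlm hmn))
      (hS.compact _) (hS.compact _) (hS.compact _)
      (fun ξ η ζ => S.chi_assoc _ _ _ _ _ _ _ _ _ _ ξ η ζ) T

/-- The fibre algebra `E_x`. -/
abbrev Fibre : Type _ := (fibreSystem hS x).Lim

variable {x} in
/-- The canonical map `i^x_α : 𝒦(X_α) → E_x` for an initial segment `α = x(0, p)` of `x`. -/
def fibreOf {p : Fin k → ℕ} {v : Λ.Obj} {α : v ⟶ x.vtx 0} (h : x.IsInit p α) :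
    compactAlg (S.A v) (S.X α) →⋆ₙₐ[ℂ] Fibre hS x :=
  @Eq.rec (Σ u : Λ.Obj, u ⟶ x.vtx 0) ⟨x.vtx p, x.init p⟩
    (fun s _ => compactAlg (S.A s.1) (S.X s.2) →⋆ₙₐ[ℂ] Fibre hS x)
    ((fibreSystem hS x).of p) ⟨v, α⟩ h.symm

end FibreAlgebra

section Linking

variable (hS : S.IsRegular) (g : Λ.PathGroupoid)

/-- If `λ' = λν` and `μ' = μν`, then `X_{λ'} ⊕ X_{μ'} = (X_λ ⊕ X_μ) ⊗ X_ν`. -/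
lemma isTensor_pair (hS : S.IsRegular) {g : Λ.PathGroupoid} {a b : KGraph.PairIndex g} (h : a ≤ b) :
    IsTensor (S.phi (KGraph.PairIndex.conn h)) (dsumTensor (S.A a.dom) (S.A b.dom)
      (S.chi a.lam (KGraph.PairIndex.conn h) b.lam (KGraph.PairIndex.conn_lam h))
      (S.chi a.mu (KGraph.PairIndex.conn h) b.mu (KGraph.PairIndex.conn_mu h))) :=
  isTensor_dsum
    (hS.isTensor a.lam (KGraph.PairIndex.conn h) b.lam (KGraph.PairIndex.conn_lam h))
    (hS.isTensor a.mu (KGraph.PairIndex.conn h) b.mu (KGraph.PairIndex.conn_mu h))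

/-- The system of the algebras `𝒦(X_λ ⊕ X_μ)`, `(λ, μ) ∈ D_g`, with the connecting maps
`T ↦ T ⊗ 1` for the identification `X_{λν} ⊕ X_{μν} = (X_λ ⊕ X_μ) ⊗ X_ν`. -/
def linkingSystem : CStarSystem (KGraph.PairIndex g) where
  G a := compactAlg (S.A a.dom) (DSum (S.A a.dom) (S.X a.lam) (S.X a.mu))
  map a b h := ampAlg (isTensor_pair hS h) (hS.compact (KGraph.PairIndex.conn h))
  inj a b h := ampAlg_injective _ _ (hS.injective _)
  map_self a T := ampAlg_eq _ _ fun ξ η => by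
    obtain ⟨e, he, he'⟩ := chi_unit₂ (S := S) a.lam a.mu (KGraph.PairIndex.conn (le_refl a))
      (KGraph.PairIndex.conn_self a) (KGraph.PairIndex.conn_lam _) (KGraph.PairIndex.conn_mu _)
    rw [dsumTensor_rsmul he he', dsumTensor_rsmul he he', (star_isAdjointPair T).map_rsmul]
  map_map a b c hab hbc T :=
    ampAlg_ampAlg
      (isTensor_pair hS hab) (isTensor_pair hS hbc) (isTensor_pair hS (hab.trans hbc))
      (hS.isTensor (KGraph.PairIndex.conn hab) (KGraph.PairIndex.conn hbc)
        (KGraph.PairIndex.conn (hab.trans hbc)) (KGraph.PairIndex.conn_comp hab hbc))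
      (hS.compact _) (hS.compact _) (hS.compact _)
      (dsumTensor_assoc (fun ξ η ζ => S.chi_assoc _ _ _ _ _ _ _ _ _ _ ξ η ζ)
        (fun ξ η ζ => S.chi_assoc _ _ _ _ _ _ _ _ _ _ ξ η ζ)) T

/-- The linking algebra `L_g`. -/
abbrev Linking : Type _ := (linkingSystem hS g).Lim

/-- The canonical map `i^g_{λ,μ} : 𝒦(X_λ ⊕ X_μ) → L_g`. -/
def linkingOf (a : KGraph.PairIndex g) :
    compactAlg (S.A a.dom) (DSum (S.A a.dom) (S.X a.lam) (S.X a.mu)) →⋆ₙₐ[ℂ] Linking hS g :=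
  (linkingSystem hS g).of a

/-- The multiplier `P_x` of `L_g`: left and right multiplication by it are induced by left and right
multiplication by the projection `P_λ` of `X_λ ⊕ X_μ` onto `X_λ`. -/
def projX : DoubleCentralizer ℂ (Linking hS g) :=
  (linkingSystem hS g).multLim
    (fun a => leftMul _ _ (projFst_isAdjointPair (S.A a.dom) (S.X a.lam) (S.X a.mu)))
    (fun a => rightMul _ _ (projFst_isAdjointPair (S.A a.dom) (S.X a.lam) (S.X a.mu)))
    (fun a b h T => ampAlg_leftMul (isTensor_pair hS h) (hS.compact _) _ _ (projFst_dsumTensor _ _) T)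
    (fun a b h T => ampAlg_rightMul (isTensor_pair hS h) (hS.compact _) _ _ (projFst_dsumTensor _ _) T)
    (fun a T => norm_leftMul_le _ _ (projFst_comp_self _ _ _) T)
    (fun a T => norm_rightMul_le _ _ (projFst_comp_self _ _ _) T)
    (fun a T T' => rfl)

/-- The multiplier `P_y` of `L_g`: left and right multiplication by it are induced by left and right
multiplication by the projection `P_μ` of `X_λ ⊕ X_μ` onto `X_μ`. -/
def projY : DoubleCentralizer ℂ (Linking hS g) :=
  (linkingSystem hS g).multLim
    (fun a => leftMul _ _ (projSnd_isAdjointPair (S.A a.dom) (S.X a.lam) (S.X a.mu)))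
    (fun a => rightMul _ _ (projSnd_isAdjointPair (S.A a.dom) (S.X a.lam) (S.X a.mu)))
    (fun a b h T => ampAlg_leftMul (isTensor_pair hS h) (hS.compact _) _ _ (projSnd_dsumTensor _ _) T)
    (fun a b h T => ampAlg_rightMul (isTensor_pair hS h) (hS.compact _) _ _ (projSnd_dsumTensor _ _) T)
    (fun a T => norm_leftMul_le _ _ (projSnd_comp_self _ _ _) T)
    (fun a T => norm_rightMul_le _ _ (projSnd_comp_self _ _ _) T)
    (fun a T T' => rfl)

variable {hS g} in
/-- `P L Q = {P e Q : e ∈ L}` for multipliers `P`, `Q` of `L = L_g`. -/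
def corner (P Q : DoubleCentralizer ℂ (Linking hS g)) : Submodule ℂ (Linking hS g) :=
  LinearMap.range (P.fst.comp Q.snd).toLinearMap

/-- `E_g = P_x L_g P_y`. -/
abbrev Bimod : Submodule ℂ (Linking hS g) := corner (projX hS g) (projY hS g)

/-- The system of the Banach spaces `𝒦(X_μ, X_λ)`, `(λ, μ) ∈ D_g`, with the connecting maps
`T ↦ T'` given by `T'(χ(ξ ⊗ η)) = χ(T ξ ⊗ η)`. -/
def offDiagSystem : BanachSystem (KGraph.PairIndex g) where
  V a := compacts (S.A a.dom) (S.X a.mu) (S.X a.lam)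
  map a b h := ampLin
    (hS.isTensor a.mu (KGraph.PairIndex.conn h) b.mu (KGraph.PairIndex.conn_mu h))
    (hS.isTensor a.lam (KGraph.PairIndex.conn h) b.lam (KGraph.PairIndex.conn_lam h))
    (hS.compact (KGraph.PairIndex.conn h)) (hS.injective _)
  map_self a T := ampLin_eq _ _ _ _ fun ξ η => by
    obtain ⟨e, he, he'⟩ := chi_unit₂ (S := S) a.lam a.mu (KGraph.PairIndex.conn (le_refl a))
      (KGraph.PairIndex.conn_self a) (KGraph.PairIndex.conn_lam _) (KGraph.PairIndex.conn_mu _)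
    obtain ⟨T', -, hT⟩ := exists_adjoint _ T.2
    rw [he, he', hT.map_rsmul]
  map_map a b c hab hbc T :=
    ampLin_ampLin
      (hS.isTensor a.mu _ b.mu (KGraph.PairIndex.conn_mu hab))
      (hS.isTensor a.lam _ b.lam (KGraph.PairIndex.conn_lam hab))
      (hS.isTensor b.mu _ c.mu (KGraph.PairIndex.conn_mu hbc))
      (hS.isTensor b.lam _ c.lam (KGraph.PairIndex.conn_lam hbc))
      (hS.isTensor a.mu _ c.mu (KGraph.PairIndex.conn_mu (hab.trans hbc)))
      (hS.isTensor a.lam _ c.lam (KGraph.PairIndex.conn_lam (hab.trans hbc)))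
      (hS.isTensor (KGraph.PairIndex.conn hab) (KGraph.PairIndex.conn hbc)
        (KGraph.PairIndex.conn (hab.trans hbc)) (KGraph.PairIndex.conn_comp hab hbc))
      (hS.compact _) (hS.compact _) (hS.compact _)
      (hS.injective _) (hS.injective _) (hS.injective _)
      (fun ξ η ζ => S.chi_assoc _ _ _ _ _ _ _ _ _ _ ξ η ζ)
      (fun ξ η ζ => S.chi_assoc _ _ _ _ _ _ _ _ _ _ ξ η ζ) T

/-- The inductive limit of the Banach spaces `𝒦(X_μ, X_λ)` over `(λ, μ) ∈ D_g`. -/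
abbrev OffDiagLim : Type _ := (offDiagSystem hS g).Lim

/-- The canonical isometry `𝒦(X_μ, X_λ) → lim 𝒦(X_μ, X_λ)`. -/
def offDiagOf (a : KGraph.PairIndex g) :
    compacts (S.A a.dom) (S.X a.mu) (S.X a.lam) →ₗᵢ[ℂ] OffDiagLim hS g :=
  (offDiagSystem hS g).of a

end Linking

end LambdaSystem

end Systems

end HilbertMod

end

open HilbertMod HilbertMod.LambdaSystem HilbertMod.KGraph

universe u v w

noncomputable section

set_option linter.unusedSectionVars false
set_option linter.unusedVariables false

/-! The algebra `L_g` is a linking algebra for `E_x` and `E_y`, and it inherits this from the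
algebras `𝒦(X_λ ⊕ X_μ)` at the finite stages.

At the stage `(λ, μ)` the projections `P_λ` and `P_μ` cut `𝒦(X_λ ⊕ X_μ)` into corners, among them
`𝒦(X_λ)`, `𝒦(X_μ)` and `𝒦(X_μ, X_λ)`. The maps `T ↦ T ⊗ 1` respect these corners
(`ampAlg_cornerFst`, `ampAlg_cornerSnd`, `ampAlg_offDiag`) and are isometric because the left
actions are injective. Each limit is therefore the closure of an increasing union. The compatible
projections define projections `P_x`, `P_y` in the multiplier algebra
(`CStarSystem.isStarProjection_multLim`), and each corner of `L_g` is the limit of the corresponding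
corners at the finite stages. For `P_x L_g P_y` this is already assertion (c), proved in
`exists_offDiagLim_equiv`.

The limit of the `𝒦(X_λ)` over `D_g` is `E_x`. Indeed every `x(0, n)` is an initial segment of some
`λ` occurring in `D_g`, since a pair can be prolonged along the common tail `z` by any degree; and
two factorisations of the same path through `x(0, n)` agree by left cancellation. This is
`exists_fibreHom`. Applied to the `λ` it gives `Φ_x`, and applied to the `μ` it gives `Φ_y`.

Once `E_x` and `E_y` are corners of `L_g`, the bimodule identities for `E_g` are associativity in
`L_g`, and positivity and norms are read off through the injective maps `Φ_x`, `Φ_y`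
(`cornerImprimitivity`). The remaining point is fullness. It rests on `θ_{ξ,ζ} θ_{ζ',η} =
θ_{ξ⟨ζ,ζ'⟩,η}` for `ξ, η ∈ X_λ` and `ζ, ζ' ∈ X_μ`: since `X_μ` is full, the vectors `ξ⟨ζ,ζ'⟩` span a
dense subspace of `X_λ`, so these products span a dense subspace of `𝒦(X_λ)`. Fullness on the other
side uses that `X_λ` is full in the same way. Morita–Rieffel equivalence follows, with `E_g` as the
bimodule. -/

namespace HilbertMod

open scoped RightActions
open MulOpposite (op unop)

/-! ### Positivity seen through an injective homomorphism. -/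

section Positivity

variable {A L : Type*} [NonUnitalCStarAlgebra A] [PartialOrder A] [StarOrderedRing A]
  [NonUnitalCStarAlgebra L] [PartialOrder L] [StarOrderedRing L]

/-- An injective `⋆`-homomorphism of C⋆-algebras reflects positivity. -/
lemma nonneg_of_map_nonneg (Φ : A →⋆ₙₐ[ℂ] L) (hΦ : Function.Injective Φ) {a : A}
    (h : 0 ≤ Φ a) : 0 ≤ a := by
  have hs : IsSelfAdjoint a := hΦ (by rw [map_star]; exact (IsSelfAdjoint.of_nonneg h).star_eq)
  -- The negative part is given by the continuous functional calculus, which `Φ` respects; hence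
  -- `Φ(a⁻) = Φ(a)⁻ = 0`.
  have hn : a⁻ = 0 := by
    refine hΦ ?_
    rw [map_zero, CFC.negPart_def,
      NonUnitalStarAlgHomClass.map_cfcₙ (R := ℝ) (S := ℂ) Φ _ a (hφ := map_continuous Φ)
        (hφa := IsSelfAdjoint.of_nonneg h), ← CFC.negPart_def]
    exact (CFC.negPart_eq_zero_iff _ (IsSelfAdjoint.of_nonneg h)).mpr h
  exact (CFC.negPart_eq_zero_iff a hs).mp hn

end Positivity

/-! ### Corners `P L Q` cut out by multiplier projections. -/

section Multiplier

variable {L : Type*} [NonUnitalCStarAlgebra L]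

/-- Take `x = (a - b)⋆` and use the C⋆-identity. Faithfulness turns the single relation `(e P) f = e
(P f)` defining a double centralizer into the module identities below. -/
lemma mul_left_faithful {a b : L} (h : ∀ x, x * a = x * b) : a = b := by
  rw [← sub_eq_zero, ← CStarRing.star_mul_self_eq_zero_iff, mul_sub, h, sub_self]

lemma mul_right_faithful {a b : L} (h : ∀ x, a * x = b * x) : a = b :=
  star_injective (mul_left_faithful fun x => by
    have := congrArg star (h (star x))
    rwa [star_mul, star_mul, star_star] at this)

/-- `P (e f) = (P e) f` for a multiplier `P`. -/
lemma multiplier_fst_mul (P : DoubleCentralizer ℂ L) (e f : L) : P.fst (e * f) = P.fst e * f :=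
  mul_left_faithful fun x => by
    rw [← P.central, ← mul_assoc, P.central, mul_assoc]

/-- `(e f) P = e (f P)` for a multiplier `P`. -/
lemma multiplier_snd_mul (P : DoubleCentralizer ℂ L) (e f : L) : P.snd (e * f) = e * P.snd f :=
  mul_right_faithful fun x => by
    rw [P.central, mul_assoc, ← P.central, mul_assoc]

/-- `P (e Q) = (P e) Q` for multipliers `P`, `Q`. -/
lemma multiplier_fst_snd (P Q : DoubleCentralizer ℂ L) (e : L) :
    P.fst (Q.snd e) = Q.snd (P.fst e) :=
  mul_right_faithful fun x => by
    -- Multiplied by `x` on the right, both sides become `(P e)(Q x)`.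
    rw [← multiplier_fst_mul, Q.central, Q.central, multiplier_fst_mul]

/-- For projections `P`, `Q` in the multiplier algebra, `e ∈ P L Q` iff `P e = e` and `e Q = e`. -/
lemma mem_range_fst_snd {P Q : DoubleCentralizer ℂ L} (hP : IsStarProjection P)
    (hQ : IsStarProjection Q) {e : L} :
    e ∈ LinearMap.range (P.fst.comp Q.snd).toLinearMap ↔ P.fst e = e ∧ Q.snd e = e := by
  have hPP : ∀ f, P.fst (P.fst f) = P.fst f := fun f => by
    -- The coordinates of a product of double centralizers are composites, so `P = P P` unfolds
    -- definitionally to idempotence of each coordinate.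
    conv_rhs => rw [← hP.isIdempotentElem.eq]
    rfl
  have hQQ : ∀ f, Q.snd (Q.snd f) = Q.snd f := fun f => by
    conv_rhs => rw [← hQ.isIdempotentElem.eq]
    rfl
  constructor
  · rintro ⟨f, rfl⟩
    change P.fst (P.fst (Q.snd f)) = P.fst (Q.snd f) ∧ Q.snd (P.fst (Q.snd f)) = P.fst (Q.snd f)
    -- The left action of `P` commutes with the right action of `Q`, so `Q` can be moved next to the
    -- other `Q`.
    exact ⟨hPP _, by rw [← multiplier_fst_snd, hQQ]⟩
  · rintro ⟨h1, h2⟩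
    exact ⟨e, by change P.fst (Q.snd e) = e; rw [h2, h1]⟩

/-- The involution of double centralizers exchanges the two coordinates: `Q⋆ e = (e⋆ Q)⋆`. For
self-adjoint `P`, `Q` the two fixed-point conditions are therefore swapped. -/
lemma star_mem_range_fst_snd {P Q : DoubleCentralizer ℂ L} (hP : IsStarProjection P)
    (hQ : IsStarProjection Q) {e : L}
    (he : e ∈ LinearMap.range (P.fst.comp Q.snd).toLinearMap) :
    star e ∈ LinearMap.range (Q.fst.comp P.snd).toLinearMap := by
  rw [mem_range_fst_snd hP hQ] at he
  rw [mem_range_fst_snd hQ hP]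
  constructor
  · rw [← hQ.isSelfAdjoint.star_eq, DoubleCentralizer.star_fst, star_star, he.2]
  · rw [← hP.isSelfAdjoint.star_eq, DoubleCentralizer.star_snd, star_star, he.1]

lemma mul_mem_range_fst_snd {P Q R : DoubleCentralizer ℂ L} (hP : IsStarProjection P)
    (hQ : IsStarProjection Q) (hR : IsStarProjection R) {e f : L}
    (he : e ∈ LinearMap.range (P.fst.comp Q.snd).toLinearMap)
    (hf : f ∈ LinearMap.range (Q.fst.comp R.snd).toLinearMap) :
    e * f ∈ LinearMap.range (P.fst.comp R.snd).toLinearMap := by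
  rw [mem_range_fst_snd hP hQ] at he
  rw [mem_range_fst_snd hQ hR] at hf
  rw [mem_range_fst_snd hP hR, multiplier_fst_mul, multiplier_snd_mul, he.1, hf.2]
  exact ⟨rfl, rfl⟩

/-- A corner is the common fixed-point set of two continuous maps. Closedness makes `E_g` complete,
and it allows membership in a corner to be tested on a dense set. -/
lemma isClosed_range_fst_snd {P Q : DoubleCentralizer ℂ L} (hP : IsStarProjection P)
    (hQ : IsStarProjection Q) :
    IsClosed (LinearMap.range (P.fst.comp Q.snd).toLinearMap : Set L) := by
  have : (LinearMap.range (P.fst.comp Q.snd).toLinearMap : Set L) =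
      {e | P.fst e = e} ∩ {e | Q.snd e = e} := Set.ext fun e => mem_range_fst_snd hP hQ
  rw [this]
  exact (isClosed_eq P.fst.continuous continuous_id).inter
    (isClosed_eq Q.snd.continuous continuous_id)

end Multiplier

/-! ### Maps out of inductive limits. -/

section LimitMaps

variable {ι : Type w} [Preorder ι] [IsDirectedOrder ι] [Nonempty ι]

namespace BanachSystem

variable (S : BanachSystem.{u} ι)

lemma lim_ind {p : S.Lim → Prop} (a : S.Lim) (hp : IsClosed {x | p x})
    (h : ∀ i x, p (S.of i x)) : p a :=
  UniformSpace.Completion.induction_on a hp (S.alg_ind h)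

variable {F : Type*} [NormedAddCommGroup F] [NormedSpace ℂ F] [CompleteSpace F]

/-- A compatible family of linear isometries extends to the inductive limit. -/
lemma exists_lift (f : ∀ i, S.V i →ₗᵢ[ℂ] F)
    (hf : ∀ i j (h : i ≤ j) x, f j (S.map i j h x) = f i x) :
    ∃ Ψ : S.Lim →ₗᵢ[ℂ] F, ∀ i x, Ψ (S.of i x) = f i x := by
  let g : S.Alg → F := DirectLimit.lift S.map (fun i x => f i x) fun i j h x => (hf i j h x).symm
  have hg : ∀ i x, g (S.toAlg i x) = f i x := fun i x => rfl
  let gl : S.Alg →ₗ[ℂ] F :=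
    { toFun := g
      map_add' := S.alg_ind₂ fun i x y => by rw [← map_add, hg, hg, hg, map_add]
      map_smul' := fun c => S.alg_ind fun i x => by
        rw [← map_smul, hg, hg, map_smul, RingHom.id_apply] }
  -- The norm of a class in the algebraic limit is the norm of any representative, so isometry at
  -- each stage is isometry on the algebraic limit.
  have hn : ∀ a, ‖gl a‖ = ‖a‖ := S.alg_ind fun i x => (f i).norm_map x
  let G : S.Lim →L[ℂ] F := gl.extendOfNorm
    (UniformSpace.Completion.toComplₗᵢ (𝕜 := ℂ) (E := S.Alg)).toLinearMap
  have hd : DenseRange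
      (UniformSpace.Completion.toComplₗᵢ (𝕜 := ℂ) (E := S.Alg)).toLinearMap :=
    UniformSpace.Completion.denseRange_coe
  -- The bound required by the extension is met with the constant `1`, since both `gl` and the
  -- inclusion in the completion preserve norms.
  have hG : ∀ a : S.Alg, G (a : S.Lim) = gl a := LinearMap.extendOfNorm_eq hd ⟨1, fun a => by
    rw [hn, one_mul]
    exact (UniformSpace.Completion.norm_coe a).ge⟩
  refine ⟨⟨G.toLinearMap, fun z => ?_⟩, fun i x => hG (S.toAlg i x)⟩
  refine UniformSpace.Completion.induction_on z
    (isClosed_eq (continuous_norm.comp G.continuous) continuous_norm) fun a => ?_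
  change ‖G (a : S.Lim)‖ = _
  rw [hG, hn, UniformSpace.Completion.norm_coe]

end BanachSystem

namespace CStarSystem

variable (S : CStarSystem.{u} ι) {L : Type*} [NonUnitalCStarAlgebra L]

/-- A compatible family of injective `⋆`-homomorphisms extends to an injective `⋆`-homomorphism of
the inductive limit. -/
lemma exists_lift (f : ∀ i, S.G i →⋆ₙₐ[ℂ] L) (hinj : ∀ i, Function.Injective (f i))
    (hf : ∀ i j (h : i ≤ j) x, f j (S.map i j h x) = f i x) :
    ∃ Φ : S.Lim →⋆ₙₐ[ℂ] L, Function.Injective Φ ∧ ∀ i x, Φ (S.of i x) = f i x := by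
  let g : S.Alg → L := DirectLimit.lift S.map (fun i x => f i x) fun i j h x => (hf i j h x).symm
  have hg : ∀ i x, g (S.toAlg i x) = f i x := fun i x => rfl
  let gl : S.Alg →ₗ[ℂ] L :=
    { toFun := g
      map_add' := S.alg_ind₂ fun i x y => by rw [← map_add, hg, hg, hg, map_add]
      map_smul' := fun c => S.alg_ind fun i x => by
        rw [← map_smul, hg, hg, map_smul, RingHom.id_apply] }
  -- Injectivity enters here: an injective `⋆`-homomorphism of C⋆-algebras is isometric.
  have hn : ∀ a, ‖gl a‖ = ‖a‖ := S.alg_ind fun i x =>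
    NonUnitalStarAlgHom.norm_map (f i) (hinj i) x
  let e : S.Alg →ₗ[ℂ] S.Lim :=
    { toFun := CStarCompletion.incl
      map_add' := CStarCompletion.incl_add S.Alg
      map_smul' := CStarCompletion.incl_smul S.Alg }
  let G : S.Lim →L[ℂ] L := gl.extendOfNorm e
  have hd : DenseRange e := (CStarCompletion.isDenseInducing_incl S.Alg).dense
  have hG : ∀ i x, G (S.of i x) = f i x := fun i x =>
    LinearMap.extendOfNorm_eq hd ⟨1, fun a => by
      rw [hn, one_mul]
      exact (CStarCompletion.norm_incl _ a).ge⟩ (S.toAlg i x)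
  refine ⟨{ G.toLinearMap with
    map_zero' := map_zero G
    map_mul' := fun a b => ?_
    map_star' := fun a => ?_ }, ?_, hG⟩
  -- So far `G` is only a continuous linear map. That it respects products, and then adjoints, is a
  -- closed condition, valid on the dense union of the stages.
  · refine S.lim_ind₂ (p := fun a b => G (a * b) = G a * G b) a b (isClosed_eq
      (G.continuous.comp continuous_mul)
      ((G.continuous.comp continuous_fst).mul (G.continuous.comp continuous_snd))) fun i x y => ?_
    rw [← map_mul, hG, hG, hG, map_mul]
  · refine S.lim_ind (p := fun a => G (star a) = star (G a)) a (isClosed_eq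
      (G.continuous.comp continuous_star) (continuous_star.comp G.continuous)) fun i x => ?_
    rw [← map_star, hG, hG, map_star]
  -- Injectivity on a dense subalgebra would not survive completion; isometry does.
  · have hGn : ∀ a, ‖G a‖ = ‖a‖ := fun a => S.lim_ind (p := fun a => ‖G a‖ = ‖a‖) a
      (isClosed_eq (continuous_norm.comp G.continuous) continuous_norm) fun i x => by
        rw [hG, norm_of, NonUnitalStarAlgHom.norm_map (f i) (hinj i)]
    exact (AddMonoidHomClass.isometry_of_norm G hGn).injective

end CStarSystem

end LimitMaps

/-! ### Closed ranges and dense spans under injective homomorphisms. -/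

section StarHom

variable {A L : Type*} [NonUnitalCStarAlgebra A] [NonUnitalCStarAlgebra L]

lemma continuous_starHom (Φ : A →⋆ₙₐ[ℂ] L) : Continuous Φ :=
  AddMonoidHomClass.continuous_of_bound Φ 1 fun a => by
    rw [one_mul]; exact NonUnitalStarAlgHom.norm_apply_le Φ a

/-- The range is an isometric copy of a complete space. To show that it contains a corner of `L_g`,
it is then enough to reach the elements coming from the finite stages. -/
lemma isClosed_range_of_injective (Φ : A →⋆ₙₐ[ℂ] L) (hΦ : Function.Injective Φ) :
    IsClosed (Set.range Φ) :=
  (AddMonoidHomClass.isometry_of_norm Φ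
    (NonUnitalStarAlgHom.norm_map Φ hΦ)).isClosedEmbedding.isClosed_range

/-- If the image of an injective `⋆`-homomorphism `Φ` is contained in the closed span of `Φ(s)`,
then the span of `s` is dense. -/
lemma dense_span_of_map (Φ : A →⋆ₙₐ[ℂ] L) (hΦ : Function.Injective Φ) (s : Set A)
    (h : ∀ a, Φ a ∈ closure (Submodule.span ℂ (Φ '' s) : Set L)) :
    Dense (Submodule.span ℂ s : Set A) := by
  have hiso := AddMonoidHomClass.isometry_of_norm Φ (NonUnitalStarAlgHom.norm_map Φ hΦ)
  intro a
  -- Since `Φ` is an embedding, closures in `A` are preimages of closures of images in `L`.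
  rw [hiso.isEmbedding.isInducing.closure_eq_preimage_closure_image]
  refine closure_mono ?_ (h a)
  have : Submodule.span ℂ (Φ '' s) = (Submodule.span ℂ s).map (Φ : A →ₗ[ℂ] L) :=
    (Submodule.map_span (Φ : A →ₗ[ℂ] L) s).symm
  rw [this]
  rintro _ ⟨x, hx, rfl⟩
  exact ⟨x, hx, rfl⟩

end StarHom

/-! ### Imprimitivity bimodules inside a C⋆-algebra. -/

section CornerBimodule

variable {A B L : Type*} [NonUnitalCStarAlgebra A] [PartialOrder A] [StarOrderedRing A]
  [NonUnitalCStarAlgebra B] [PartialOrder B] [StarOrderedRing B]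
  [NonUnitalCStarAlgebra L] [PartialOrder L] [StarOrderedRing L]

/-- A closed subspace `E` of a C⋆-algebra `L` is an imprimitivity bimodule for C⋆-subalgebras `A`,
`B` of `L` if `A E ⊆ E`, `E B ⊆ E`, `E E⋆` spans a dense subspace of `A`, and `E⋆ E` spans a dense
subspace of `B`. -/
def cornerImprimitivity (Φ : A →⋆ₙₐ[ℂ] L) (hΦ : Function.Injective Φ) (Ψ : B →⋆ₙₐ[ℂ] L)
    (hΨ : Function.Injective Ψ) (E : Submodule ℂ L) (hE : IsClosed (E : Set L))
    (hl : ∀ a, ∀ e ∈ E, Φ a * e ∈ E) (hr : ∀ b, ∀ e ∈ E, e * Ψ b ∈ E)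
    (p : E → E → A) (hp : ∀ e f : E, Φ (p e f) = (e : L) * star (f : L))
    (q : E → E → B) (hq : ∀ e f : E, Ψ (q e f) = star (e : L) * (f : L))
    (hpd : Dense (Submodule.span ℂ {a | ∃ x y, a = p x y} : Set A))
    (hqd : Dense (Submodule.span ℂ {b | ∃ x y, b = q x y} : Set B)) :
    ImprimitivityBimodule A B E :=
  letI : SMul A E := ⟨fun a e => ⟨Φ a * e, hl a e e.2⟩⟩
  letI : SMul Bᵐᵒᵖ E := ⟨fun b e => ⟨e * Ψ (unop b), hr (unop b) e e.2⟩⟩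
  letI : CStarModule A E :=
    -- The arguments are swapped because `p e f`, the preimage of `e f⋆`, is linear in `e`, whereas
    -- the inner product of a `CStarModule` is linear in its second variable. Every axiom is checked
    -- after applying the injective map `Φ`, where it becomes an identity in `L`.
    { inner := fun x y => p y x
      inner_add_right := fun {x y z} => hΦ <| by
        rw [map_add, hp, hp, hp, Submodule.coe_add, add_mul]
      inner_self_nonneg := fun {x} => nonneg_of_map_nonneg Φ hΦ <| by
        rw [hp]; exact mul_star_self_nonneg _
      inner_self := fun {x} => by
        rw [← map_eq_zero_iff Φ hΦ, hp, CStarRing.mul_star_self_eq_zero_iff,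
          Submodule.coe_eq_zero]
      inner_op_smul_right := fun {a x y} => hΦ <| by
        rw [map_mul, hp, hp]
        exact mul_assoc _ _ _
      inner_smul_right_complex := fun {z x y} => hΦ <| by
        rw [map_smul, hp, hp, Submodule.coe_smul, smul_mul_assoc]
      star_inner := fun x y => hΦ <| by
        rw [map_star, hp, hp, star_mul, star_star]
      norm_eq_sqrt_norm_inner_self := fun x => by
        rw [← NonUnitalStarAlgHom.norm_map Φ hΦ, hp, CStarRing.norm_self_mul_star,
          Real.sqrt_mul_self (norm_nonneg _)]
        rfl }
  letI : CStarModule Bᵐᵒᵖ E :=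
    -- No swap is needed here: `q e f` lies over `e⋆ f`, which is linear in `f`. A right `B`-module
    -- is a module over the opposite algebra, so each axiom is stripped of `op` and then compared in
    -- `L` through `Ψ`.
    { inner := fun x y => op (q x y)
      inner_add_right := fun {x y z} => MulOpposite.unop_injective <| hΨ <| by
        rw [MulOpposite.unop_add, map_add]
        simp only [MulOpposite.unop_op]
        rw [hq, hq, hq, Submodule.coe_add, mul_add]
      inner_self_nonneg := fun {x} => MulOpposite.op_nonneg.mpr <|
        nonneg_of_map_nonneg Ψ hΨ <| by
          rw [hq]; exact star_mul_self_nonneg _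
      inner_self := fun {x} => by
        rw [MulOpposite.op_eq_zero_iff, ← map_eq_zero_iff Ψ hΨ, hq,
          CStarRing.star_mul_self_eq_zero_iff, Submodule.coe_eq_zero]
      inner_op_smul_right := fun {a x y} => MulOpposite.unop_injective <| hΨ <| by
        rw [MulOpposite.unop_mul, map_mul]
        simp only [MulOpposite.unop_op]
        rw [hq, hq]
        exact (mul_assoc _ _ _).symm
      inner_smul_right_complex := fun {z x y} => MulOpposite.unop_injective <| hΨ <| by
        rw [MulOpposite.unop_smul, map_smul]
        simp only [MulOpposite.unop_op]
        rw [hq, hq, Submodule.coe_smul, mul_smul_comm]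
      star_inner := fun x y => MulOpposite.unop_injective <| hΨ <| by
        rw [MulOpposite.unop_star, map_star]
        simp only [MulOpposite.unop_op]
        rw [hq, hq, star_mul, star_star]
      norm_eq_sqrt_norm_inner_self := fun x => by
        rw [MulOpposite.norm_op, ← NonUnitalStarAlgHom.norm_map Ψ hΨ, hq,
          CStarRing.norm_star_mul_self, Real.sqrt_mul_self (norm_nonneg _)]
        rfl }
  { complete := hE.completeSpace_coe
    linner := p
    linner_eq := fun x y => rfl
    smul_rsmul := fun a x b => Subtype.ext (mul_assoc (Φ a) (x : L) (Ψ b))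
    rinner_smul := fun a x y => hΨ <| by
      change Ψ (q (a • x) y) = Ψ (q x (star a • y))
      rw [hq, hq]
      change star (Φ a * (x : L)) * y = star (x : L) * (Φ (star a) * y)
      rw [star_mul, map_star, mul_assoc]
    linner_rsmul := fun b x y => hΦ <| by
      rw [hp, hp]
      change (x : L) * Ψ b * star (y : L) = x * star ((y : L) * Ψ (star b))
      rw [star_mul, map_star, star_star, mul_assoc]
    -- In `L` this is `(x y⋆) z = x (y⋆ z)`.
    linner_smul_eq := fun x y z => Subtype.ext <| by
      change Φ (p x y) * (z : L) = x * Ψ (q y z)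
      rw [hp, hq, mul_assoc]
    left_full := hpd
    right_full := hqd }

end CornerBimodule

end HilbertMod

namespace HilbertMod

open scoped RightActions
open MulOpposite (op unop)

/-! ### Dense subspaces of the compact operators. -/

section Fullness

variable {B : Type*} [NonUnitalCStarAlgebra B] [PartialOrder B] [StarOrderedRing B]
  {H H₀ : Type*} [NormedAddCommGroup H] [NormedSpace ℂ H] [SMul Bᵐᵒᵖ H] [RightHilbertModule B H]
  [NormedAddCommGroup H₀] [NormedSpace ℂ H₀] [SMul Bᵐᵒᵖ H₀] [RightHilbertModule B H₀]

/-- A closed subspace of `H` containing `H · s` is all of `H` if `s` spans a dense subspace of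
`B`. -/
lemma eq_top_of_rsmul_mem (M : Submodule ℂ H) (hM : IsClosed (M : Set H)) (s : Set B)
    (hs : (Submodule.span ℂ s).topologicalClosure = ⊤) (h : ∀ (x : H), ∀ b ∈ s, x <• b ∈ M) :
    M = ⊤ := by
  -- For fixed `x` the map `b ↦ x b` is linear and continuous, so the elements `b` with `x b ∈ M`
  -- form a closed subspace containing `s`.
  have h1 : ∀ (x : H) (b : B), x <• b ∈ M := by
    intro x b
    let f : B →L[ℂ] H := LinearMap.mkContinuous
      { toFun := fun b => x <• b
        map_add' := fun b c => rsmul_add B x b c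
        map_smul' := fun r b => rsmul_smul B x r b } ‖x‖ (norm_rsmul_le B x)
    have : (Submodule.span ℂ s).topologicalClosure ≤ M.comap f.toLinearMap :=
      Submodule.topologicalClosure_minimal _ (Submodule.span_le.mpr fun b hb => h x b hb)
        (hM.preimage f.continuous)
    rw [hs] at this
    exact this (Submodule.mem_top (x := b))
  rw [eq_top_iff]
  rintro x -
  refine hM.closure_subset (Metric.mem_closure_iff.mpr fun ε hε => ?_)
  -- An approximate unit of `B` brings `x b` arbitrarily close to `x`.
  obtain ⟨b, hb⟩ := exists_rsmul_near (B := B) x hε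
  exact ⟨_, h1 x b, by rwa [dist_eq_norm]⟩

variable [CompleteSpace H]

/-- A closed subspace of `𝒦(H)` containing the rank-one operators is all of `𝒦(H)`. -/
lemma eq_top_of_rankOne_mem (N : Submodule ℂ (compactAlg B H))
    (hN : IsClosed (N : Set (compactAlg B H)))
    (h : ∀ ξ η : H, (⟨rankOne B ξ η, rankOne_mem B ξ η⟩ : compactAlg B H) ∈ N) : N = ⊤ := by
  let ι : compactAlg B H →ₗ[ℂ] H →L[ℂ] H := (compacts B H H).subtype
  -- Induction over compact operators takes place in `H →L[ℂ] H`, so `N` is transported there. It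
  -- stays closed because `𝒦(H)` is closed among the bounded operators.
  have hcl : IsClosed (N.map ι : Set (H →L[ℂ] H)) :=
    (isClosed_compacts B (H₁ := H) (H₂ := H)).isClosedEmbedding_subtypeVal.isClosedMap _ hN
  rw [eq_top_iff]
  rintro T -
  obtain ⟨R, hR, he⟩ := compacts_induction B (ContinuousLinearMap.id ℂ (H →L[ℂ] H)) (N.map ι)
    hcl (fun ξ η => ⟨_, h ξ η, rfl⟩) T.2
  obtain rfl : R = T := Subtype.ext he
  exact hR

/-- If `H₀` is full, then the operators `θ_{ξ⟨ζ, ζ'⟩, η} = θ_{ξ, ζ} θ_{ζ', η}` with `ζ, ζ' ∈ H₀` span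
a dense subspace of `𝒦(H)`. -/
lemma eq_top_of_rankOne_rsmul_mem
    (hfull : (Submodule.span ℂ {b | ∃ x y : H₀, b = rinner B x y}).topologicalClosure = ⊤)
    (N : Submodule ℂ (compactAlg B H)) (hN : IsClosed (N : Set (compactAlg B H)))
    (h : ∀ (ξ η : H) (ζ ζ' : H₀), (⟨rankOne B (ξ <• rinner B ζ ζ') η, rankOne_mem B _ η⟩ :
      compactAlg B H) ∈ N) : N = ⊤ := by
  refine eq_top_of_rankOne_mem N hN fun ξ η => ?_
  -- With `η` fixed, `ξ ↦ θ_{ξ,η}` is linear with bound `‖η‖`. The preimage of `N` is a closed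
  -- subspace of `H` containing every `ξ⟨ζ,ζ'⟩`, hence all of `H` by fullness of `H₀`.
  let f : H →L[ℂ] compactAlg B H := LinearMap.mkContinuous
    { toFun := fun ξ => ⟨rankOne B ξ η, rankOne_mem B ξ η⟩
      map_add' := fun ξ ξ' => Subtype.ext (ContinuousLinearMap.ext fun x => add_rsmul B ξ ξ' _)
      map_smul' := fun c ξ => Subtype.ext (ContinuousLinearMap.ext fun x => smul_rsmul B ξ c _) }
    ‖η‖ (fun ξ => by
      refine ContinuousLinearMap.opNorm_le_bound _ (by positivity) fun x => ?_
      change ‖ξ <• rinner B η x‖ ≤ _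
      calc _ ≤ ‖ξ‖ * ‖rinner B η x‖ := norm_rsmul_le B _ _
        _ ≤ ‖ξ‖ * (‖η‖ * ‖x‖) := by gcongr; exact norm_rinner_le B _ _
        _ = _ := by ring)
  have hM := eq_top_of_rsmul_mem (N.comap f.toLinearMap) (hN.preimage f.continuous) _ hfull
    (by rintro x _ ⟨ζ, ζ', rfl⟩; exact h x η ζ ζ')
  have : ξ ∈ N.comap f.toLinearMap := by rw [hM]; exact Submodule.mem_top
  exact this

end Fullness

lemma norm_comp_comp_le {F G K J : Type*} [NormedAddCommGroup F] [NormedSpace ℂ F]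
    [NormedAddCommGroup G] [NormedSpace ℂ G] [NormedAddCommGroup K] [NormedSpace ℂ K]
    [NormedAddCommGroup J] [NormedSpace ℂ J] (f : K →L[ℂ] J) (R : G →L[ℂ] K) (g : F →L[ℂ] G)
    (hf : ‖f‖ ≤ 1) (hg : ‖g‖ ≤ 1) : ‖f.comp (R.comp g)‖ ≤ ‖R‖ := by
  calc _ ≤ ‖f‖ * (‖R‖ * ‖g‖) := (f.opNorm_comp_le _).trans (by gcongr; exact R.opNorm_comp_le g)
    _ ≤ 1 * (‖R‖ * 1) := by gcongr
    _ = ‖R‖ := by ring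

/-! ### Corners of `𝒦(H₁ ⊕ H₂)`. -/

section DirectSumCorners

variable {B : Type*} [NonUnitalCStarAlgebra B] [PartialOrder B] [StarOrderedRing B]
  {H₁ H₂ : Type*}
  [NormedAddCommGroup H₁] [NormedSpace ℂ H₁] [SMul Bᵐᵒᵖ H₁] [RightHilbertModule B H₁]
  [NormedAddCommGroup H₂] [NormedSpace ℂ H₂] [SMul Bᵐᵒᵖ H₂] [RightHilbertModule B H₂]

/-- The adjoint of the inclusion `i` is the coordinate projection, so `i⋆ i = 1` and `‖i‖² ≤ ‖1‖ ≤
1`. Equality fails when `H₁ = 0`. -/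
lemma norm_inlL_le : ‖inlL B H₁ H₂‖ ≤ 1 := by
  have h := (inlL_isAdjointPair B H₁ H₂).norm_sq_le
  have h1 : (fstL B H₁ H₂).comp (inlL B H₁ H₂) = ContinuousLinearMap.id ℂ H₁ := rfl
  have h2 := ContinuousLinearMap.norm_id_le (𝕜 := ℂ) (E := H₁)
  rw [h1] at h
  nlinarith

lemma norm_inrL_le : ‖inrL B H₁ H₂‖ ≤ 1 := by
  have h := (inrL_isAdjointPair B H₁ H₂).norm_sq_le
  have h1 : (sndL B H₁ H₂).comp (inrL B H₁ H₂) = ContinuousLinearMap.id ℂ H₂ := rfl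
  have h2 := ContinuousLinearMap.norm_id_le (𝕜 := ℂ) (E := H₂)
  rw [h1] at h
  nlinarith

variable [CompleteSpace H₁] [CompleteSpace H₂]

variable (H₂) in
/-- `cornerFst` as a `⋆`-homomorphism. -/
def cornerFstHom : compactAlg B H₁ →⋆ₙₐ[ℂ] compactAlg B (DSum B H₁ H₂) where
  toFun := cornerFst
  map_smul' c T := Subtype.ext <| ContinuousLinearMap.ext fun x => map_smul (inlL B H₁ H₂) c _
  map_zero' := Subtype.ext <| ContinuousLinearMap.ext fun x => map_zero (inlL B H₁ H₂)
  map_add' S T := Subtype.ext <| ContinuousLinearMap.ext fun x => map_add (inlL B H₁ H₂) _ _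
  -- The inner projection and inclusion cancel definitionally.
  map_mul' S T := rfl
  map_star' T := (eq_star (((inlL_isAdjointPair B H₁ H₂).symm.comp (star_isAdjointPair T)).comp
    (inlL_isAdjointPair B H₁ H₂))).symm

variable (H₁) in
/-- `cornerSnd` as a `⋆`-homomorphism. -/
def cornerSndHom : compactAlg B H₂ →⋆ₙₐ[ℂ] compactAlg B (DSum B H₁ H₂) where
  toFun := cornerSnd
  map_smul' c T := Subtype.ext <| ContinuousLinearMap.ext fun x => map_smul (inrL B H₁ H₂) c _
  map_zero' := Subtype.ext <| ContinuousLinearMap.ext fun x => map_zero (inrL B H₁ H₂)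
  map_add' S T := Subtype.ext <| ContinuousLinearMap.ext fun x => map_add (inrL B H₁ H₂) _ _
  map_mul' S T := rfl
  map_star' T := (eq_star (((inrL_isAdjointPair B H₁ H₂).symm.comp (star_isAdjointPair T)).comp
    (inrL_isAdjointPair B H₁ H₂))).symm

/-- Compressing `S ⊕ 0` by the inclusion and projection of the first summand gives back `S`. -/
lemma cornerFst_injective :
    Function.Injective (cornerFst : compactAlg B H₁ → compactAlg B (DSum B H₁ H₂)) :=
  fun S T h => Subtype.ext <| congrArg (fun R : compactAlg B (DSum B H₁ H₂) =>
    (fstL B H₁ H₂).comp ((R : DSum B H₁ H₂ →L[ℂ] DSum B H₁ H₂).comp (inlL B H₁ H₂))) h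

lemma cornerSnd_injective :
    Function.Injective (cornerSnd : compactAlg B H₂ → compactAlg B (DSum B H₁ H₂)) :=
  fun S T h => Subtype.ext <| congrArg (fun R : compactAlg B (DSum B H₁ H₂) =>
    (sndL B H₁ H₂).comp ((R : DSum B H₁ H₂ →L[ℂ] DSum B H₁ H₂).comp (inrL B H₁ H₂))) h

/-- Each of `T` and its off-diagonal copy arises from the other by composing with inclusions and
coordinate projections, all of which are contractions. -/
lemma norm_offDiag (T : compacts B H₂ H₁) : ‖offDiag T‖ = ‖T‖ := by
  have hfst : ‖fstL B H₁ H₂‖ ≤ 1 := (inlL_isAdjointPair B H₁ H₂).norm_le.trans norm_inlL_le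
  have hsnd : ‖sndL B H₁ H₂‖ ≤ 1 := (inrL_isAdjointPair B H₁ H₂).norm_le.trans norm_inrL_le
  have h1 : ‖(inlL B H₁ H₂).comp ((T : H₂ →L[ℂ] H₁).comp (sndL B H₁ H₂))‖ ≤
      ‖(T : H₂ →L[ℂ] H₁)‖ := norm_comp_comp_le _ _ _ norm_inlL_le hsnd
  have h2 : ‖(fstL B H₁ H₂).comp (((inlL B H₁ H₂).comp ((T : H₂ →L[ℂ] H₁).comp
      (sndL B H₁ H₂))).comp (inrL B H₁ H₂))‖ ≤
      ‖(inlL B H₁ H₂).comp ((T : H₂ →L[ℂ] H₁).comp (sndL B H₁ H₂))‖ :=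
    norm_comp_comp_le _ _ _ hfst norm_inrL_le
  have h3 : (fstL B H₁ H₂).comp (((inlL B H₁ H₂).comp ((T : H₂ →L[ℂ] H₁).comp
      (sndL B H₁ H₂))).comp (inrL B H₁ H₂)) = (T : H₂ →L[ℂ] H₁) := rfl
  rw [h3] at h2
  exact le_antisymm h1 h2

/-- `offDiag` as a linear isometry. -/
def offDiagIsometry : compacts B H₂ H₁ →ₗᵢ[ℂ] compactAlg B (DSum B H₁ H₂) where
  toFun := offDiag
  map_smul' c T := Subtype.ext <| ContinuousLinearMap.ext fun x => map_smul (inlL B H₁ H₂) c _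
  map_add' S T := Subtype.ext <| ContinuousLinearMap.ext fun x => map_add (inlL B H₁ H₂) _ _
  norm_map' := norm_offDiag

/-- The involution on compact operators is obtained by choice; uniqueness of adjoints replaces it by
an explicit operator, which can then be evaluated on vectors. -/
lemma star_offDiag_rankOne (ξ : H₁) (η : H₂) :
    (star (offDiag ⟨rankOne B ξ η, rankOne_mem B ξ η⟩ : compactAlg B (DSum B H₁ H₂)) :
      compactAlg B (DSum B H₁ H₂)) =
    ⟨(inrL B H₁ H₂).comp ((rankOne B η ξ).comp (fstL B H₁ H₂)),
      comp_mem_compacts_left B (inrL_isAdjointPair B H₁ H₂)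
        (comp_mem_compacts_right B (inlL_isAdjointPair B H₁ H₂).symm (rankOne_mem B η ξ))⟩ :=
  eq_star (((inrL_isAdjointPair B H₁ H₂).symm.comp (rankOne_isAdjointPair B ξ η)).comp
    (inlL_isAdjointPair B H₁ H₂))

/-- This is `θ_{ξ,ζ} θ_{ζ',η} = θ_{ξ⟨ζ,ζ'⟩,η}`, the source of left fullness: the coefficients
`⟨ζ,ζ'⟩` come from `H₂`, so it is fullness of `H₂` that produces all of `𝒦(H₁)`. -/
lemma offDiag_mul_star_offDiag (ξ η : H₁) (ζ ζ' : H₂) :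
    (offDiag ⟨rankOne B ξ ζ, rankOne_mem B ξ ζ⟩ : compactAlg B (DSum B H₁ H₂)) *
      star (offDiag ⟨rankOne B η ζ', rankOne_mem B η ζ'⟩) =
    cornerFst ⟨rankOne B (ξ <• rinner B ζ ζ') η, rankOne_mem B _ η⟩ := by
  rw [star_offDiag_rankOne]
  refine Subtype.ext (ContinuousLinearMap.ext fun x => congrArg (inlL B H₁ H₂) ?_)
  change ξ <• rinner B ζ (ζ' <• rinner B η x.1) = (ξ <• rinner B ζ ζ') <• rinner B η x.1
  rw [rinner_rsmul_right, rsmul_rsmul]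

/-- The mirror image: coefficients from `H₁` produce the compact operators on `H₂`. -/
lemma star_offDiag_mul_offDiag (ξ η : H₂) (ζ ζ' : H₁) :
    star (offDiag ⟨rankOne B ζ ξ, rankOne_mem B ζ ξ⟩ : compactAlg B (DSum B H₁ H₂)) *
      offDiag ⟨rankOne B ζ' η, rankOne_mem B ζ' η⟩ =
    cornerSnd ⟨rankOne B (ξ <• rinner B ζ ζ') η, rankOne_mem B _ η⟩ := by
  rw [star_offDiag_rankOne]
  refine Subtype.ext (ContinuousLinearMap.ext fun x => congrArg (inrL B H₁ H₂) ?_)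
  change ξ <• rinner B ζ (ζ' <• rinner B η x.2) = (ξ <• rinner B ζ ζ') <• rinner B η x.2
  rw [rinner_rsmul_right, rsmul_rsmul]

/-- The witness is the matrix entry of `T` at the first summand, that is, inclusion, then `T`, then
coordinate projection. The next two lemmas take the other relevant matrix entries. -/
lemma exists_cornerFst_eq (T : compactAlg B (DSum B H₁ H₂)) :
    ∃ S : compactAlg B H₁, leftMul B _ (projFst_isAdjointPair B H₁ H₂)
      (rightMul B _ (projFst_isAdjointPair B H₁ H₂) T) = cornerFst S :=
  ⟨⟨_, comp_mem_compacts_left B (inlL_isAdjointPair B H₁ H₂).symm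
    (comp_mem_compacts_right B (inlL_isAdjointPair B H₁ H₂) T.2)⟩, rfl⟩

lemma exists_cornerSnd_eq (T : compactAlg B (DSum B H₁ H₂)) :
    ∃ S : compactAlg B H₂, leftMul B _ (projSnd_isAdjointPair B H₁ H₂)
      (rightMul B _ (projSnd_isAdjointPair B H₁ H₂) T) = cornerSnd S :=
  ⟨⟨_, comp_mem_compacts_left B (inrL_isAdjointPair B H₁ H₂).symm
    (comp_mem_compacts_right B (inrL_isAdjointPair B H₁ H₂) T.2)⟩, rfl⟩

lemma exists_offDiag_eq (T : compactAlg B (DSum B H₁ H₂)) :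
    ∃ S : compacts B H₂ H₁, leftMul B _ (projFst_isAdjointPair B H₁ H₂)
      (rightMul B _ (projSnd_isAdjointPair B H₁ H₂) T) = offDiag S :=
  ⟨⟨_, comp_mem_compacts_left B (inlL_isAdjointPair B H₁ H₂).symm
    (comp_mem_compacts_right B (inrL_isAdjointPair B H₁ H₂) T.2)⟩, rfl⟩

/-- `(P T)⋆ = T⋆ P` for a projection `P`. -/
lemma star_leftMul {H : Type*} [NormedAddCommGroup H] [NormedSpace ℂ H] [CompleteSpace H]
    [SMul Bᵐᵒᵖ H] [RightHilbertModule B H] {P : H →L[ℂ] H} (hP : IsAdjointPair B P P)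
    (T : compactAlg B H) : star (leftMul B P hP T) = rightMul B P hP (star T) :=
  eq_star ((star_isAdjointPair T).comp hP)

/-- `(T P)⋆ = P T⋆` for a projection `P`. -/
lemma star_rightMul {H : Type*} [NormedAddCommGroup H] [NormedSpace ℂ H] [CompleteSpace H]
    [SMul Bᵐᵒᵖ H] [RightHilbertModule B H] {P : H →L[ℂ] H} (hP : IsAdjointPair B P P)
    (T : compactAlg B H) : star (rightMul B P hP T) = leftMul B P hP (star T) :=
  eq_star (hP.comp (star_isAdjointPair T))

end DirectSumCorners

/-! ### Corners are preserved by `T ↦ T ⊗ 1`. -/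

section Amplification

variable {B C : Type*} [NonUnitalCStarAlgebra B] [PartialOrder B] [StarOrderedRing B]
  [NonUnitalCStarAlgebra C] [PartialOrder C] [StarOrderedRing C]
  {H₁ H₂ Y Z₁ Z₂ : Type*}
  [NormedAddCommGroup H₁] [NormedSpace ℂ H₁] [SMul Bᵐᵒᵖ H₁] [RightHilbertModule B H₁]
  [NormedAddCommGroup H₂] [NormedSpace ℂ H₂] [SMul Bᵐᵒᵖ H₂] [RightHilbertModule B H₂]
  [NormedAddCommGroup Y] [NormedSpace ℂ Y] [CompleteSpace Y] [SMul Cᵐᵒᵖ Y]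
  [RightHilbertModule C Y]
  [NormedAddCommGroup Z₁] [NormedSpace ℂ Z₁] [SMul Cᵐᵒᵖ Z₁] [RightHilbertModule C Z₁]
  [NormedAddCommGroup Z₂] [NormedSpace ℂ Z₂] [SMul Cᵐᵒᵖ Z₂] [RightHilbertModule C Z₂]
  [CompleteSpace H₁] [CompleteSpace H₂] [CompleteSpace Z₁] [CompleteSpace Z₂]
  {φ : B →⋆ₙₐ[ℂ] adjointableAlg C Y} {t₁ : H₁ →ₗ[ℂ] Y →ₗ[ℂ] Z₁}
  {t₂ : H₂ →ₗ[ℂ] Y →ₗ[ℂ] Z₂}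

lemma fstL_dsumTensor (x : DSum B H₁ H₂) (y : Y) :
    fstL C Z₁ Z₂ (dsumTensor B C t₁ t₂ x y) = t₁ x.1 y := add_zero (t₁ x.1 y)

lemma sndL_dsumTensor (x : DSum B H₁ H₂) (y : Y) :
    sndL C Z₁ Z₂ (dsumTensor B C t₁ t₂ x y) = t₂ x.2 y := zero_add (t₂ x.2 y)

lemma dsumTensor_inlL (x : H₁) (y : Y) :
    dsumTensor B C t₁ t₂ (inlL B H₁ H₂ x) y = inlL C Z₁ Z₂ (t₁ x y) := by
  rw [dsumTensor_apply]
  have h1 : (inlL B H₁ H₂ x).1 = x := rfl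
  have h2 : (inlL B H₁ H₂ x).2 = 0 := rfl
  rw [h1, h2, map_zero, LinearMap.zero_apply, map_zero, add_zero]

lemma dsumTensor_inrL (x : H₂) (y : Y) :
    dsumTensor B C t₁ t₂ (inrL B H₁ H₂ x) y = inrL C Z₁ Z₂ (t₂ x y) := by
  rw [dsumTensor_apply]
  have h1 : (inrL B H₁ H₂ x).1 = 0 := rfl
  have h2 : (inrL B H₁ H₂ x).2 = x := rfl
  rw [h1, h2, map_zero, LinearMap.zero_apply, map_zero, zero_add]

/-- On an elementary tensor `(x₁, x₂) ⊗ y` both operators give `(T x₁ ⊗ y, 0)`, and elementary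
tensors determine the amplified operator. This compatibility lets the corner embeddings pass to the
limit. -/
lemma ampAlg_cornerFst (h₁ : IsTensor φ t₁) (h₂ : IsTensor φ t₂)
    (hφ : ∀ b, (φ b : Y →L[ℂ] Y) ∈ compacts C Y Y) (T : compactAlg B H₁) :
    ampAlg (isTensor_dsum h₁ h₂) hφ (cornerFst T) = cornerFst (ampAlg h₁ hφ T) :=
  ampAlg_eq _ _ fun x y => by
    change inlL C Z₁ Z₂ ((ampAlg h₁ hφ T : Z₁ →L[ℂ] Z₁)
      (fstL C Z₁ Z₂ (dsumTensor B C t₁ t₂ x y))) =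
      dsumTensor B C t₁ t₂ (inlL B H₁ H₂ ((T : H₁ →L[ℂ] H₁) x.1)) y
    rw [fstL_dsumTensor, ampAlg_apply, dsumTensor_inlL]

lemma ampAlg_cornerSnd (h₁ : IsTensor φ t₁) (h₂ : IsTensor φ t₂)
    (hφ : ∀ b, (φ b : Y →L[ℂ] Y) ∈ compacts C Y Y) (T : compactAlg B H₂) :
    ampAlg (isTensor_dsum h₁ h₂) hφ (cornerSnd T) = cornerSnd (ampAlg h₂ hφ T) :=
  ampAlg_eq _ _ fun x y => by
    change inrL C Z₁ Z₂ ((ampAlg h₂ hφ T : Z₂ →L[ℂ] Z₂)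
      (sndL C Z₁ Z₂ (dsumTensor B C t₁ t₂ x y))) =
      dsumTensor B C t₁ t₂ (inrL B H₁ H₂ ((T : H₂ →L[ℂ] H₂) x.2)) y
    rw [sndL_dsumTensor, ampAlg_apply, dsumTensor_inrL]

/-- On `(x₁, x₂) ⊗ y` both operators give `(T x₂ ⊗ y, 0)`. It identifies the connecting maps of
`𝒦(X_μ, X_λ)` with those of the off-diagonal corners. -/
lemma ampAlg_offDiag (h₁ : IsTensor φ t₁) (h₂ : IsTensor φ t₂)
    (hφ : ∀ b, (φ b : Y →L[ℂ] Y) ∈ compacts C Y Y) (hinj : Function.Injective φ)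
    (T : compacts B H₂ H₁) :
    ampAlg (isTensor_dsum h₁ h₂) hφ (offDiag T) = offDiag (ampLin h₂ h₁ hφ hinj T) :=
  ampAlg_eq _ _ fun x y => by
    change inlL C Z₁ Z₂ ((ampLin h₂ h₁ hφ hinj T : Z₂ →L[ℂ] Z₁)
      (sndL C Z₁ Z₂ (dsumTensor B C t₁ t₂ x y))) =
      dsumTensor B C t₁ t₂ (inlL B H₁ H₂ ((T : H₂ →L[ℂ] H₁) x.2)) y
    rw [sndL_dsumTensor, ampLin_apply, dsumTensor_inlL]

end Amplification

end HilbertMod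

namespace HilbertMod

open CategoryTheory

/-! ### Projections in the multiplier algebra of a limit. -/

section MultiplierLimits

variable {ι : Type w} [Preorder ι] [IsDirectedOrder ι] [Nonempty ι]

/-- The multiplier of an inductive limit given by compatible families of left and right
multiplications by projections is a projection. -/
lemma CStarSystem.isStarProjection_multLim (S : CStarSystem.{u} ι) {l r : ∀ i, S.G i →ₗ[ℂ] S.G i}
    {hl : ∀ i j h x, S.map i j h (l i x) = l j (S.map i j h x)}
    {hr : ∀ i j h x, S.map i j h (r i x) = r j (S.map i j h x)}
    {hl' : ∀ i x, ‖l i x‖ ≤ ‖x‖} {hr' : ∀ i x, ‖r i x‖ ≤ ‖x‖}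
    {hlr : ∀ i x y, r i x * y = x * l i y}
    (hll : ∀ i x, l i (l i x) = l i x) (hrr : ∀ i x, r i (r i x) = r i x)
    (hsl : ∀ i x, star (l i x) = r i (star x)) (hsr : ∀ i x, star (r i x) = l i (star x)) :
    IsStarProjection (S.multLim l r hl hr hl' hr' hlr) where
  isIdempotentElem := by
    refine DoubleCentralizer.ext _ _ _ _ (Prod.ext (ContinuousLinearMap.ext fun e => ?_)
      (ContinuousLinearMap.ext fun e => ?_))
    · change S.mapLim l hl hl' (S.mapLim l hl hl' e) = S.mapLim l hl hl' e
      refine S.lim_ind (p := fun e => S.mapLim l hl hl' (S.mapLim l hl hl' e) = S.mapLim l hl hl' e)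
        e (isClosed_eq (by fun_prop) (by fun_prop)) fun i x => ?_
      rw [mapLim_of, mapLim_of, hll]
    · change S.mapLim r hr hr' (S.mapLim r hr hr' e) = S.mapLim r hr hr' e
      refine S.lim_ind (p := fun e => S.mapLim r hr hr' (S.mapLim r hr hr' e) = S.mapLim r hr hr' e)
        e (isClosed_eq (by fun_prop) (by fun_prop)) fun i x => ?_
      rw [mapLim_of, mapLim_of, hrr]
  isSelfAdjoint := by
    refine DoubleCentralizer.ext _ _ _ _ (Prod.ext (ContinuousLinearMap.ext fun e => ?_)
      (ContinuousLinearMap.ext fun e => ?_))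
    -- The first coordinate of the adjoint multiplier is built from the second coordinate, so the
    -- left action calls for the hypothesis on `r`, and the right action for that on `l`.
    · change star (S.mapLim r hr hr' (star e)) = S.mapLim l hl hl' e
      refine S.lim_ind (p := fun e => star (S.mapLim r hr hr' (star e)) = S.mapLim l hl hl' e)
        e (isClosed_eq (by fun_prop) (by fun_prop)) fun i x => ?_
      rw [← map_star (S.of i), mapLim_of, mapLim_of, ← map_star (S.of i), hsr, star_star]
    · change star (S.mapLim l hl hl' (star e)) = S.mapLim r hr hr' e
      refine S.lim_ind (p := fun e => star (S.mapLim l hl hl' (star e)) = S.mapLim r hr hr' e)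
        e (isClosed_eq (by fun_prop) (by fun_prop)) fun i x => ?_
      rw [← map_star (S.of i), mapLim_of, mapLim_of, ← map_star (S.of i), hsl, star_star]

end MultiplierLimits

/-! ### Cofinality of `D_g` in the initial segments of `x` and `y`. -/

namespace KGraph

variable {k : ℕ} {Λ : KGraph.{u, v} k}

/-- With `α = x(0, p)`, the morphism sought is `x(n, p)`. -/
lemma InfinitePath.IsInit.exists_seg {x : Λ.InfinitePath} {p n : Fin k → ℕ} {v : Λ.Obj}
    {α : v ⟶ x.vtx 0} (h : x.IsInit p α) (hn : n ≤ p) : ∃ ν : v ⟶ x.vtx n, ν ≫ x.init n = α := by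
  unfold InfinitePath.IsInit at h
  obtain rfl : v = x.vtx p := congrArg Sigma.fst h
  obtain rfl : α = x.init p := eq_of_heq (Sigma.mk.inj h).2
  exact ⟨x.seg hn, x.seg_comp _ _⟩

lemma PairIndex.exists_le_d_lam (g : Λ.PathGroupoid) (n : Fin k → ℕ) :
    ∃ a : PairIndex g, n ≤ Λ.d a.lam := by
  obtain ⟨b, hb⟩ := (Classical.arbitrary (PairIndex g)).exists_extend n
  exact ⟨b, by rw [hb]; exact le_self_add⟩

/-- The difference `d(λ) - d(μ)` is constant on `D_g`. Prolonging a pair so that `d(λ)` grows by `n`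
therefore makes `d(μ)` grow by `n` as well. -/
lemma PairIndex.exists_le_d_mu (g : Λ.PathGroupoid) (n : Fin k → ℕ) :
    ∃ a : PairIndex g, n ≤ Λ.d a.mu := by
  obtain ⟨a⟩ : Nonempty (PairIndex g) := inferInstance
  obtain ⟨b, hb⟩ := a.exists_extend n
  refine ⟨b, fun i => ?_⟩
  have h1 := a.deg i
  have h2 := b.deg i
  have h3 := congrFun hb i
  simp only [Pi.add_apply] at h3
  change n i ≤ Λ.d b.mu i
  omega

end KGraph

/-! ### The fibre algebra as a limit over a cofinal set of initial segments. -/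

namespace LambdaSystem

variable {k : ℕ} {Λ : KGraph.{u, v} k} {S : LambdaSystem.{u, v, w} Λ}

/-- The homomorphism `𝒦(X_α) → 𝒦(X_{αβ})`, `T ↦ T ⊗ 1`; here `γ = αβ`. -/
abbrev amp (hS : S.IsRegular) {u v w : Λ.Obj} (α : v ⟶ w) (β : u ⟶ v) (γ : u ⟶ w)
    (h : β ≫ α = γ) : compactAlg (S.A v) (S.X α) →⋆ₙₐ[ℂ] compactAlg (S.A u) (S.X γ) :=
  ampAlg (hS.isTensor α β γ h) (hS.compact β)

/-- Follows from associativity of `χ`. The composite paths are separate variables tied by equations,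
so that a path may be refactored without transporting operators between types. -/
lemma amp_amp (hS : S.IsRegular) {t u v w : Λ.Obj} (α : v ⟶ w) (β : u ⟶ v) (γ : t ⟶ u)
    (αβ : u ⟶ w) (βγ : t ⟶ v) (αβγ : t ⟶ w) (h₁ : β ≫ α = αβ) (h₂ : γ ≫ β = βγ)
    (h₃ : γ ≫ αβ = αβγ) (h₄ : βγ ≫ α = αβγ) (T : compactAlg (S.A v) (S.X α)) :
    amp hS αβ γ αβγ h₃ (amp hS α β αβ h₁ T) = amp hS α βγ αβγ h₄ T :=
  ampAlg_ampAlg (hS.isTensor α β αβ h₁) (hS.isTensor αβ γ αβγ h₃) (hS.isTensor α βγ αβγ h₄)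
    (hS.isTensor β γ βγ h₂) (hS.compact _) (hS.compact _) (hS.compact _)
    (fun ξ η ζ => S.chi_assoc _ _ _ _ _ _ _ _ _ _ ξ η ζ) T

lemma amp_id (hS : S.IsRegular) {v w : Λ.Obj} (α : v ⟶ w) (h : 𝟙 v ≫ α = α)
    (T : compactAlg (S.A v) (S.X α)) : amp hS α (𝟙 v) α h T = T :=
  ampAlg_eq _ _ fun ξ η => by
    rw [S.chi_id_right, S.chi_id_right, (star_isAdjointPair T).map_rsmul]

/-- The fibre algebra `E_x` is the inductive limit of the algebras `𝒦(X_α)` over any cofinal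
directed set of initial segments `α` of `x`: a compatible family of injective homomorphisms of these
extends to `E_x`. -/
lemma exists_fibreHom (hS : S.IsRegular) (x : Λ.InfinitePath) {ι : Type*} [Preorder ι]
    [IsDirectedOrder ι] (dom : ι → Λ.Obj) (lam : ∀ a, dom a ⟶ x.vtx 0)
    (conn : ∀ a b, a ≤ b → (dom b ⟶ dom a)) (hconn : ∀ a b h, conn a b h ≫ lam a = lam b)
    (hinit : ∀ a, x.IsInit (Λ.d (lam a)) (lam a)) (hcof : ∀ n, ∃ a, n ≤ Λ.d (lam a))
    {L : Type*} [NonUnitalCStarAlgebra L]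
    (j : ∀ a, compactAlg (S.A (dom a)) (S.X (lam a)) →⋆ₙₐ[ℂ] L)
    (hinj : ∀ a, Function.Injective (j a))
    (hj : ∀ a b h T, j b (amp hS (lam a) (conn a b h) (lam b) (hconn a b h) T) = j a T) :
    ∃ Φ : Fibre hS x →⋆ₙₐ[ℂ] L, Function.Injective Φ ∧
      (∀ a p (h : x.IsInit p (lam a)) T, Φ (fibreOf hS h T) = j a T) ∧
      ∀ N : Set L, IsClosed N → (∀ a T, j a T ∈ N) → ∀ b, Φ b ∈ N := by
  -- The value assigned to `T ∈ 𝒦(X_α)` depends neither on the stage to which `T` is amplified nor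
  -- on the factorisation used to get there.
  have indep : ∀ {v : Λ.Obj} (α : v ⟶ x.vtx 0) (a b : ι) (ν : dom a ⟶ v) (ν' : dom b ⟶ v)
      (h : ν ≫ α = lam a) (h' : ν' ≫ α = lam b) (T : compactAlg (S.A v) (S.X α)),
      j a (amp hS α ν (lam a) h T) = j b (amp hS α ν' (lam b) h' T) := by
    intro v α a b ν ν' h h' T
    obtain ⟨c, hac, hbc⟩ := exists_ge_ge a b
    -- At a common later stage `c`, both routes factor `lam c` through `α`; left cancellation makes
    -- them equal.
    have e : conn a c hac ≫ ν = conn b c hbc ≫ ν' := KGraph.cancel (α := α) (by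
      rw [Category.assoc, Category.assoc, h, h', hconn, hconn])
    have h1 : (conn a c hac ≫ ν) ≫ α = lam c := by rw [Category.assoc, h, hconn]
    rw [← hj a c hac, ← hj b c hbc, amp_amp hS α ν _ _ (conn a c hac ≫ ν) _ h rfl _ h1,
      amp_amp hS α ν' _ _ (conn a c hac ≫ ν) _ h' e.symm _ h1]
  choose a ha using hcof
  choose ν hν using fun n => (hinit (a n)).exists_seg (ha n)
  obtain ⟨Φ, hΦ, hof⟩ := (fibreSystem hS x).exists_lift
    (fun n => (j (a n)).comp (amp hS (x.init n) (ν n) (lam (a n)) (hν n)))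
    (fun n => (hinj (a n)).comp (ampAlg_injective
      (hS.isTensor (x.init n) (ν n) (lam (a n)) (hν n)) (hS.compact _) (hS.injective _)))
    -- Going from `x(0, m)` through `x(0, n)` to stage `a n` is amplification along a factorisation
    -- of `lam (a n)` through `x(0, m)`, so `indep` compares it with the route chosen for `m`.
    (fun m n h T => by
      change j (a n) (amp hS (x.init n) (ν n) (lam (a n)) (hν n)
        (amp hS (x.init m) (x.seg h) (x.init n) (x.seg_comp _ h) T)) =
        j (a m) (amp hS (x.init m) (ν m) (lam (a m)) (hν m) T)
      exact (congrArg (j (a n)) (amp_amp hS (x.init m) (x.seg h) (ν n) (x.init n) (ν n ≫ x.seg h)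
        (lam (a n)) _ rfl _ (by rw [Category.assoc, x.seg_comp, hν]) T)).trans
        (indep _ _ _ _ _ _ _ _))
  refine ⟨Φ, hΦ, fun b p h T => ?_, fun N hN hjN b => ?_⟩
  -- The map `fibreOf` is transported along `α = x(0, p)`. Stating the claim for a variable `α`
  -- allows this equation to be eliminated; afterwards `α` is taken to be `lam b`, with the identity
  -- as connecting morphism.
  · have key : ∀ {v : Λ.Obj} (α : v ⟶ x.vtx 0) (h : x.IsInit p α)
        (T : compactAlg (S.A v) (S.X α)) (ν : dom b ⟶ v) (h' : ν ≫ α = lam b),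
        Φ (fibreOf hS h T) = j b (amp hS α ν (lam b) h' T) := by
      intro v α h T ν' h'
      unfold KGraph.InfinitePath.IsInit at h
      obtain rfl : v = x.vtx p := congrArg Sigma.fst h
      obtain rfl : α = x.init p := eq_of_heq (Sigma.mk.inj h).2
      exact (hof p T).trans (indep _ _ _ _ _ _ _ _)
    rw [key (lam b) h T (𝟙 _) (Category.id_comp _), amp_id]
  -- On the dense union of the stages, `Φ` takes only values of the maps `j a`. This clause serves
  -- to bound the range of `Φ` and to prove fullness.
  · refine (fibreSystem hS x).lim_ind (p := fun b => Φ b ∈ N) b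
      (hN.preimage (continuous_starHom Φ)) fun n T => ?_
    rw [hof]
    exact hjN _ _

/-! ### The corners of `L_g` and the bimodule `E_g`. -/

section LinkingAlgebra

variable (hS : S.IsRegular) (g : Λ.PathGroupoid)

lemma linkingOf_map {a b : KGraph.PairIndex g} (h : a ≤ b)
    (T : compactAlg (S.A a.dom) (DSum (S.A a.dom) (S.X a.lam) (S.X a.mu))) :
    linkingOf hS g b (ampAlg (isTensor_pair hS h) (hS.compact (KGraph.PairIndex.conn h)) T) =
      linkingOf hS g a T :=
  (linkingSystem hS g).of_map a b h T

lemma norm_linkingOf (a : KGraph.PairIndex g)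
    (T : compactAlg (S.A a.dom) (DSum (S.A a.dom) (S.X a.lam) (S.X a.mu))) :
    ‖linkingOf hS g a T‖ = ‖T‖ :=
  (linkingSystem hS g).norm_of a T

/-- `linkingOf` as a linear isometry. -/
def linkingIsometry (a : KGraph.PairIndex g) :
    compactAlg (S.A a.dom) (DSum (S.A a.dom) (S.X a.lam) (S.X a.mu)) →ₗᵢ[ℂ] Linking hS g where
  toFun := linkingOf hS g a
  map_add' := map_add (linkingOf hS g a)
  map_smul' c T := map_smul (linkingOf hS g a) c T
  norm_map' := norm_linkingOf hS g a

lemma linkingOf_injective (a : KGraph.PairIndex g) : Function.Injective (linkingOf hS g a) :=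
  (linkingIsometry hS g a).injective

lemma isStarProjection_projX : IsStarProjection (projX hS g) :=
  (linkingSystem hS g).isStarProjection_multLim (fun a T => rfl) (fun a T => rfl)
    (fun a T => star_leftMul _ T) (fun a T => star_rightMul _ T)

lemma isStarProjection_projY : IsStarProjection (projY hS g) :=
  (linkingSystem hS g).isStarProjection_multLim (fun a T => rfl) (fun a T => rfl)
    (fun a T => star_leftMul _ T) (fun a T => star_rightMul _ T)

/-- Both actions of the limit multiplier restrict to the corresponding multiplications at stage `a`,
so a compression in `L_g` can be computed at a finite stage. -/
lemma projX_projX_linkingOf (a : KGraph.PairIndex g)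
    (T : compactAlg (S.A a.dom) (DSum (S.A a.dom) (S.X a.lam) (S.X a.mu))) :
    (projX hS g).fst ((projX hS g).snd (linkingOf hS g a T)) = linkingOf hS g a
      (leftMul _ _ (projFst_isAdjointPair (S.A a.dom) (S.X a.lam) (S.X a.mu))
        (rightMul _ _ (projFst_isAdjointPair (S.A a.dom) (S.X a.lam) (S.X a.mu)) T)) :=
  (congrArg (projX hS g).fst ((linkingSystem hS g).mapLim_of _ _
    (fun a T => norm_rightMul_le _ _ (projFst_comp_self _ _ _) T) a T)).trans
    ((linkingSystem hS g).mapLim_of _ _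
      (fun a T => norm_leftMul_le _ _ (projFst_comp_self _ _ _) T) a _)

lemma projY_projY_linkingOf (a : KGraph.PairIndex g)
    (T : compactAlg (S.A a.dom) (DSum (S.A a.dom) (S.X a.lam) (S.X a.mu))) :
    (projY hS g).fst ((projY hS g).snd (linkingOf hS g a T)) = linkingOf hS g a
      (leftMul _ _ (projSnd_isAdjointPair (S.A a.dom) (S.X a.lam) (S.X a.mu))
        (rightMul _ _ (projSnd_isAdjointPair (S.A a.dom) (S.X a.lam) (S.X a.mu)) T)) :=
  (congrArg (projY hS g).fst ((linkingSystem hS g).mapLim_of _ _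
    (fun a T => norm_rightMul_le _ _ (projSnd_comp_self _ _ _) T) a T)).trans
    ((linkingSystem hS g).mapLim_of _ _
      (fun a T => norm_leftMul_le _ _ (projSnd_comp_self _ _ _) T) a _)

lemma projX_projY_linkingOf (a : KGraph.PairIndex g)
    (T : compactAlg (S.A a.dom) (DSum (S.A a.dom) (S.X a.lam) (S.X a.mu))) :
    (projX hS g).fst ((projY hS g).snd (linkingOf hS g a T)) = linkingOf hS g a
      (leftMul _ _ (projFst_isAdjointPair (S.A a.dom) (S.X a.lam) (S.X a.mu))
        (rightMul _ _ (projSnd_isAdjointPair (S.A a.dom) (S.X a.lam) (S.X a.mu)) T)) :=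
  (congrArg (projX hS g).fst ((linkingSystem hS g).mapLim_of _ _
    (fun a T => norm_rightMul_le _ _ (projSnd_comp_self _ _ _) T) a T)).trans
    ((linkingSystem hS g).mapLim_of _ _
      (fun a T => norm_leftMul_le _ _ (projFst_comp_self _ _ _) T) a _)

variable {hS g} in
/-- A closed set containing the elements `P T Q` with `T` in one of the algebras `𝒦(X_λ ⊕ X_μ)`
contains `P L_g Q`. -/
lemma corner_subset {P Q : DoubleCentralizer ℂ (Linking hS g)} {N : Set (Linking hS g)}
    (hN : IsClosed N) (h : ∀ a T, P.fst (Q.snd (linkingOf hS g a T)) ∈ N) :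
    (corner P Q : Set (Linking hS g)) ⊆ N := by
  rintro _ ⟨e, rfl⟩
  exact (linkingSystem hS g).lim_ind (p := fun e => P.fst (Q.snd e) ∈ N) e
    (hN.preimage (P.fst.continuous.comp Q.snd.continuous)) h

/-- The operator `T ⊕ 0` is unchanged by compression, so the element is its own witness; likewise
for the other two corners. -/
lemma linkingOf_cornerFst_mem (a : KGraph.PairIndex g) (T : compactAlg (S.A a.dom) (S.X a.lam)) :
    linkingOf hS g a (cornerFst T) ∈ corner (projX hS g) (projX hS g) :=
  ⟨linkingOf hS g a (cornerFst T), projX_projX_linkingOf hS g a _⟩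

lemma linkingOf_cornerSnd_mem (a : KGraph.PairIndex g) (T : compactAlg (S.A a.dom) (S.X a.mu)) :
    linkingOf hS g a (cornerSnd T) ∈ corner (projY hS g) (projY hS g) :=
  ⟨linkingOf hS g a (cornerSnd T), projY_projY_linkingOf hS g a _⟩

lemma linkingOf_offDiag_mem (a : KGraph.PairIndex g)
    (T : compacts (S.A a.dom) (S.X a.mu) (S.X a.lam)) :
    linkingOf hS g a (offDiag T) ∈ Bimod hS g :=
  ⟨linkingOf hS g a (offDiag T), projX_projY_linkingOf hS g a _⟩

/-- The identification `Φ_x` of `E_x` with the corner `P_x L_g P_x`. -/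
lemma exists_fibreHom_x :
    ∃ Φ : Fibre hS g.x →⋆ₙₐ[ℂ] Linking hS g, Function.Injective Φ ∧
      Set.range Φ = corner (projX hS g) (projX hS g) ∧
      (∀ (a : KGraph.PairIndex g) (p : Fin k → ℕ) (h : g.x.IsInit p a.lam)
        (T : compactAlg (S.A a.dom) (S.X a.lam)),
        Φ (fibreOf hS h T) = linkingOf hS g a (cornerFst T)) ∧
      ∀ N : Set (Linking hS g), IsClosed N →
        (∀ a (T : compactAlg (S.A a.dom) (S.X a.lam)), linkingOf hS g a (cornerFst T) ∈ N) →
        ∀ b, Φ b ∈ N := by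
  have hinit : ∀ a : KGraph.PairIndex g, g.x.IsInit (Λ.d a.lam) a.lam := fun a => by
    obtain ⟨z, hx, -⟩ := a.exists_tail
    exact hx.1
  obtain ⟨Φ, hΦ, hof, hN⟩ := exists_fibreHom hS g.x (ι := KGraph.PairIndex g) (fun a => a.dom)
    (fun a => a.lam) (fun a b h => KGraph.PairIndex.conn h)
    (fun a b h => KGraph.PairIndex.conn_lam h) hinit (KGraph.PairIndex.exists_le_d_lam g)
    (fun a => (linkingOf hS g a).comp (cornerFstHom (S.X a.mu)))
    (fun a => (linkingOf_injective hS g a).comp cornerFst_injective)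
    (fun a b h T => by
      refine Eq.trans ?_ (linkingOf_map hS g h (cornerFst T))
      exact congrArg (linkingOf hS g b) (ampAlg_cornerFst
        (hS.isTensor a.lam _ b.lam (KGraph.PairIndex.conn_lam h))
        (hS.isTensor a.mu _ b.mu (KGraph.PairIndex.conn_mu h)) _ T).symm)
  refine ⟨Φ, hΦ, Set.Subset.antisymm ?_ ?_, hof, hN⟩
  · rintro _ ⟨b, rfl⟩
    exact hN _ (isClosed_range_fst_snd (isStarProjection_projX hS g) (isStarProjection_projX hS g))
      (linkingOf_cornerFst_mem hS g) b
  -- As the range is closed, it suffices to reach `P_x T P_x` with `T` at a finite stage. This is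
  -- some `R ⊕ 0`, the image of the class of `R` in `E_x`.
  · refine corner_subset (isClosed_range_of_injective Φ hΦ) fun a T => ?_
    obtain ⟨R, hR⟩ := exists_cornerFst_eq T
    rw [projX_projX_linkingOf, hR]
    exact ⟨_, hof a _ (hinit a) R⟩

/-- The identification `Φ_y` of `E_y` with the corner `P_y L_g P_y`. -/
lemma exists_fibreHom_y :
    ∃ Φ : Fibre hS g.y →⋆ₙₐ[ℂ] Linking hS g, Function.Injective Φ ∧
      Set.range Φ = corner (projY hS g) (projY hS g) ∧
      (∀ (a : KGraph.PairIndex g) (q : Fin k → ℕ) (h : g.y.IsInit q a.mu)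
        (T : compactAlg (S.A a.dom) (S.X a.mu)),
        Φ (fibreOf hS h T) = linkingOf hS g a (cornerSnd T)) ∧
      ∀ N : Set (Linking hS g), IsClosed N →
        (∀ a (T : compactAlg (S.A a.dom) (S.X a.mu)), linkingOf hS g a (cornerSnd T) ∈ N) →
        ∀ b, Φ b ∈ N := by
  have hinit : ∀ a : KGraph.PairIndex g, g.y.IsInit (Λ.d a.mu) a.mu := fun a => by
    obtain ⟨z, -, hy⟩ := a.exists_tail
    exact hy.1
  obtain ⟨Φ, hΦ, hof, hN⟩ := exists_fibreHom hS g.y (ι := KGraph.PairIndex g) (fun a => a.dom)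
    (fun a => a.mu) (fun a b h => KGraph.PairIndex.conn h)
    (fun a b h => KGraph.PairIndex.conn_mu h) hinit (KGraph.PairIndex.exists_le_d_mu g)
    (fun a => (linkingOf hS g a).comp (cornerSndHom (S.X a.lam)))
    (fun a => (linkingOf_injective hS g a).comp cornerSnd_injective)
    (fun a b h T => by
      refine Eq.trans ?_ (linkingOf_map hS g h (cornerSnd T))
      exact congrArg (linkingOf hS g b) (ampAlg_cornerSnd
        (hS.isTensor a.lam _ b.lam (KGraph.PairIndex.conn_lam h))
        (hS.isTensor a.mu _ b.mu (KGraph.PairIndex.conn_mu h)) _ T).symm)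
  refine ⟨Φ, hΦ, Set.Subset.antisymm ?_ ?_, hof, hN⟩
  · rintro _ ⟨b, rfl⟩
    exact hN _ (isClosed_range_fst_snd (isStarProjection_projY hS g) (isStarProjection_projY hS g))
      (linkingOf_cornerSnd_mem hS g) b
  · refine corner_subset (isClosed_range_of_injective Φ hΦ) fun a T => ?_
    obtain ⟨R, hR⟩ := exists_cornerSnd_eq T
    rw [projY_projY_linkingOf, hR]
    exact ⟨_, hof a _ (hinit a) R⟩

/-- The elements `e f⋆` with `e, f ∈ E_g` span a dense subspace of `P_x L_g P_x`. -/
lemma linkingOf_cornerFst_mem_closure (a : KGraph.PairIndex g)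
    (T : compactAlg (S.A a.dom) (S.X a.lam)) :
    linkingOf hS g a (cornerFst T) ∈ (Submodule.span ℂ
      {l : Linking hS g | ∃ e f : Bimod hS g, l = e * star (f : Linking hS g)}).topologicalClosure := by
  set N := (Submodule.span ℂ
    {l : Linking hS g | ∃ e f : Bimod hS g, l = e * star (f : Linking hS g)}).topologicalClosure
  have hN : IsClosed (N : Set (Linking hS g)) := Submodule.isClosed_topologicalClosure _
  let j := (linkingOf hS g a).comp (cornerFstHom (S.X a.mu))
  let jl : compactAlg (S.A a.dom) (S.X a.lam) →ₗ[ℂ] Linking hS g :=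
    { toFun := j, map_add' := map_add j, map_smul' := map_smul j }
  -- Fullness of `X_μ` enters here. The generator `θ_{ξ⟨ζ,ζ'⟩,η}` is `e f⋆` for the off-diagonal
  -- elements `e`, `f` given by `θ_{ξ,ζ}` and `θ_{η,ζ'}`.
  have htop := eq_top_of_rankOne_rsmul_mem (hS.full a.mu) (N.comap jl)
    (hN.preimage (continuous_starHom j))
    (fun ξ η ζ ζ' => Submodule.le_topologicalClosure _ (Submodule.subset_span
      ⟨⟨_, linkingOf_offDiag_mem hS g a ⟨_, rankOne_mem _ ξ ζ⟩⟩,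
        ⟨_, linkingOf_offDiag_mem hS g a ⟨_, rankOne_mem _ η ζ'⟩⟩, by
        rw [← map_star, ← map_mul, offDiag_mul_star_offDiag]; rfl⟩))
  have : T ∈ N.comap jl := by rw [htop]; exact Submodule.mem_top
  exact this

/-- The elements `e⋆ f` with `e, f ∈ E_g` span a dense subspace of `P_y L_g P_y`. -/
lemma linkingOf_cornerSnd_mem_closure (a : KGraph.PairIndex g)
    (T : compactAlg (S.A a.dom) (S.X a.mu)) :
    linkingOf hS g a (cornerSnd T) ∈ (Submodule.span ℂ
      {l : Linking hS g | ∃ e f : Bimod hS g, l = star (e : Linking hS g) * f}).topologicalClosure := by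
  set N := (Submodule.span ℂ
    {l : Linking hS g | ∃ e f : Bimod hS g, l = star (e : Linking hS g) * f}).topologicalClosure
  have hN : IsClosed (N : Set (Linking hS g)) := Submodule.isClosed_topologicalClosure _
  let j := (linkingOf hS g a).comp (cornerSndHom (S.X a.lam))
  let jl : compactAlg (S.A a.dom) (S.X a.mu) →ₗ[ℂ] Linking hS g :=
    { toFun := j, map_add' := map_add j, map_smul' := map_smul j }
  -- On this side the coefficients `⟨ζ,ζ'⟩` come from `X_λ`, and the off-diagonal elements are given
  -- by `θ_{ζ,ξ}` and `θ_{ζ',η}`.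
  have htop := eq_top_of_rankOne_rsmul_mem (hS.full a.lam) (N.comap jl)
    (hN.preimage (continuous_starHom j))
    (fun ξ η ζ ζ' => Submodule.le_topologicalClosure _ (Submodule.subset_span
      ⟨⟨_, linkingOf_offDiag_mem hS g a ⟨_, rankOne_mem _ ζ ξ⟩⟩,
        ⟨_, linkingOf_offDiag_mem hS g a ⟨_, rankOne_mem _ ζ' η⟩⟩, by
        rw [← map_star, ← map_mul, star_offDiag_mul_offDiag]; rfl⟩))
  have : T ∈ N.comap jl := by rw [htop]; exact Submodule.mem_top
  exact this

/-- `E_g` is the inductive limit of the Banach spaces `𝒦(X_μ, X_λ)`. -/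
lemma exists_offDiagLim_equiv :
    ∃ Ψ : OffDiagLim hS g ≃ₗᵢ[ℂ] Bimod hS g,
      ∀ (a : KGraph.PairIndex g) (T : compacts (S.A a.dom) (S.X a.mu) (S.X a.lam)),
        (Ψ (offDiagOf hS g a T) : Linking hS g) = linkingOf hS g a (offDiag T) := by
  obtain ⟨Ψ, hΨ⟩ := (offDiagSystem hS g).exists_lift
    (fun a => (linkingIsometry hS g a).comp offDiagIsometry)
    (fun a b h T => by
      refine Eq.trans ?_ (linkingOf_map hS g h (offDiag T))
      exact congrArg (linkingOf hS g b) (ampAlg_offDiag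
        (hS.isTensor a.lam _ b.lam (KGraph.PairIndex.conn_lam h))
        (hS.isTensor a.mu _ b.mu (KGraph.PairIndex.conn_mu h)) _ (hS.injective _) T).symm)
  have hmem : ∀ z, Ψ z ∈ Bimod hS g := fun z => (offDiagSystem hS g).lim_ind
    (p := fun z => Ψ z ∈ Bimod hS g) z
    ((isClosed_range_fst_snd (isStarProjection_projX hS g)
      (isStarProjection_projY hS g)).preimage Ψ.continuous)
    fun a T => by rw [hΨ]; exact linkingOf_offDiag_mem hS g a T
  let Ψ' : OffDiagLim hS g →ₗᵢ[ℂ] Bimod hS g :=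
    ⟨Ψ.toLinearMap.codRestrict _ hmem, fun z => Ψ.norm_map z⟩
  have hsurj : Function.Surjective Ψ' := by
    rintro ⟨e, he⟩
    -- The range of an isometry of a complete space is closed, and `P_x T P_y` at a finite stage is
    -- off-diagonal, hence in the range.
    have hr : e ∈ Set.range Ψ := by
      refine corner_subset Ψ.isometry.isClosedEmbedding.isClosed_range (fun a T => ?_) he
      obtain ⟨R, hR⟩ := exists_offDiag_eq T
      rw [projX_projY_linkingOf, hR]
      exact ⟨_, hΨ a R⟩
    obtain ⟨z, rfl⟩ := hr
    exact ⟨z, rfl⟩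
  exact ⟨LinearIsometryEquiv.ofSurjective Ψ' hsurj, fun a T => hΨ a T⟩

/-- `E_g` is an `E_x`-`E_y` imprimitivity bimodule. -/
lemma exists_imprimitivityBimodule :
    ∃ (Φx : Fibre hS g.x →⋆ₙₐ[ℂ] Linking hS g) (Φy : Fibre hS g.y →⋆ₙₐ[ℂ] Linking hS g)
        (M : ImprimitivityBimodule (Fibre hS g.x) (Fibre hS g.y) (Bimod hS g)),
      Function.Injective Φx ∧ Function.Injective Φy ∧
      Set.range Φx = corner (projX hS g) (projX hS g) ∧
      Set.range Φy = corner (projY hS g) (projY hS g) ∧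
      (∀ (a : KGraph.PairIndex g) (p : Fin k → ℕ) (h : g.x.IsInit p a.lam)
        (T : compactAlg (S.A a.dom) (S.X a.lam)),
        Φx (fibreOf hS h T) = linkingOf hS g a (cornerFst T)) ∧
      (∀ (a : KGraph.PairIndex g) (q : Fin k → ℕ) (h : g.y.IsInit q a.mu)
        (T : compactAlg (S.A a.dom) (S.X a.mu)),
        Φy (fibreOf hS h T) = linkingOf hS g a (cornerSnd T)) ∧
      (∀ (b : Fibre hS g.x) (e : Bimod hS g), (M.lact b e : Linking hS g) = Φx b * e) ∧
      (∀ (e : Bimod hS g) (c : Fibre hS g.y), (M.ract e c : Linking hS g) = e * Φy c) ∧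
      (∀ e f : Bimod hS g, Φx (M.linner e f) = (e : Linking hS g) * star (f : Linking hS g)) ∧
      (∀ e f : Bimod hS g, Φy (M.rin e f) = star (e : Linking hS g) * (f : Linking hS g)) := by
  have hX := isStarProjection_projX hS g
  have hY := isStarProjection_projY hS g
  obtain ⟨Φx, ix, rx, ofx, clx⟩ := exists_fibreHom_x hS g
  obtain ⟨Φy, iy, ry, ofy, cly⟩ := exists_fibreHom_y hS g
  -- Here `e f⋆` lies in `P_x L_g P_y · P_y L_g P_x`, hence in `P_x L_g P_x`, which is the range of
  -- `Φx`. The preimage, unique by injectivity, is the left inner product.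
  have hp : ∀ e f : Bimod hS g, ∃ a, Φx a = (e : Linking hS g) * star (f : Linking hS g) :=
    fun e f => by
      have h : (e : Linking hS g) * star (f : Linking hS g) ∈ corner (projX hS g) (projX hS g) :=
        mul_mem_range_fst_snd hX hY hX e.2 (star_mem_range_fst_snd hX hY f.2)
      rw [← SetLike.mem_coe, ← rx] at h
      exact h
  have hq : ∀ e f : Bimod hS g, ∃ a, Φy a = star (e : Linking hS g) * (f : Linking hS g) :=
    fun e f => by
      have h : star (e : Linking hS g) * (f : Linking hS g) ∈ corner (projY hS g) (projY hS g) :=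
        mul_mem_range_fst_snd hY hX hY (star_mem_range_fst_snd hX hY e.2) f.2
      rw [← SetLike.mem_coe, ← ry] at h
      exact h
  choose p hp using hp
  choose q hq using hq
  have hl : ∀ b, ∀ e ∈ Bimod hS g, Φx b * e ∈ Bimod hS g := fun b e he => by
    refine mul_mem_range_fst_snd hX hX hY ?_ he
    have h := Set.mem_range_self (f := Φx) b
    rw [rx] at h
    exact h
  have hr : ∀ c, ∀ e ∈ Bimod hS g, e * Φy c ∈ Bimod hS g := fun c e he => by
    refine mul_mem_range_fst_snd hX hY hY he ?_
    have h := Set.mem_range_self (f := Φy) c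
    rw [ry] at h
    exact h
  -- Density is pushed forward along `Φx` and needs checking only on the elements `T ⊕ 0` of the
  -- finite stages.
  have hpd : Dense (Submodule.span ℂ {a | ∃ x y, a = p x y} : Set (Fibre hS g.x)) := by
    refine dense_span_of_map Φx ix _ fun a => clx _ isClosed_closure (fun a T => ?_) a
    refine closure_mono (Submodule.span_mono ?_) (linkingOf_cornerFst_mem_closure hS g a T)
    rintro _ ⟨e, f, rfl⟩
    exact ⟨p e f, ⟨e, f, rfl⟩, hp e f⟩
  have hqd : Dense (Submodule.span ℂ {a | ∃ x y, a = q x y} : Set (Fibre hS g.y)) := by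
    refine dense_span_of_map Φy iy _ fun a => cly _ isClosed_closure (fun a T => ?_) a
    refine closure_mono (Submodule.span_mono ?_) (linkingOf_cornerSnd_mem_closure hS g a T)
    rintro _ ⟨e, f, rfl⟩
    exact ⟨q e f, ⟨e, f, rfl⟩, hq e f⟩
  exact ⟨Φx, Φy, cornerImprimitivity Φx ix Φy iy (Bimod hS g) (isClosed_range_fst_snd hX hY) hl hr
    p hp q hq hpd hqd, ix, iy, rx, ry, ofx, ofy, fun b e => rfl, fun e c => rfl, hp, hq⟩

end LinkingAlgebra

end LambdaSystem

end HilbertMod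

end

/-! ### The main theorem. -/

theorem corollary4p1p6 {k : ℕ} {Λ : KGraph.{u, v} k} (S : LambdaSystem.{u, v, w} Λ) (hS : S.IsRegular)
    (g : Λ.PathGroupoid) :
    MoritaRieffelEquivalent.{max u v w} (Fibre hS g.x) (Fibre hS g.y) ∧
    (∃ (Φx : Fibre hS g.x →⋆ₙₐ[ℂ] Linking hS g) (Φy : Fibre hS g.y →⋆ₙₐ[ℂ] Linking hS g)
        (M : ImprimitivityBimodule (Fibre hS g.x) (Fibre hS g.y) (Bimod hS g)),
      Function.Injective Φx ∧ Function.Injective Φy ∧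
      Set.range Φx = corner (projX hS g) (projX hS g) ∧
      Set.range Φy = corner (projY hS g) (projY hS g) ∧
      (∀ (a : PairIndex g) (p : Fin k → ℕ) (h : g.x.IsInit p a.lam)
        (T : compactAlg (S.A a.dom) (S.X a.lam)),
        Φx (fibreOf hS h T) = linkingOf hS g a (cornerFst T)) ∧
      (∀ (a : PairIndex g) (q : Fin k → ℕ) (h : g.y.IsInit q a.mu)
        (T : compactAlg (S.A a.dom) (S.X a.mu)),
        Φy (fibreOf hS h T) = linkingOf hS g a (cornerSnd T)) ∧
      (∀ (b : Fibre hS g.x) (e : Bimod hS g), (M.lact b e : Linking hS g) = Φx b * e) ∧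
      (∀ (e : Bimod hS g) (c : Fibre hS g.y), (M.ract e c : Linking hS g) = e * Φy c) ∧
      (∀ e f : Bimod hS g, Φx (M.linner e f) = (e : Linking hS g) * star (f : Linking hS g)) ∧
      (∀ e f : Bimod hS g, Φy (M.rin e f) = star (e : Linking hS g) * (f : Linking hS g))) ∧
    (∃ Ψ : OffDiagLim hS g ≃ₗᵢ[ℂ] Bimod hS g,
      ∀ (a : PairIndex g) (T : compacts (S.A a.dom) (S.X a.mu) (S.X a.lam)),
        (Ψ (offDiagOf hS g a T) : Linking hS g) = linkingOf hS g a (offDiag T)) := by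
  obtain ⟨Φx, Φy, M, h⟩ := exists_imprimitivityBimodule hS g
  -- The same bimodule `E_g` serves for the Morita–Rieffel equivalence and for its concrete
  -- description.
  exact ⟨⟨Bimod hS g, inferInstance, inferInstance, ⟨M⟩⟩, ⟨Φx, Φy, M, h⟩,
    exists_offDiagLim_equiv hS g⟩
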